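/- Let $V$ be a finite-dimensional real Hilbert space with exterior (Grassmann) algebra $\Lambda V$, let $A,C:V\to V$ be linear with $C^T=-C$, and assume that all eigenvalues of $A$ have real part $\le-\lambda_A<0$. Put $M_A=\sup_{t\ge 0}e^{\lambda_A t/2}\|e^{tA}\|<\infty$ and $C_A=\int_0^\infty e^{A^Ts}Ce^{As}\,ds$, and assume $A^TC_A=C_AA$. Let $\mathcal A$ be a unital $C^*$-algebra with a state $\omega$. For a real inner product space $W$, a $W$-Grassmann variable is a unital algebra homomorphism $X:\Lambda W\to\mathcal A$; we write $G(X)=X(G)$ for $G\in\Lambda W$ and $\|X\|=\sup_{|w|=1}\|X(w)\|$. Variables $X$ on $W$ and $Y$ on $W'$ are compatible if $(w,w')\mapsto X(w)+Y(w')$ extends to a homomorphism $\Lambda(W\oplus W')\to\mathcal A$, and independent if moreover $\omega(G(X)H(Y))=\omega(G(X))\,\omega(H(Y))$ for all $G\in\Lambda W$, $H\in\Lambda W'$. Let $\partial_R:\Lambda W\to\Lambda W\otimes W$ be the right derivative, $\partial_R(f_1\cdots f_n)=\sum_k(-1)^{n-k}f_1\cdots\widehat{f_k}\cdots f_n\otimes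 f_k$, and $\langle f\otimes v,w\rangle=\langle v,w\rangle f$. The variable $X$ is Gaussian with covariance (correlation) $D$, where $D:W\to W$ is bounded and antisymmetric, if $\|X\|<\infty$ and $\omega(G(X)X(f))=\omega(\langle\partial_RG,Df\rangle(X))$ for all $G\in\Lambda W$, $f\in W$. Let $\Xi$ be a white noise with correlation $C$, i.e. a Gaussian variable on $L^2(\mathbb R;V)$ with covariance $f\mapsto Cf(\cdot)$. Let $B_t(v)=\Xi(\mathbb 1_{[0,t]}v)$ for $t\ge0$ be its Brownian motion, let $B^A_t(v)=\Xi(\mathbb 1_{(-\infty,t]}(\cdot)\,e^{A(t-\cdot)}v)$, $t\in\mathbb R$, be its Ornstein–Uhlenbeck motion, and let $L=\sup_{t\in\mathbb R}\|B^A_t\|$. Let $X$ be a $V$-Grassmann variable, Gaussian with covariance $C_A$ and independent of the process $(B^A_t)_{t\in\mathbb R}$, and let $K>0$ satisfy $L\le K/3$ and $\|X\|\le K/8$. Let $U\in\Lambda V$ be even and put $$F(v)=\tfrac12\langle C\partial_RU,v\rangle=-\tfrac12\langle\partial_RU,Cv\rangle,\qquad v\in V,$$ where $C$ acts on the second tensor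 factor. (i) For every $\lambda\in\mathbb R$ the functional $\tilde\omega(\cdot)=\omega(\,\cdot\,e^{-\lambda U(X)})$ is invariant for the equation $$\Psi_t(v)=X(v)+\int_0^t\big(\Psi_s(Av)+\lambda\Psi_s(F(v))\big)\,ds+B_t(v),\qquad t\ge0,\ v\in V;$$ that is, this equation has a continuous solution $(\Psi_t)_{t\ge0}$ with values in the $V$-Grassmann variables, and $\tilde\omega(G(\Psi_t))=\tilde\omega(G(\Psi_0))$ for every such solution, all $t\ge 0$ and all $G\in\Lambda V$. (ii) There is $\lambda_0>0$, depending only on $K$, $L$, $F$, $\lambda_A$ and an upper bound for $M_A$ (and not otherwise on $A,C,U,\mathcal A,\omega,X,\Xi$), such that for $|\lambda|\le\lambda_0$ there is exactly one stationary solution of norm at most $K$, i.e. exactly one continuous family $(\Psi^s_t)_{t\in\mathbb R}$ of $V$-Grassmann variables with $\sup_t\|\Psi^s_t\|\le K$ and $$\Psi^s_t(v)=\lambda\int_{-\infty}^t\Psi^s_\tau\big(F(e^{A(t-\tau)}v)\big)\,d\tau+B^A_t(v),\qquad t\in\mathbb R,\ v\in V,$$ and for all $t\in\mathbb R$ and $G\in\Lambda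 V$ $$\omega\big(G(X)e^{-\lambda U(X)}\big)=\omega\big(G(\Psi^s_t)\big)\,\omega\big(e^{-\lambda U(X)}\big).$$ -/

import Mathlib

open MeasureTheory Set

noncomputable section

/-- A state on a unital C⋆-algebra: a continuous, positive, normalised linear functional. -/
def IsState {𝒜 : Type*} [CStarAlgebra 𝒜] (ω : 𝒜 →L[ℂ] ℂ) : Prop :=
  (∀ a : 𝒜, 0 ≤ (ω (star a * a)).re ∧ (ω (star a * a)).im = 0) ∧ ω 1 = 1

/-- A `V`-Grassmann random variable: a unital algebra homomorphism from the Grassmann algebra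
`ΛV` into `𝒜`. The element `F(X)` of `𝒜` is `X F`. -/
abbrev GrassmannRV (V 𝒜 : Type*) [AddCommGroup V] [Module ℝ V] [CStarAlgebra 𝒜] : Type _ :=
  ExteriorAlgebra ℝ V →ₐ[ℝ] 𝒜

/-- Two Grassmann random variables are compatible if the linear map `(v, w) ↦ X(v) + Y(w)`
extends to a homomorphism from `Λ(V ⊕ W)` to `𝒜`. -/
def Compatible {V W 𝒜 : Type*} [AddCommGroup V] [Module ℝ V] [AddCommGroup W] [Module ℝ W]
    [CStarAlgebra 𝒜] (X : GrassmannRV V 𝒜) (Y : GrassmannRV W 𝒜) : Prop :=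
  ∃ Z : GrassmannRV (V × W) 𝒜, ∀ (v : V) (w : W),
    Z (ExteriorAlgebra.ι ℝ (v, w)) = X (ExteriorAlgebra.ι ℝ v) + Y (ExteriorAlgebra.ι ℝ w)

/-- (Tensor) independence of two Grassmann random variables under `ω`. -/
def Independent {V W 𝒜 : Type*} [AddCommGroup V] [Module ℝ V] [AddCommGroup W] [Module ℝ W]
    [CStarAlgebra 𝒜] (ω : 𝒜 →L[ℂ] ℂ) (X : GrassmannRV V 𝒜) (Y : GrassmannRV W 𝒜) : Prop :=
  Compatible X Y ∧ ∀ (G : ExteriorAlgebra ℝ V) (H : ExteriorAlgebra ℝ W),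
    ω (X G * Y H) = ω (X G) * ω (Y H)

section Gaussian

variable {W : Type*} [NormedAddCommGroup W] [InnerProductSpace ℝ W]

/-- The element `⟨∂_R G, w⟩` of `ΛW`, where `∂_R : ΛW → ΛW ⊗ W` is the right derivative,
`∂_R (f₁ ⋯ fₙ) = ∑ₖ (-1)ⁿ⁻ᵏ (f₁ ⋯ f̸ₖ ⋯ fₙ) ⊗ fₖ`, and `⟨f ⊗ v, w⟩ = ⟨v, w⟩ f`.
This is the contraction of `G` from the right by the linear form `⟨·, w⟩`; see
`rightDeriv_one` and `rightDeriv_mul_ι`, which determine it. -/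
def rightDeriv (G : ExteriorAlgebra ℝ W) (w : W) : ExteriorAlgebra ℝ W :=
  CliffordAlgebra.contractRight G (innerₛₗ ℝ w)

theorem rightDeriv_one (w : W) : rightDeriv (1 : ExteriorAlgebra ℝ W) w = 0 :=
  CliffordAlgebra.contractRight_one _ _

theorem rightDeriv_mul_ι (G : ExteriorAlgebra ℝ W) (f w : W) :
    rightDeriv (G * ExteriorAlgebra.ι ℝ f) w
      = inner ℝ f w • G - rightDeriv G w * ExteriorAlgebra.ι ℝ f := by
  have h := CliffordAlgebra.contractRight_mul_ι (Q := (0 : QuadraticForm ℝ W))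
    (d := (innerₛₗ ℝ w : Module.Dual ℝ W)) f G
  rw [real_inner_comm]
  exact h

/-- `X` is a (centred) Grassmann Gaussian variable with correlation `C` under `ω`: the
restriction of `X` to `W` is bounded, and the integration by parts formula
`ω(G(X) X(f)) = ω(⟨∂_R G(X), C f⟩)` holds. -/
def IsGrassmannGaussian {𝒜 : Type*} [CStarAlgebra 𝒜] (ω : 𝒜 →L[ℂ] ℂ) (C : W →L[ℝ] W)
    (X : GrassmannRV W 𝒜) : Prop :=
  (∃ c : ℝ, ∀ w : W, ‖X (ExteriorAlgebra.ι ℝ w)‖ ≤ c * ‖w‖) ∧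
  ∀ (G : ExteriorAlgebra ℝ W) (f : W),
    ω (X G * X (ExteriorAlgebra.ι ℝ f)) = ω (X (rightDeriv G (C f)))

end Gaussian

section Noise

variable {V : Type*} [NormedAddCommGroup V] [InnerProductSpace ℝ V]
variable {𝒜 : Type*} [CStarAlgebra 𝒜]

/-- `Ξ` is a `V`-valued one-dimensional white noise with correlation `C`: a Grassmann Gaussian
variable on `L²(ℝ; V)` whose correlation is `(C̃ f)(x) = C (f x)`. -/
def IsWhiteNoise (ω : 𝒜 →L[ℂ] ℂ) (C : V →L[ℝ] V)
    (Ξ : GrassmannRV (Lp V 2 (volume : Measure ℝ)) 𝒜) : Prop :=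
  IsGrassmannGaussian ω (C.compLpL 2 (volume : Measure ℝ)) Ξ

/-- The Brownian motion of the noise `Ξ`, `B_t(v) = Ξ(𝟙_{[0,t]} ⊗ v)` for `t ≥ 0`. -/
def brownianMotion (Ξ : GrassmannRV (Lp V 2 (volume : Measure ℝ)) 𝒜) (t : ℝ) (v : V) : 𝒜 :=
  Ξ (ExteriorAlgebra.ι ℝ (indicatorConstLp 2 (measurableSet_Icc (a := (0 : ℝ)) (b := t))
    (measure_Icc_lt_top (μ := (volume : Measure ℝ))).ne v))

/-- The function `s ↦ 𝟙_{(-∞,t]}(s) e^{A(t-s)} v`. -/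
def ouFun (A : V →L[ℝ] V) (t : ℝ) (v : V) : ℝ → V :=
  (Iic t).indicator fun s => NormedSpace.exp ((t - s) • A) v

theorem ouFun_add (A : V →L[ℝ] V) (t : ℝ) (v w : V) :
    ouFun A t (v + w) = ouFun A t v + ouFun A t w := by
  ext s
  by_cases h : s ∈ Iic t <;> simp [ouFun, h]

theorem ouFun_smul (A : V →L[ℝ] V) (t : ℝ) (c : ℝ) (v : V) :
    ouFun A t (c • v) = c • ouFun A t v := by
  ext s
  by_cases h : s ∈ Iic t <;> simp [ouFun, h]

open Classical in
/-- The map `v ↦ 𝟙_{(-∞,t]}(·) e^{A(t-·)} v` from `V` to `L²(ℝ; V)`. (The functions are square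
integrable whenever all eigenvalues of `A` have negative real part; otherwise the value is `0`.) -/
def ouKernel (A : V →L[ℝ] V) (t : ℝ) : V →ₗ[ℝ] Lp V 2 (volume : Measure ℝ) :=
  if h : ∀ v : V, MemLp (ouFun A t v) 2 (volume : Measure ℝ) then
    { toFun := fun v => (h v).toLp (ouFun A t v)
      map_add' := fun v w => by
        rw [← MemLp.toLp_add (h v) (h w)]
        exact MemLp.toLp_congr _ _ (by rw [ouFun_add])
      map_smul' := fun c v => by
        rw [RingHom.id_apply, ← MemLp.toLp_const_smul c (h v)]
        exact MemLp.toLp_congr _ _ (by rw [ouFun_smul]) }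
  else 0

/-- The Ornstein-Uhlenbeck motion at time `t`, `B^A_t(v) = Ξ(𝟙_{(-∞,t]}(·) e^{A(t-·)} v)`. -/
def ouMotion (A : V →L[ℝ] V) (Ξ : GrassmannRV (Lp V 2 (volume : Measure ℝ)) 𝒜) (t : ℝ) :
    GrassmannRV V 𝒜 :=
  Ξ.comp (ExteriorAlgebra.map (ouKernel A t))

/-- The whole process `(B^A_t)_{t ∈ ℝ}` as one Grassmann random variable, on the direct sum of
copies of `V` indexed by the times `t ∈ ℝ`: the generator `v` in the copy of index `t` is sent
to `B^A_t(v)`. Independence of this variable is independence of all finite families of the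
`B^A_t`. -/
def ouProcess (A : V →L[ℝ] V) (Ξ : GrassmannRV (Lp V 2 (volume : Measure ℝ)) 𝒜) :
    GrassmannRV (ℝ →₀ V) 𝒜 :=
  Ξ.comp (ExteriorAlgebra.map (Finsupp.lsum ℝ fun t : ℝ => ouKernel A t))

theorem ouProcess_single (A : V →L[ℝ] V) (Ξ : GrassmannRV (Lp V 2 (volume : Measure ℝ)) 𝒜)
    (t : ℝ) (v : V) :
    ouProcess A Ξ (ExteriorAlgebra.ι ℝ (Finsupp.single t v))
      = ouMotion A Ξ t (ExteriorAlgebra.ι ℝ v) := by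
  simp [ouProcess, ouMotion]

/-- `C_A = ∫₀^∞ e^{Aᵀ s} C e^{A s} ds`. -/
def ouCovariance [CompleteSpace V] (A C : V →L[ℝ] V) : V →L[ℝ] V :=
  ∫ s in Ioi (0 : ℝ), NormedSpace.exp (s • ContinuousLinearMap.adjoint A) ∘L C ∘L
    NormedSpace.exp (s • A)

/-- All (complex) eigenvalues of `A` have real part at most `-lamA`. -/
def EigenvaluesLE (A : V →L[ℝ] V) (lamA : ℝ) : Prop :=
  ∀ z : ℂ, Module.End.HasEigenvalue (LinearMap.baseChange ℂ (A : V →ₗ[ℝ] V)) z → z.re ≤ -lamA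

/-- `sup_{t ≥ 0} e^{lamA t / 2} ‖e^{tA}‖`, finite if all eigenvalues of `A` have real part at most
`-lamA < 0`. -/
def growthConst (A : V →L[ℝ] V) (lamA : ℝ) : ℝ :=
  ⨆ t : NNReal, Real.exp (lamA * t / 2) * ‖NormedSpace.exp ((t : ℝ) • A)‖

end Noise

section Dynamics

variable {V : Type*} [NormedAddCommGroup V] [InnerProductSpace ℝ V]
variable {𝒜 : Type*} [CStarAlgebra 𝒜]

/-- The drift `F(v) = ½ ⟨C ∂_R U, v⟩ = -½ ⟨∂_R U, C v⟩` of the potential `U`, for an antisymmetric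
`C`. -/
def langevinDrift (C : V →L[ℝ] V) (U : ExteriorAlgebra ℝ V) : V →ₗ[ℝ] ExteriorAlgebra ℝ V where
  toFun v := -((1 / 2 : ℝ) • rightDeriv U (C v))
  map_add' v w := by simp [rightDeriv, add_comm]
  map_smul' c v := by simp [rightDeriv, smul_comm c]

variable [FiniteDimensional ℝ V]

/-- The restriction of `X` to `V`, as a continuous linear map. Its operator norm is the norm
`‖X‖ = sup_{|v| = 1} ‖X(v)‖` of `X`, and the distance of `X` and `Y` is the operator norm of the
difference of the restrictions. -/
def GrassmannRV.lin (X : GrassmannRV V 𝒜) : V →L[ℝ] 𝒜 :=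
  LinearMap.toContinuousLinearMap (X.toLinearMap ∘ₗ ExteriorAlgebra.ι ℝ)

/-- `Ψ` (used at times `t ≥ 0` only) is a solution with initial condition `X` of the equation
`Ψ_t(v) = X(v) + ∫₀ᵗ (Ψ_s(A v) + lam Ψ_s(F(v))) ds + B_t(v)`. -/
structure IsSDESolution (A : V →L[ℝ] V) (F : V →ₗ[ℝ] ExteriorAlgebra ℝ V) (lam : ℝ)
    (Ξ : GrassmannRV (Lp V 2 (volume : Measure ℝ)) 𝒜) (X : GrassmannRV V 𝒜)
    (Ψ : ℝ → GrassmannRV V 𝒜) : Prop where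
  continuousOn : ContinuousOn (fun t => (Ψ t).lin) (Ici 0)
  equation : ∀ t : ℝ, 0 ≤ t → ∀ v : V,
    Ψ t (ExteriorAlgebra.ι ℝ v) = X (ExteriorAlgebra.ι ℝ v)
      + (∫ s in (0 : ℝ)..t, (Ψ s (ExteriorAlgebra.ι ℝ (A v)) + lam • Ψ s (F v)))
      + brownianMotion Ξ t v

/-- `ρ` is an invariant measure for the equation with drift `A + lam F`, noise `Ξ` and initial
condition `X`: the equation has a global solution, and `ρ(G(Ψ_t)) = ρ(G(Ψ_0))` for every solution
`Ψ`, every `G` and every `t ≥ 0`. -/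
def IsInvariantMeasure (ρ : 𝒜 →L[ℂ] ℂ) (A : V →L[ℝ] V) (F : V →ₗ[ℝ] ExteriorAlgebra ℝ V)
    (lam : ℝ) (Ξ : GrassmannRV (Lp V 2 (volume : Measure ℝ)) 𝒜) (X : GrassmannRV V 𝒜) : Prop :=
  (∃ Ψ : ℝ → GrassmannRV V 𝒜, IsSDESolution A F lam Ξ X Ψ) ∧
  ∀ Ψ : ℝ → GrassmannRV V 𝒜, IsSDESolution A F lam Ξ X Ψ →
    ∀ t : ℝ, 0 ≤ t → ∀ G : ExteriorAlgebra ℝ V, ρ (Ψ t G) = ρ (Ψ 0 G)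

/-- `Ψ` is a stationary solution of norm at most `K`: a continuous function from `ℝ` to the
Grassmann random variables, bounded by `K`, with
`Ψ_t(v) = lam ∫_{-∞}^t Ψ_τ(F(e^{A(t-τ)} v)) dτ + B^A_t(v)`. -/
structure IsStationarySolution (A : V →L[ℝ] V) (F : V →ₗ[ℝ] ExteriorAlgebra ℝ V) (lam : ℝ)
    (Ξ : GrassmannRV (Lp V 2 (volume : Measure ℝ)) 𝒜) (K : ℝ)
    (Ψ : ℝ → GrassmannRV V 𝒜) : Prop where
  continuous : Continuous fun t => (Ψ t).lin
  norm_le : ∀ t : ℝ, ‖(Ψ t).lin‖ ≤ K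
  equation : ∀ (t : ℝ) (v : V),
    Ψ t (ExteriorAlgebra.ι ℝ v)
      = lam • (∫ τ in Iic t, Ψ τ (F (NormedSpace.exp ((t - τ) • A) v)))
        + ouMotion A Ξ t (ExteriorAlgebra.ι ℝ v)

/-- The functional `ω(· h)`. -/
def tilt (ω : 𝒜 →L[ℂ] ℂ) (h : 𝒜) : 𝒜 →L[ℂ] ℂ :=
  ω.comp ((ContinuousLinearMap.mul ℂ 𝒜).flip h)

end Dynamics

end

noncomputable section
open Filter Topology

/-! ### The exterior algebra -/

section Exterior

variable {W : Type*} [AddCommGroup W] [Module ℝ W]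

/-! Algebraic core. The Lyapunov equation for C_A (`adjoint_comp_ouCovariance_add`) and the
commutation hypothesis give C_A A = -C/2, a detailed balance relation. Let the generator be L G = ∑ᵢ
(½ ∂_{Ceᵢ} ∂_{eᵢ} G + ∂_{eᵢ}G · (A eᵢ + λ F(eᵢ))) for an orthonormal basis e. Gaussian integration
by parts against the density E = e^{-λU(X)} turns each term ∂_{eᵢ}G · A eᵢ into a second-order term
and a term containing ∂U; these cancel the diffusion and the nonlinear drift. Hence ω((L G)(X) E) =
0 for every G (`IsGrassmannGaussian.generator_eq_zero`).

Invariance. Solutions are adapted, and a noise increment after time t has zero correlation with the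
history up to t and quadratic covariation of order h. This yields an Itô formula
(`IsInfinitesimalIncrement.ito`): the right derivative of ω(G(Ψ_t) c) is ω((L G)(Ψ_t) c) for c in
the history algebra. Take c = E. Since ΛV is finite-dimensional, the functionals G ↦ ω(G(Ψ_t) E)
obey a linear ODE, which the constant functional G ↦ ω(G(X) E) also solves. Uniqueness
(`eq_zero_of_linear_ode`) gives `gibbs_invariant`.

Global existence for all λ. The drift is polynomial, but nilpotency prevents blow-up. A continuous
odd forcing is, up to a uniformly small error, a finite sum of terms α(t) θ with θ odd. The equation
with small forcing is solved by contraction. Adding one term αθ perturbs the solution inside the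
ideal generated by θ, where products of two elements vanish; the perturbation therefore solves an
affine equation (`HasSolutionIn.add_smulRight`, `exists_global_solution`).

Stationary solutions. The drift is bounded and Lipschitz on balls with constants that do not depend
on the algebra, so for small λ the mild equation on the line is a contraction
(`exists_volterra_solution`). Solutions started from X at time t - n converge exponentially to the
stationary one (`IsMildStationary.exists_relaxing`). Each of them has tilted law ω(G(X) E) at time
t, so the limit u_t has it as well. Finally u_t is a limit of functions of the noise alone, E
depends on X alone, and E is even; independence factorises ω(G(u_t) E), which is the identity in
(ii) (`IsMildStationary.expectation`).

All analysis takes place in closures of odd parts of algebras generated by X and the noise. These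
are closed subspaces of anticommuting elements, so limits and integrals in them still define
Grassmann variables. -/

theorem ExteriorAlgebra.right_induction {P : ExteriorAlgebra ℝ W → Prop}
    (algebraMap : ∀ r : ℝ, P (algebraMap ℝ _ r)) (add : ∀ x y, P x → P y → P (x + y))
    (mul_ι : ∀ x m, P x → P (x * ExteriorAlgebra.ι ℝ m)) (x : ExteriorAlgebra ℝ W) : P x :=
  CliffordAlgebra.right_induction (Q := (0 : QuadraticForm ℝ W)) algebraMap add
    (fun m x => mul_ι x m) x

theorem ExteriorAlgebra.ι_anticomm (v w : W) :
    ExteriorAlgebra.ι ℝ v * ExteriorAlgebra.ι ℝ w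
      = -(ExteriorAlgebra.ι ℝ w * ExteriorAlgebra.ι ℝ v) :=
  eq_neg_of_add_eq_zero_left (ExteriorAlgebra.ι_add_mul_swap v w)

/-- The grade involution of the exterior algebra. -/
abbrev ExteriorAlgebra.involute : ExteriorAlgebra ℝ W →ₐ[ℝ] ExteriorAlgebra ℝ W :=
  CliffordAlgebra.involute (Q := (0 : QuadraticForm ℝ W))

theorem ExteriorAlgebra.involute_ι (w : W) :
    ExteriorAlgebra.involute (ExteriorAlgebra.ι ℝ w) = -ExteriorAlgebra.ι ℝ w :=
  CliffordAlgebra.involute_ι w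

theorem ExteriorAlgebra.mul_ι_eq (G : ExteriorAlgebra ℝ W) (w : W) :
    G * ExteriorAlgebra.ι ℝ w = ExteriorAlgebra.ι ℝ w * ExteriorAlgebra.involute G := by
  induction G using ExteriorAlgebra.right_induction with
  | algebraMap r => rw [AlgHom.commutes, Algebra.commutes]
  | add x y hx hy => rw [map_add, add_mul, hx, hy, mul_add]
  | mul_ι x m hx =>
    rw [map_mul, ExteriorAlgebra.involute_ι, ← mul_assoc, ← hx, mul_assoc,
      ExteriorAlgebra.ι_anticomm m w, mul_neg, mul_neg, mul_assoc]

/-- The even and odd parts of the exterior algebra. -/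
abbrev ExteriorAlgebra.parity (W : Type*) [AddCommGroup W] [Module ℝ W] (i : ZMod 2) :
    Submodule ℝ (ExteriorAlgebra ℝ W) :=
  CliffordAlgebra.evenOdd (0 : QuadraticForm ℝ W) i

theorem ExteriorAlgebra.even_commute {a : ExteriorAlgebra ℝ W}
    (ha : a ∈ ExteriorAlgebra.parity W 0) (b : ExteriorAlgebra ℝ W) : a * b = b * a := by
  have h : ∀ w, a * ExteriorAlgebra.ι ℝ w = ExteriorAlgebra.ι ℝ w * a := fun w => by
    rw [ExteriorAlgebra.mul_ι_eq]
    congr 1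
    exact CliffordAlgebra.involute_eq_of_mem_even ha
  induction b using ExteriorAlgebra.right_induction with
  | algebraMap r => rw [Algebra.commutes]
  | add x y hx hy => rw [mul_add, hx, hy, add_mul]
  | mul_ι x m hx => rw [← mul_assoc, hx, mul_assoc, h, mul_assoc]

theorem ExteriorAlgebra.odd_anticomm {a b : ExteriorAlgebra ℝ W}
    (ha : a ∈ ExteriorAlgebra.parity W 1) (hb : b ∈ ExteriorAlgebra.parity W 1) :
    a * b = -(b * a) := by
  have h : ∀ w, a * ExteriorAlgebra.ι ℝ w = -(ExteriorAlgebra.ι ℝ w * a) := fun w => by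
    rw [ExteriorAlgebra.mul_ι_eq, ← mul_neg]
    congr 1
    exact CliffordAlgebra.involute_eq_of_mem_odd ha
  induction b, hb using CliffordAlgebra.odd_induction with
  | ι v => exact h v
  | add x y hx hy h1 h2 => rw [mul_add, h1, h2, add_mul, neg_add]
  | ι_mul_ι_mul v w x hx ih =>
    have e1 : a * (ExteriorAlgebra.ι ℝ v * ExteriorAlgebra.ι ℝ w * x)
      = (ExteriorAlgebra.ι ℝ v * ExteriorAlgebra.ι ℝ w) * (a * x) := by
      rw [mul_assoc, ← mul_assoc, h v, neg_mul, mul_assoc, ← mul_assoc a, h w]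
      noncomm_ring
    refine e1.trans ?_
    rw [ih, mul_neg]
    exact congrArg Neg.neg (mul_assoc _ _ _).symm

instance ExteriorAlgebra.finite [Module.Finite ℝ W] : Module.Finite ℝ (ExteriorAlgebra ℝ W) := by
  classical
  let b := Module.finBasis ℝ W
  exact Module.Finite.of_basis b.ExteriorAlgebra

/-- Right contraction of the exterior algebra by a linear form. -/
abbrev ExteriorAlgebra.contractRight (G : ExteriorAlgebra ℝ W) (d : Module.Dual ℝ W) :
    ExteriorAlgebra ℝ W :=
  CliffordAlgebra.contractRight (Q := (0 : QuadraticForm ℝ W)) G d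

theorem ExteriorAlgebra.contractRight_mul_ι (G : ExteriorAlgebra ℝ W) (d : Module.Dual ℝ W)
    (w : W) :
    ExteriorAlgebra.contractRight (G * ExteriorAlgebra.ι ℝ w) d
      = d w • G - ExteriorAlgebra.contractRight G d * ExteriorAlgebra.ι ℝ w :=
  CliffordAlgebra.contractRight_mul_ι (Q := (0 : QuadraticForm ℝ W)) (d := d) w G

theorem ExteriorAlgebra.contractRight_algebraMap (d : Module.Dual ℝ W) (r : ℝ) :
    ExteriorAlgebra.contractRight (algebraMap ℝ (ExteriorAlgebra ℝ W) r) d = 0 :=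
  CliffordAlgebra.contractRight_algebraMap (Q := (0 : QuadraticForm ℝ W)) d r

theorem ExteriorAlgebra.contractRight_map {W' : Type*} [AddCommGroup W'] [Module ℝ W']
    (f : W →ₗ[ℝ] W') (G : ExteriorAlgebra ℝ W) (d : Module.Dual ℝ W') :
    ExteriorAlgebra.contractRight (ExteriorAlgebra.map f G) d
      = ExteriorAlgebra.map f (ExteriorAlgebra.contractRight G (d ∘ₗ f)) := by
  induction G using ExteriorAlgebra.right_induction with
  | algebraMap r =>
    rw [AlgHom.commutes, ExteriorAlgebra.contractRight_algebraMap,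
      ExteriorAlgebra.contractRight_algebraMap, map_zero]
  | add x y hx hy => simp only [ExteriorAlgebra.contractRight] at hx hy ⊢; simp [hx, hy]
  | mul_ι x m hx =>
    rw [map_mul, ExteriorAlgebra.map_apply_ι, ExteriorAlgebra.contractRight_mul_ι, hx,
      ExteriorAlgebra.contractRight_mul_ι, map_sub, map_mul, map_smul,
      ExteriorAlgebra.map_apply_ι]
    rfl

theorem ExteriorAlgebra.contractRight_zero (G : ExteriorAlgebra ℝ W) :
    ExteriorAlgebra.contractRight G 0 = 0 := by
  simp [ExteriorAlgebra.contractRight]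

/-- The right contraction is an antiderivation from the right. -/
theorem ExteriorAlgebra.contractRight_mul (G H : ExteriorAlgebra ℝ W) (d : Module.Dual ℝ W) :
    ExteriorAlgebra.contractRight (G * H) d = G * ExteriorAlgebra.contractRight H d
      + ExteriorAlgebra.contractRight G d * ExteriorAlgebra.involute H := by
  induction H using ExteriorAlgebra.right_induction with
  | algebraMap r =>
    rw [AlgHom.commutes, ExteriorAlgebra.contractRight_algebraMap, mul_zero, zero_add,
      ← Algebra.commutes, ← Algebra.commutes, ← Algebra.smul_def, ← Algebra.smul_def]
    simp [ExteriorAlgebra.contractRight]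
  | add x y hx hy =>
    rw [map_add, mul_add, mul_add]
    have e : ∀ a b : ExteriorAlgebra ℝ W, ExteriorAlgebra.contractRight (a + b) d
        = ExteriorAlgebra.contractRight a d + ExteriorAlgebra.contractRight b d := by
      intro a b; simp [ExteriorAlgebra.contractRight]
    rw [e, e, hx, hy]
    noncomm_ring
  | mul_ι x m hx =>
    rw [← mul_assoc, ExteriorAlgebra.contractRight_mul_ι, hx,
      ExteriorAlgebra.contractRight_mul_ι, map_mul, ExteriorAlgebra.involute_ι, mul_sub,
      add_mul, mul_smul_comm]
    noncomm_ring

theorem ExteriorAlgebra.contractRight_mem {a : ExteriorAlgebra ℝ W}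
    (ha : a ∈ ExteriorAlgebra.parity W 0) (d : Module.Dual ℝ W) :
    ExteriorAlgebra.contractRight a d ∈ ExteriorAlgebra.parity W 1 := by
  induction a, ha using CliffordAlgebra.even_induction with
  | algebraMap r =>
    have := ExteriorAlgebra.contractRight_algebraMap d r
    exact this.symm ▸ Submodule.zero_mem _
  | add x y hx hy h1 h2 =>
    have : ExteriorAlgebra.contractRight (x + y) d = ExteriorAlgebra.contractRight x d
      + ExteriorAlgebra.contractRight y d := by simp [ExteriorAlgebra.contractRight]
    rw [this]
    exact Submodule.add_mem _ h1 h2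
  | ι_mul_ι_mul v w x hx ih =>
    have e0 : ExteriorAlgebra.involute x = x := CliffordAlgebra.involute_eq_of_mem_even hx
    have e : ExteriorAlgebra.contractRight
        (ExteriorAlgebra.ι ℝ v * ExteriorAlgebra.ι ℝ w * x) d
        = ExteriorAlgebra.ι ℝ v * ExteriorAlgebra.ι ℝ w * ExteriorAlgebra.contractRight x d
          + (d w • ExteriorAlgebra.ι ℝ v - d v • ExteriorAlgebra.ι ℝ w) * x := by
      have h1 : ExteriorAlgebra.contractRight (ExteriorAlgebra.ι ℝ v) d
          = algebraMap ℝ (ExteriorAlgebra ℝ W) (d v) :=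
        CliffordAlgebra.contractRight_ι (Q := (0 : QuadraticForm ℝ W)) d v
      rw [ExteriorAlgebra.contractRight_mul, e0, ExteriorAlgebra.contractRight_mul_ι, h1,
        Algebra.smul_def (d v)]
    refine e.symm ▸ Submodule.add_mem _ ?_ ?_
    · exact zero_add (1 : ZMod 2) ▸ SetLike.mul_mem_graded
        (CliffordAlgebra.ι_mul_ι_mem_evenOdd_zero _ v w) ih
    · exact add_zero (1 : ZMod 2) ▸ SetLike.mul_mem_graded (Submodule.sub_mem _
        (Submodule.smul_mem _ _ (CliffordAlgebra.ι_mem_evenOdd_one _ _))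
        (Submodule.smul_mem _ _ (CliffordAlgebra.ι_mem_evenOdd_one _ _))) hx

end Exterior

theorem langevinDrift_mem {V : Type*} [NormedAddCommGroup V] [InnerProductSpace ℝ V]
    (C : V →L[ℝ] V) {U : ExteriorAlgebra ℝ V} (hU : U ∈ ExteriorAlgebra.parity V 0) (v : V) :
    langevinDrift C U v ∈ ExteriorAlgebra.parity V 1 :=
  Submodule.neg_mem _ (Submodule.smul_mem _ _ (ExteriorAlgebra.contractRight_mem hU _))

/-! ### Closed subspaces of odd elements -/

section OddSubspace

variable {𝒜 : Type*} [CStarAlgebra 𝒜]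

/-- A closed subspace whose elements pairwise anticommute and which contains all triple
products of its elements. -/
structure IsOddSubspace (O : Submodule ℝ 𝒜) : Prop where
  isClosed : IsClosed (O : Set 𝒜)
  anticomm : ∀ a ∈ O, ∀ b ∈ O, a * b = -(b * a)
  mul_mem : ∀ a ∈ O, ∀ b ∈ O, ∀ c ∈ O, a * b * c ∈ O

theorem IsOddSubspace.mul_self {O : Submodule ℝ 𝒜} (hO : IsOddSubspace O) {a : 𝒜} (ha : a ∈ O) :
    a * a = 0 := by
  have h := hO.anticomm a ha a ha
  have h2 : (2 : ℝ) • (a * a) = 0 := by rw [two_smul]; nth_rewrite 1 [h]; simp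
  exact (smul_eq_zero.mp h2).resolve_left two_ne_zero

variable {W : Type*} [AddCommGroup W] [Module ℝ W]

/-- The closure of the image of the odd part of `ΛW` under a Grassmann random variable. -/
def oddClosure (Z : GrassmannRV W 𝒜) : Submodule ℝ 𝒜 :=
  ((ExteriorAlgebra.parity W 1).map Z.toLinearMap).topologicalClosure

/-- The closure of the image of `ΛW` under a Grassmann random variable. -/
def algClosure (Z : GrassmannRV W 𝒜) : Subalgebra ℝ 𝒜 := Z.range.topologicalClosure

theorem oddClosure_le_algClosure (Z : GrassmannRV W 𝒜) {a : 𝒜} (ha : a ∈ oddClosure Z) :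
    a ∈ algClosure Z := by
  refine closure_mono ?_ ha
  rintro _ ⟨G, -, rfl⟩
  exact ⟨G, rfl⟩

/-- Anticommutation and stability under triple products hold for odd polynomials and pass to the
closure by joint continuity of multiplication. This is how compatibility enters: with one `Z` for X
and the noise, everything built from both stays in one odd subspace. -/
theorem isOddSubspace_oddClosure (Z : GrassmannRV W 𝒜) : IsOddSubspace (oddClosure Z) where
  isClosed := Submodule.isClosed_topologicalClosure _
  anticomm a ha b hb := by
    have h : IsClosed {p : 𝒜 × 𝒜 | p.1 * p.2 = -(p.2 * p.1)} :=
      isClosed_eq (by fun_prop) (by fun_prop)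
    have hab : (a, b) ∈ closure ((((ExteriorAlgebra.parity W 1).map Z.toLinearMap :
        Submodule ℝ 𝒜) : Set 𝒜) ×ˢ (((ExteriorAlgebra.parity W 1).map Z.toLinearMap :
        Submodule ℝ 𝒜) : Set 𝒜)) := by
      rw [closure_prod_eq]; exact ⟨ha, hb⟩
    refine closure_minimal ?_ h hab
    rintro ⟨_, _⟩ ⟨⟨x, hx, rfl⟩, ⟨y, hy, rfl⟩⟩
    change Z x * Z y = -(Z y * Z x)
    rw [← map_mul, ← map_mul, ← map_neg, ExteriorAlgebra.odd_anticomm hx hy]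
  mul_mem a ha b hb c hc := by
    have h1 : a * b ∈ closure {z | ∃ G ∈ ExteriorAlgebra.parity W 0, Z G = z} := by
      refine map_mem_closure₂ (f := fun x y : 𝒜 => x * y) (by fun_prop) ha hb ?_
      rintro _ ⟨x, hx, rfl⟩ _ ⟨y, hy, rfl⟩
      refine ⟨x * y, ?_, map_mul Z x y⟩
      exact SetLike.mul_mem_graded (i := (1 : ZMod 2)) (j := 1) hx hy
    refine map_mem_closure₂ (f := fun x y : 𝒜 => x * y) (by fun_prop) h1 hc ?_
    rintro _ ⟨x, hx, rfl⟩ _ ⟨y, hy, rfl⟩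
    exact ⟨x * y, zero_add (1 : ZMod 2) ▸ SetLike.mul_mem_graded hx hy, map_mul Z x y⟩

theorem apply_mem_oddClosure (Z : GrassmannRV W 𝒜) {G : ExteriorAlgebra ℝ W}
    (hG : G ∈ ExteriorAlgebra.parity W 1) : Z G ∈ oddClosure Z :=
  subset_closure ⟨G, hG, rfl⟩

theorem apply_ι_mem_oddClosure (Z : GrassmannRV W 𝒜) (w : W) :
    Z (ExteriorAlgebra.ι ℝ w) ∈ oddClosure Z :=
  apply_mem_oddClosure Z (CliffordAlgebra.ι_mem_evenOdd_one _ _)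

theorem ExteriorAlgebra.map_mem_parity {W' : Type*} [AddCommGroup W'] [Module ℝ W']
    (f : W →ₗ[ℝ] W') {G : ExteriorAlgebra ℝ W} (hG : G ∈ ExteriorAlgebra.parity W 1) :
    ExteriorAlgebra.map f G ∈ ExteriorAlgebra.parity W' 1 := by
  induction G, hG using CliffordAlgebra.odd_induction with
  | ι v =>
    have : ExteriorAlgebra.map f (ExteriorAlgebra.ι ℝ v) = ExteriorAlgebra.ι ℝ (f v) :=
      ExteriorAlgebra.map_apply_ι f v
    exact this.symm ▸ CliffordAlgebra.ι_mem_evenOdd_one _ _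
  | add x y hx hy h1 h2 => rw [map_add]; exact Submodule.add_mem _ h1 h2
  | ι_mul_ι_mul v w x hx ih =>
    have : ExteriorAlgebra.map f (ExteriorAlgebra.ι ℝ v * ExteriorAlgebra.ι ℝ w * x)
      = ExteriorAlgebra.ι ℝ (f v) * ExteriorAlgebra.ι ℝ (f w) * ExteriorAlgebra.map f x := by
      simp only [map_mul, ExteriorAlgebra.map_apply_ι]
    exact this.symm ▸ (zero_add (1 : ZMod 2) ▸ SetLike.mul_mem_graded
      (CliffordAlgebra.ι_mul_ι_mem_evenOdd_zero _ (f v) (f w)) ih)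

theorem oddClosure_comp_map_le {W' : Type*} [AddCommGroup W'] [Module ℝ W']
    (Z : GrassmannRV W' 𝒜) (f : W →ₗ[ℝ] W') :
    oddClosure (Z.comp (ExteriorAlgebra.map f)) ≤ oddClosure Z := by
  refine Submodule.topologicalClosure_mono ?_
  rintro _ ⟨G, hG, rfl⟩
  exact ⟨_, ExteriorAlgebra.map_mem_parity f hG, rfl⟩

end OddSubspace

end

noncomputable section
open Filter Topology

/-! ### Grassmann random variables from linear maps -/

section EvalRV

variable {V : Type*} [NormedAddCommGroup V] [InnerProductSpace ℝ V]
variable {𝒜 : Type*} [CStarAlgebra 𝒜]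

/-- A linear map all of whose values square to zero. -/
def IsNull (ψ : V →L[ℝ] 𝒜) : Prop := ∀ v, ψ v * ψ v = 0

theorem isNull_zero : IsNull (0 : V →L[ℝ] 𝒜) := fun v => by simp

open Classical in
/-- The Grassmann random variable extending a linear map all of whose values square to zero
(and the extension of `0` for other maps). -/
def evalRV (ψ : V →L[ℝ] 𝒜) : GrassmannRV V 𝒜 :=
  if h : IsNull ψ then ExteriorAlgebra.lift ℝ ⟨(ψ : V →ₗ[ℝ] 𝒜), h⟩
  else ExteriorAlgebra.lift ℝ ⟨0, fun _ => mul_zero _⟩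

theorem evalRV_ι {ψ : V →L[ℝ] 𝒜} (h : IsNull ψ) (v : V) :
    evalRV ψ (ExteriorAlgebra.ι ℝ v) = ψ v := by
  rw [evalRV, dif_pos h]
  exact ExteriorAlgebra.lift_ι_apply ℝ _ _ v

theorem IsOddSubspace.isNull {O : Submodule ℝ 𝒜} (hO : IsOddSubspace O) {ψ : V →L[ℝ] 𝒜}
    (h : ∀ v, ψ v ∈ O) : IsNull ψ := fun v => hO.mul_self (h v)

theorem IsOddSubspace.evalRV_mem {O : Submodule ℝ 𝒜} (hO : IsOddSubspace O) {ψ : V →L[ℝ] 𝒜}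
    (h : ∀ v, ψ v ∈ O) {G : ExteriorAlgebra ℝ V} (hG : G ∈ ExteriorAlgebra.parity V 1) :
    evalRV ψ G ∈ O := by
  induction G, hG using CliffordAlgebra.odd_induction with
  | ι v =>
    have := evalRV_ι (hO.isNull h) v
    exact this.symm ▸ h v
  | add x y hx hy h1 h2 => rw [map_add]; exact O.add_mem h1 h2
  | ι_mul_ι_mul v w x hx ih =>
    have : evalRV ψ (ExteriorAlgebra.ι ℝ v * ExteriorAlgebra.ι ℝ w * x)
        = ψ v * ψ w * evalRV ψ x := by
      rw [map_mul, map_mul, evalRV_ι (hO.isNull h), evalRV_ι (hO.isNull h)]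
    exact this.symm ▸ hO.mul_mem _ (h v) _ (h w) _ ih

theorem evalRV_mem_subalgebra {S : Subalgebra ℝ 𝒜} {ψ : V →L[ℝ] 𝒜} (hψ : IsNull ψ)
    (h : ∀ v, ψ v ∈ S) (G : ExteriorAlgebra ℝ V) : evalRV ψ G ∈ S := by
  induction G using ExteriorAlgebra.right_induction with
  | algebraMap r => rw [AlgHom.commutes]; exact S.algebraMap_mem r
  | add x y hx hy => rw [map_add]; exact S.add_mem hx hy
  | mul_ι x m hx => rw [map_mul, evalRV_ι hψ]; exact S.mul_mem hx (h m)

theorem tendsto_evalRV {α : Type*} {l : Filter α} {u : α → V →L[ℝ] 𝒜} {ψ : V →L[ℝ] 𝒜}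
    (hu : Tendsto u l (𝓝 ψ)) (hn : ∀ᶠ i in l, IsNull (u i)) (hψ : IsNull ψ)
    (G : ExteriorAlgebra ℝ V) : Tendsto (fun i => evalRV (u i) G) l (𝓝 (evalRV ψ G)) := by
  induction G using ExteriorAlgebra.right_induction with
  | algebraMap r => simp only [AlgHom.commutes]; exact tendsto_const_nhds
  | add x y hx hy => simp only [map_add]; exact hx.add hy
  | mul_ι x m hx =>
    simp only [map_mul]
    refine hx.mul ?_
    rw [evalRV_ι hψ]
    have h : Tendsto (fun i => u i m) l (𝓝 (ψ m)) :=
      ((ContinuousLinearMap.apply ℝ 𝒜 m).continuous.tendsto ψ).comp hu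
    refine h.congr' ?_
    filter_upwards [hn] with i hi
    rw [evalRV_ι hi]

theorem continuousOn_evalRV {s : Set ℝ} {u : ℝ → V →L[ℝ] 𝒜} (hu : ContinuousOn u s)
    (hn : ∀ t ∈ s, IsNull (u t)) (G : ExteriorAlgebra ℝ V) :
    ContinuousOn (fun t => evalRV (u t) G) s := fun t ht =>
  tendsto_evalRV (hu t ht) (eventually_mem_nhdsWithin.mono hn) (hn t ht) G

variable [FiniteDimensional ℝ V]

theorem GrassmannRV.lin_apply (X : GrassmannRV V 𝒜) (v : V) :
    X.lin v = X (ExteriorAlgebra.ι ℝ v) := rfl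

theorem GrassmannRV.isNull_lin (X : GrassmannRV V 𝒜) : IsNull X.lin := fun v => by
  rw [X.lin_apply, ← map_mul, ExteriorAlgebra.ι_sq_zero, map_zero]

theorem evalRV_lin (X : GrassmannRV V 𝒜) : evalRV X.lin = X := by
  ext v
  simp [evalRV_ι X.isNull_lin, X.lin_apply]

theorem lin_evalRV {ψ : V →L[ℝ] 𝒜} (h : IsNull ψ) : (evalRV ψ).lin = ψ := by
  ext v
  rw [GrassmannRV.lin_apply, evalRV_ι h]

theorem GrassmannRV.lin_injective : Function.Injective (GrassmannRV.lin (V := V) (𝒜 := 𝒜)) :=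
  fun X Y h => by rw [← evalRV_lin X, ← evalRV_lin Y, h]

/-- The drift `v ↦ F(v)(ψ)`. -/
def driftMap (F : V →ₗ[ℝ] ExteriorAlgebra ℝ V) (ψ : V →L[ℝ] 𝒜) : V →L[ℝ] 𝒜 :=
  LinearMap.toContinuousLinearMap ((evalRV ψ).toLinearMap ∘ₗ F)

theorem driftMap_apply (F : V →ₗ[ℝ] ExteriorAlgebra ℝ V) (ψ : V →L[ℝ] 𝒜) (v : V) :
    driftMap F ψ v = evalRV ψ (F v) := rfl

theorem driftMap_lin (F : V →ₗ[ℝ] ExteriorAlgebra ℝ V) (X : GrassmannRV V 𝒜) (v : V) :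
    driftMap F X.lin v = X (F v) := by rw [driftMap_apply, evalRV_lin]

/-- The prefactor depends on `V` only, so estimates on basis vectors that are uniform in the algebra
remain uniform for operator norms. -/
theorem clm_norm_le_of_basis (c : ℝ) (hc : 0 ≤ c) (T : V →L[ℝ] 𝒜)
    (h : ∀ i, ‖T (Module.finBasis ℝ V i)‖ ≤ c) :
    ‖T‖ ≤ Fintype.card (Fin (Module.finrank ℝ V)) •
      ‖((Module.finBasis ℝ V).equivFunL : V →L[ℝ] (Fin (Module.finrank ℝ V) → ℝ))‖ * c :=
  (Module.finBasis ℝ V).opNorm_le hc h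

theorem tendsto_clm_of_apply {α : Type*} {l : Filter α} {u : α → V →L[ℝ] 𝒜} {ψ : V →L[ℝ] 𝒜}
    (h : ∀ v, Tendsto (fun i => u i v) l (𝓝 (ψ v))) : Tendsto u l (𝓝 ψ) := by
  rw [tendsto_iff_norm_sub_tendsto_zero]
  have h1 : Tendsto (fun i => Fintype.card (Fin (Module.finrank ℝ V)) •
      ‖((Module.finBasis ℝ V).equivFunL : V →L[ℝ] (Fin (Module.finrank ℝ V) → ℝ))‖ *
      ∑ j : Fin (Module.finrank ℝ V), ‖(u i - ψ) (Module.finBasis ℝ V j)‖) l (𝓝 0) := by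
    have : Tendsto (fun i => ∑ j : Fin (Module.finrank ℝ V), ‖(u i - ψ) (Module.finBasis ℝ V j)‖) l (𝓝 0) := by
      rw [← Finset.sum_const_zero (ι := Fin (Module.finrank ℝ V)) (s := Finset.univ)]
      exact tendsto_finsetSum _ fun j _ => tendsto_iff_norm_sub_tendsto_zero.mp (h _)
    simpa using this.const_mul _
  refine squeeze_zero (fun _ => norm_nonneg _) (fun i => ?_) h1
  exact clm_norm_le_of_basis _ (Finset.sum_nonneg fun _ _ => norm_nonneg _) _ fun j =>
    Finset.single_le_sum (f := fun j => ‖(u i - ψ) (Module.finBasis ℝ V j)‖)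
      (fun _ _ => norm_nonneg _) (Finset.mem_univ j)

theorem continuousOn_driftMap (F : V →ₗ[ℝ] ExteriorAlgebra ℝ V) {s : Set ℝ}
    {u : ℝ → V →L[ℝ] 𝒜} (hu : ContinuousOn u s) (hn : ∀ t ∈ s, IsNull (u t)) :
    ContinuousOn (fun t => driftMap F (u t)) s := fun t ht =>
  tendsto_clm_of_apply fun v => continuousOn_evalRV hu hn (F v) t ht

/-- Only an inequality, because the zero algebra is not excluded. -/
theorem norm_one_le_one_of_cstar : ‖(1 : 𝒜)‖ ≤ 1 := by
  rcases subsingleton_or_nontrivial 𝒜 with h | h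
  · rw [Subsingleton.elim (1 : 𝒜) 0, norm_zero]; exact zero_le_one
  · exact CStarRing.norm_one.le

end EvalRV

/-! ### Drift bounds uniform in the algebra -/

section Universal

universe u
variable {V : Type*} [NormedAddCommGroup V] [InnerProductSpace ℝ V]

/-- The evaluation of an element of the Grassmann algebra is bounded and Lipschitz on bounded
sets of Grassmann random variables, uniformly in the algebra. -/
theorem exists_evalRV_bound (G : ExteriorAlgebra ℝ V) {R : ℝ} (hR : 0 ≤ R) :
    ∃ c : ℝ, 0 ≤ c ∧ ∀ (𝒜 : Type u) [CStarAlgebra 𝒜] (ψ φ : V →L[ℝ] 𝒜), IsNull ψ → IsNull φ →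
      ‖ψ‖ ≤ R → ‖φ‖ ≤ R →
      ‖evalRV ψ G‖ ≤ c ∧ ‖evalRV ψ G - evalRV φ G‖ ≤ c * ‖ψ - φ‖ := by
  induction G using ExteriorAlgebra.right_induction with
  | algebraMap r =>
    refine ⟨|r|, abs_nonneg r, fun 𝒜 _ ψ φ _ _ _ _ => ⟨?_, ?_⟩⟩
    · rw [AlgHom.commutes, Algebra.algebraMap_eq_smul_one, norm_smul, Real.norm_eq_abs]
      exact mul_le_of_le_one_right (abs_nonneg r) norm_one_le_one_of_cstar
    · rw [AlgHom.commutes, AlgHom.commutes, sub_self, norm_zero]; positivity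
  | add x y hx hy =>
    obtain ⟨c, hc, h1⟩ := hx
    obtain ⟨d, hd, h2⟩ := hy
    refine ⟨c + d, add_nonneg hc hd, fun 𝒜 _ ψ φ hψ hφ hψR hφR => ?_⟩
    obtain ⟨a1, a2⟩ := h1 𝒜 ψ φ hψ hφ hψR hφR
    obtain ⟨b1, b2⟩ := h2 𝒜 ψ φ hψ hφ hψR hφR
    constructor
    · rw [map_add]; exact norm_add_le_of_le a1 b1
    · rw [map_add, map_add, add_sub_add_comm, add_mul]; exact norm_add_le_of_le a2 b2
  | mul_ι x m hx =>
    obtain ⟨c, hc, h1⟩ := hx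
    -- In the Lipschitz estimate the summand `R` pays for the factor `ψ m`, and `1` pays for the
    -- difference `(ψ - φ) m`.
    refine ⟨c * ((R + 1) * ‖m‖), by positivity, fun 𝒜 _ ψ φ hψ hφ hψR hφR => ?_⟩
    obtain ⟨a1, a2⟩ := h1 𝒜 ψ φ hψ hφ hψR hφR
    have a3 := (h1 𝒜 φ φ hφ hφ hφR hφR).1
    have hm : ‖ψ m‖ ≤ R * ‖m‖ := ψ.le_of_opNorm_le hψR m
    rw [map_mul, map_mul, evalRV_ι hψ, evalRV_ι hφ]
    constructor
    · refine (norm_mul_le _ _).trans (mul_le_mul a1 (hm.trans ?_) (norm_nonneg _) hc)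
      nlinarith [norm_nonneg m]
    · have e : evalRV ψ x * ψ m - evalRV φ x * φ m
          = (evalRV ψ x - evalRV φ x) * ψ m + evalRV φ x * (ψ - φ) m := by
        rw [sub_apply]; noncomm_ring
      have e1 : ‖(evalRV ψ x - evalRV φ x) * ψ m‖ ≤ c * ‖ψ - φ‖ * (R * ‖m‖) :=
        (norm_mul_le _ _).trans (mul_le_mul a2 hm (norm_nonneg _) (by positivity))
      have e2 : ‖evalRV φ x * (ψ - φ) m‖ ≤ c * (‖ψ - φ‖ * ‖m‖) :=
        (norm_mul_le _ _).trans (mul_le_mul a3 ((ψ - φ).le_opNorm m) (norm_nonneg _) hc)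
      rw [e]
      refine (norm_add_le_of_le e1 e2).trans (le_of_eq ?_)
      ring

/-- The constant is chosen before the algebra; this is what makes the final threshold for λ
independent of 𝒜, ω and the random variables. -/
theorem exists_driftMap_bound [FiniteDimensional ℝ V] (F : V →ₗ[ℝ] ExteriorAlgebra ℝ V) {R : ℝ} (hR : 0 ≤ R) :
    ∃ c : ℝ, 0 ≤ c ∧ ∀ (𝒜 : Type u) [CStarAlgebra 𝒜] (ψ φ : V →L[ℝ] 𝒜), IsNull ψ → IsNull φ →
      ‖ψ‖ ≤ R → ‖φ‖ ≤ R →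
      ‖driftMap F ψ‖ ≤ c ∧ ‖driftMap F ψ - driftMap F φ‖ ≤ c * ‖ψ - φ‖ := by
  choose c hc hb using fun i => exists_evalRV_bound.{u} (F (Module.finBasis ℝ V i)) hR
  set d := Fintype.card (Fin (Module.finrank ℝ V)) •
      ‖((Module.finBasis ℝ V).equivFunL : V →L[ℝ] (Fin (Module.finrank ℝ V) → ℝ))‖ with hd
  have hd0 : 0 ≤ d := by positivity
  have hs : 0 ≤ ∑ i, c i := Finset.sum_nonneg fun i _ => hc i
  have hi : ∀ i, c i ≤ ∑ i, c i := fun i =>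
    Finset.single_le_sum (fun i _ => hc i) (Finset.mem_univ i)
  refine ⟨d * ∑ i, c i, by positivity, fun 𝒜 _ ψ φ hψ hφ hψR hφR => ⟨?_, ?_⟩⟩
  · exact clm_norm_le_of_basis _ hs _ fun i => ((hb i 𝒜 ψ φ hψ hφ hψR hφR).1).trans (hi i)
  · rw [mul_assoc]
    refine clm_norm_le_of_basis _ (by positivity) _ fun i => ?_
    exact ((hb i 𝒜 ψ φ hψ hφ hψR hφR).2).trans
      (mul_le_mul_of_nonneg_right (hi i) (norm_nonneg _))

end Universal

end

noncomputable section
open Filter Topology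

/-! ### Exponential decay of the semigroup -/

section ComplexSpace

variable {E : Type*} [NormedAddCommGroup E] [NormedSpace ℂ E] [CompleteSpace E]

theorem exp_apply_of_eigen (T : E →L[ℂ] E) (z : ℂ) (w : E) (h : T w = z • w) :
    NormedSpace.exp T w = Complex.exp z • w := by
  have h1 := NormedSpace.exp_series_hasSum_exp' (𝕂 := ℂ) T
  have h2 := NormedSpace.exp_series_hasSum_exp' (𝕂 := ℂ) z
  have h3 := (ContinuousLinearMap.apply ℂ E w).hasSum h1
  have h4 := h2.smul_const w
  rw [← Complex.exp_eq_exp_ℂ] at h4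
  refine h3.unique ?_
  convert h4 using 2 with n
  have : ∀ n : ℕ, (T ^ n) w = z ^ n • w := fun n => by
    induction n with
    | zero => simp
    | succ n ih => rw [pow_succ', mul_apply_eq_comp, ih, map_smul, h, smul_smul,
        pow_succ]
  simp [this, smul_smul]

/-- Spectral mapping for the exponential: the eigenspace of e^T for z is invariant under T, which
commutes with e^T. It therefore contains an eigenvector of T, with eigenvalue μ say, and z = e^μ. -/
theorem norm_le_of_mem_spectrum_exp [FiniteDimensional ℂ E] {T : E →L[ℂ] E} {l : ℝ}
    (hT : ∀ (μ : ℂ) (w : E), w ≠ 0 → T w = μ • w → μ.re ≤ -l) (z : ℂ)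
    (hz : z ∈ spectrum ℂ (NormedSpace.exp T)) : ‖z‖ ≤ Real.exp (-l) := by
  set S := NormedSpace.exp T with hS
  let N : Submodule ℂ E := LinearMap.ker ((S - z • 1 : E →L[ℂ] E) :
    E →ₗ[ℂ] E)
  have hmem : ∀ x, x ∈ N ↔ S x = z • x := fun x => by
    simp [N, sub_eq_zero]
  have hN : N ≠ ⊥ := by
    intro hbot
    apply hz
    have hinj := LinearMap.ker_eq_bot.mp hbot
    have hbij : Function.Bijective (S - z • 1 : E →L[ℂ] E) :=
      ⟨hinj, LinearMap.injective_iff_surjective.mp hinj⟩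
    have hu : IsUnit (S - z • 1 : E →L[ℂ] E) :=
      ContinuousLinearMap.isUnit_iff_bijective.mpr hbij
    have hu' := hu.neg
    rw [neg_sub] at hu'
    exact hu'
  have hcomm : ∀ x, S (T x) = T (S x) := fun x => by
    have : Commute S T := (Commute.refl T).exp_left
    exact congrArg (fun f : E →L[ℂ] _ => f x) this.eq
  have hinv : ∀ x ∈ N, (T : E →ₗ[ℂ] _) x ∈ N := fun x hx => by
    rw [hmem] at hx ⊢
    change S (T x) = z • T x
    rw [hcomm, hx, map_smul]
  have : Nontrivial N := Submodule.nontrivial_iff_ne_bot.mpr hN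
  obtain ⟨μ, hμ⟩ := Module.End.exists_eigenvalue ((T : E →ₗ[ℂ] _).restrict hinv)
  obtain ⟨⟨w, hwN⟩, hw⟩ := hμ.exists_hasEigenvector
  have hw1 : T w = μ • w := congrArg Subtype.val hw.apply_eq_smul
  have hw0 : w ≠ 0 := fun h => hw.2 (Subtype.ext h)
  have h1 := hT μ w hw0 hw1
  have h2 : z • w = Complex.exp μ • w := by
    rw [← (hmem w).mp hwN, hS, exp_apply_of_eigen T μ w hw1]
  have h3 : z = Complex.exp μ := smul_left_injective ℂ hw0 h2
  rw [h3, Complex.norm_exp]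
  exact Real.exp_le_exp.mpr h1

/-- The spectral radius of e^T is at most e^{-l} < e^{-l/2}, so Gelfand's formula gives decay of
integer powers; compactness of [0,1] covers the fractional part of t. Giving up half the rate leaves
room for non-diagonalisable T. -/
theorem exists_norm_exp_le_of_eigenvalues [FiniteDimensional ℂ E] (T : E →L[ℂ] E) {l : ℝ}
    (hl : 0 < l) (hT : ∀ (μ : ℂ) (w : E), w ≠ 0 → T w = μ • w → μ.re ≤ -l) :
    ∃ c : ℝ, ∀ t : ℝ, 0 ≤ t → ‖NormedSpace.exp (t • T)‖ ≤ c * Real.exp (-(l / 2) * t) := by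
  set S := NormedSpace.exp T with hS
  have hrad : spectralRadius ℂ S ≤ ENNReal.ofReal (Real.exp (-l)) := by
    refine iSup₂_le fun z hz => ?_
    rw [← ENNReal.ofReal_coe_nnreal]
    exact ENNReal.ofReal_le_ofReal (norm_le_of_mem_spectrum_exp hT z hz)
  have hlt : spectralRadius ℂ S < ENNReal.ofReal (Real.exp (-(l / 2))) := by
    refine hrad.trans_lt ((ENNReal.ofReal_lt_ofReal_iff (Real.exp_pos _)).mpr ?_)
    exact Real.exp_lt_exp.mpr (by linarith)
  have hev := (spectrum.pow_norm_pow_one_div_tendsto_nhds_spectralRadius S).eventually_lt_const hlt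
  have hev2 : ∀ᶠ n : ℕ in atTop, ‖S ^ n‖ * Real.exp (l / 2 * n) ≤ 1 := by
    filter_upwards [hev, eventually_gt_atTop 0] with n hn hn0
    have hn' : (n : ℝ) ≠ 0 := by positivity
    have h1 := (ENNReal.ofReal_lt_ofReal_iff (Real.exp_pos _)).mp hn
    have h2 : ‖S ^ n‖ ≤ Real.exp (-(l / 2)) ^ n := by
      have h3 := pow_le_pow_left₀ (by positivity) h1.le n
      rwa [← Real.rpow_natCast, ← Real.rpow_mul (norm_nonneg _), one_div,
        inv_mul_cancel₀ hn', Real.rpow_one] at h3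
    rw [← Real.exp_nat_mul] at h2
    calc _ ≤ Real.exp (n * -(l / 2)) * Real.exp (l / 2 * n) := by gcongr
      _ = 1 := by rw [← Real.exp_add]; ring_nf; exact Real.exp_zero
  obtain ⟨c, hc⟩ : BddAbove (Set.range fun n : ℕ => ‖S ^ n‖ * Real.exp (l / 2 * n)) :=
    (isBoundedUnder_of_eventually_le hev2).bddAbove_range
  have hc' : ∀ n : ℕ, ‖S ^ n‖ ≤ c * Real.exp (-(l / 2) * n) := fun n => by
    have := hc ⟨n, rfl⟩
    rw [neg_mul, Real.exp_neg, ← div_eq_mul_inv, le_div_iff₀ (Real.exp_pos _)]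
    exact this
  have hc0 : 0 ≤ c := by
    have := hc ⟨0, rfl⟩
    exact le_trans (by positivity) this
  have hcont : Continuous fun s : ℝ => NormedSpace.exp (s • T) :=
    continuous_iff_continuousAt.mpr fun s => (hasDerivAt_exp_smul_const T s).continuousAt
  obtain ⟨b, hb⟩ := isCompact_Icc.exists_bound_of_continuousOn (s := Icc (0 : ℝ) 1)
    hcont.continuousOn
  have hb0 : 0 ≤ b := (norm_nonneg _).trans (hb 0 ⟨le_rfl, zero_le_one⟩)
  refine ⟨b * c * Real.exp (l / 2), fun t ht => ?_⟩
  set n := ⌊t⌋₊ with hn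
  have hn1 : (n : ℝ) ≤ t := Nat.floor_le ht
  have hn2 : t < n + 1 := Nat.lt_floor_add_one t
  let : NormedAlgebra ℚ (E →L[ℂ] E) := NormedAlgebra.restrictScalars ℚ ℝ _
  have e : NormedSpace.exp (t • T) = NormedSpace.exp ((t - n) • T) * S ^ n := by
    rw [hS, ← NormedSpace.exp_nsmul, ← NormedSpace.exp_add_of_commute, ← Nat.cast_smul_eq_nsmul ℝ,
      ← add_smul]
    · congr 2; ring
    · rw [← Nat.cast_smul_eq_nsmul ℝ]
      exact ((Commute.refl T).smul_left _).smul_right _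
  have e1 := hb (t - n) ⟨by linarith, by linarith⟩
  rw [e]
  calc _ ≤ b * (c * Real.exp (-(l / 2) * n)) :=
        (norm_mul_le _ _).trans (mul_le_mul e1 (hc' n) (norm_nonneg _) hb0)
    _ ≤ b * (c * Real.exp (l / 2 + -(l / 2) * t)) := by
        gcongr; nlinarith
    _ = _ := by rw [Real.exp_add]; ring

end ComplexSpace

/-! ### Decay of the real semigroup and the Lyapunov equation -/

section Growth

variable {V : Type*} [NormedAddCommGroup V] [InnerProductSpace ℝ V]

/-- The space of real-linear functionals with complex values. -/
def ComplexDual (V : Type*) [NormedAddCommGroup V] [InnerProductSpace ℝ V] : Type _ := V →L[ℝ] ℂ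

instance : NormedAddCommGroup (ComplexDual V) := inferInstanceAs (NormedAddCommGroup (V →L[ℝ] ℂ))

instance : NormedSpace ℂ (ComplexDual V) := inferInstanceAs (NormedSpace ℂ (V →L[ℝ] ℂ))

instance finiteDimensional_complexDual [FiniteDimensional ℝ V] :
    FiniteDimensional ℂ (ComplexDual V) :=
  (FiniteDimensional.right ℝ ℂ (V →L[ℝ] ℂ) : FiniteDimensional ℂ (V →L[ℝ] ℂ))

/-- Precomposition, as a map to the `ℂ`-linear operators on the complex dual space. -/
def complexDualMap (T : V →L[ℝ] V) : ComplexDual V →L[ℂ] ComplexDual V :=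
  LinearMap.mkContinuous
    { toFun := fun φ : V →L[ℝ] ℂ => (φ ∘L T : V →L[ℝ] ℂ)
      map_add' := fun _ _ => rfl
      map_smul' := fun _ _ => rfl } ‖T‖ fun φ => by
        rw [mul_comm]; exact ContinuousLinearMap.opNorm_comp_le (φ : V →L[ℝ] ℂ) T

theorem complexDualMap_apply (T : V →L[ℝ] V) (φ : V →L[ℝ] ℂ) :
    complexDualMap T φ = (φ ∘L T : V →L[ℝ] ℂ) := rfl

theorem complexDualMap_pow (T : V →L[ℝ] V) (n : ℕ) :
    complexDualMap (T ^ n) = complexDualMap T ^ n := by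
  induction n with
  | zero => rfl
  | succ n ih =>
    rw [pow_succ', pow_succ, ← ih]
    rfl

theorem complexDualMap_add (S T : V →L[ℝ] V) :
    complexDualMap (S + T) = complexDualMap S + complexDualMap T :=
  ContinuousLinearMap.ext fun φ : V →L[ℝ] ℂ =>
    (ContinuousLinearMap.ext fun v => map_add φ (S v) (T v) :
      (φ ∘L (S + T) : V →L[ℝ] ℂ) = φ ∘L S + φ ∘L T)

theorem complexDualMap_smul (c : ℝ) (T : V →L[ℝ] V) :
    complexDualMap (c • T) = c • complexDualMap T :=
  ContinuousLinearMap.ext fun φ : V →L[ℝ] ℂ =>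
    (ContinuousLinearMap.ext fun v => map_smul φ c (T v) :
      (φ ∘L (c • T) : V →L[ℝ] ℂ) = c • (φ ∘L T : V →L[ℝ] ℂ))

theorem complexDualMap_exp [FiniteDimensional ℝ V] (T : V →L[ℝ] V) :
    complexDualMap (NormedSpace.exp T) = NormedSpace.exp (complexDualMap T) := by
  let P : (V →L[ℝ] V) →ₗ[ℝ] (ComplexDual V →L[ℂ] ComplexDual V) :=
    { toFun := complexDualMap
      map_add' := complexDualMap_add
      map_smul' := complexDualMap_smul }
  have h1 := NormedSpace.exp_series_hasSum_exp' (𝕂 := ℝ) T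
  have h2 := NormedSpace.exp_series_hasSum_exp' (𝕂 := ℝ) (complexDualMap T)
  have h3 := h1.map P (LinearMap.continuous_of_finiteDimensional P)
  refine h3.unique (h2.congr_fun ?_)
  intro n
  rw [← complexDualMap_pow]
  exact map_smul P _ _

/-- A real functional norming `T v`, regarded as complex-valued, detects the norm. So decay proved
on the complex dual, a complex normed space, carries over to `V`. -/
theorem norm_le_norm_complexDualMap (T : V →L[ℝ] V) : ‖T‖ ≤ ‖complexDualMap T‖ := by
  refine T.opNorm_le_bound (norm_nonneg (complexDualMap T)) fun v => ?_
  obtain ⟨g, hg, hgv⟩ := exists_dual_vector'' ℝ (T v)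
  have h1 := (complexDualMap T).le_opNorm (Complex.ofRealCLM ∘L g : V →L[ℝ] ℂ)
  have h2 := ContinuousLinearMap.le_opNorm
    ((Complex.ofRealCLM ∘L g) ∘L T : V →L[ℝ] ℂ) v
  have h3 : ‖((Complex.ofRealCLM ∘L g) ∘L T : V →L[ℝ] ℂ) v‖ = ‖T v‖ := by
    simp [hgv]
  have h4 : ‖Complex.ofRealCLM ∘L g‖ ≤ 1 := by
    refine (ContinuousLinearMap.opNorm_comp_le _ _).trans ?_
    rw [Complex.ofRealCLM_norm, one_mul]; exact hg
  rw [h3] at h2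
  refine h2.trans (mul_le_mul_of_nonneg_right (h1.trans ?_) (norm_nonneg _))
  exact mul_le_of_le_one_right (norm_nonneg (complexDualMap T)) h4

/-- If z were not an eigenvalue of the complexification, A_ℂ - z would be surjective. The
complex-linear extension of `w` annihilates its range, which would force w = 0. -/
theorem hasEigenvalue_of_complexDual [FiniteDimensional ℝ V] (A : V →L[ℝ] V) (z : ℂ) (w : V →L[ℝ] ℂ) (hw : w ≠ 0)
    (h : complexDualMap A w = z • w) :
    Module.End.HasEigenvalue (LinearMap.baseChange ℂ (A : V →ₗ[ℝ] V)) z := by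
  set Ac := LinearMap.baseChange ℂ (A : V →ₗ[ℝ] V) with hAc
  by_contra hne
  rw [Module.End.hasEigenvalue_iff, not_not, Module.End.eigenspace_def] at hne
  have hsurj := LinearMap.injective_iff_surjective.mp (LinearMap.ker_eq_bot.mp hne)
  let l : TensorProduct ℝ ℂ V →ₗ[ℂ] ℂ := LinearMap.liftBaseChange ℂ (w : V →ₗ[ℝ] ℂ)
  have hl : ∀ x, l ((Ac - z • 1) x) = 0 := by
    intro x
    induction x using TensorProduct.induction_on with
    | zero => simp
    | add x y hx hy => rw [map_add, map_add, hx, hy, add_zero]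
    | tmul c v =>
      have h' : w (A v) = z * w v := by
        have := congrArg (fun f : V →L[ℝ] ℂ => f v) h
        simpa [complexDualMap_apply] using this
      simp [l, hAc, h', TensorProduct.smul_tmul']
      ring
  refine hw (ContinuousLinearMap.ext fun v => ?_)
  obtain ⟨x, hx⟩ := hsurj ((1 : ℂ) ⊗ₜ[ℝ] v)
  have := hl x
  rw [hx] at this
  simpa [l] using this

theorem exists_norm_exp_le [FiniteDimensional ℝ V] (A : V →L[ℝ] V) {lamA : ℝ} (hl : 0 < lamA)
    (hA : EigenvaluesLE A lamA) :
    ∃ c : ℝ, ∀ t : ℝ, 0 ≤ t → ‖NormedSpace.exp (t • A)‖ ≤ c * Real.exp (-(lamA / 2) * t) := by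
  obtain ⟨c, hc⟩ := exists_norm_exp_le_of_eigenvalues (complexDualMap A) hl fun μ w hw h =>
    hA μ (hasEigenvalue_of_complexDual A μ w hw h)
  refine ⟨c, fun t ht => (norm_le_norm_complexDualMap _).trans ?_⟩
  rw [complexDualMap_exp, complexDualMap_smul]
  exact hc t ht

/-- A real supremum over an unbounded family is 0 by convention, so a bound on `growthConst` says
something only after the spectral estimate has shown the family to be bounded. -/
theorem norm_exp_le_of_growthConst_le [FiniteDimensional ℝ V] (A : V →L[ℝ] V) {lamA M : ℝ} (hl : 0 < lamA)
    (hA : EigenvaluesLE A lamA) (hM : growthConst A lamA ≤ M) {t : ℝ} (ht : 0 ≤ t) :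
    ‖NormedSpace.exp (t • A)‖ ≤ M * Real.exp (-(lamA / 2) * t) := by
  obtain ⟨c, hc⟩ := exists_norm_exp_le A hl hA
  have hb : BddAbove (Set.range fun t : NNReal =>
      Real.exp (lamA * t / 2) * ‖NormedSpace.exp ((t : ℝ) • A)‖) := by
    refine ⟨c, ?_⟩
    rintro _ ⟨s, rfl⟩
    have := hc s s.2
    calc _ ≤ Real.exp (lamA * s / 2) * (c * Real.exp (-(lamA / 2) * s)) :=
          mul_le_mul_of_nonneg_left this (Real.exp_pos _).le
      _ = c * Real.exp (lamA * s / 2 + -(lamA / 2) * s) := by rw [Real.exp_add]; ring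
      _ = c := by ring_nf; simp
  have h1 : Real.exp (lamA * t / 2) * ‖NormedSpace.exp (t • A)‖ ≤ M :=
    (le_ciSup hb ⟨t, ht⟩).trans hM
  have h2 : Real.exp (lamA * t / 2) * Real.exp (-(lamA / 2) * t) = 1 := by
    rw [← Real.exp_add]; ring_nf; exact Real.exp_zero
  calc _ = Real.exp (lamA * t / 2) * ‖NormedSpace.exp (t • A)‖ * Real.exp (-(lamA / 2) * t) := by
        rw [mul_right_comm, h2, one_mul]
    _ ≤ _ := by gcongr

theorem continuous_exp_smul [CompleteSpace V] (A : V →L[ℝ] V) :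
    Continuous fun t : ℝ => NormedSpace.exp (t • A) :=
  continuous_iff_continuousAt.mpr fun t => (hasDerivAt_exp_smul_const A t).continuousAt

theorem exp_add_smul [CompleteSpace V] (A : V →L[ℝ] V) (s t : ℝ) :
    NormedSpace.exp ((s + t) • A) = NormedSpace.exp (s • A) ∘L NormedSpace.exp (t • A) := by
  let : NormedAlgebra ℚ (V →L[ℝ] V) := NormedAlgebra.restrictScalars ℚ ℝ _
  rw [add_smul, NormedSpace.exp_add_of_commute]
  · rfl
  · exact ((Commute.refl A).smul_left _).smul_right _

/-- The Lyapunov equation of the covariance of the Ornstein-Uhlenbeck process. -/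
theorem adjoint_comp_ouCovariance_add [FiniteDimensional ℝ V] [CompleteSpace V] (A C : V →L[ℝ] V) {lamA : ℝ}
    (hl : 0 < lamA) (hA : EigenvaluesLE A lamA) :
    ContinuousLinearMap.adjoint A ∘L ouCovariance A C + ouCovariance A C ∘L A = -C := by
  obtain ⟨c, hc⟩ := exists_norm_exp_le A hl hA
  set A' := ContinuousLinearMap.adjoint A with hA'
  have hnorm : ∀ s : ℝ, ‖NormedSpace.exp (s • A')‖ = ‖NormedSpace.exp (s • A)‖ := fun s => by
    have : star (NormedSpace.exp (s • A)) = NormedSpace.exp (s • A') := by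
      rw [NormedSpace.star_exp, star_smul, star_trivial, ContinuousLinearMap.star_eq_adjoint]
    rw [← this, ContinuousLinearMap.star_eq_adjoint]
    exact LinearIsometryEquiv.norm_map _ _
  -- The integrand of C_A satisfies g' = Aᵀg + gA, with g(0) = C and g(∞) = 0; integrating over the
  -- half-line is the whole proof.
  let g : ℝ → V →L[ℝ] V := fun s =>
    NormedSpace.exp (s • A') * C * NormedSpace.exp (s • A)
  have hg : ∀ s, HasDerivAt g (A' * g s + g s * A) s := fun s => by
    have h1 := hasDerivAt_exp_smul_const' A' s
    have h2 := hasDerivAt_exp_smul_const A s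
    have h3 := (h1.mul_const C).mul h2
    refine h3.congr_deriv ?_
    simp only [g, mul_assoc]
  have hgb : ∀ s, 0 ≤ s → ‖g s‖ ≤ c ^ 2 * ‖C‖ * Real.exp (-lamA * s) := fun s hs => by
    have h0 := hc s hs
    have h1 : ‖g s‖ ≤ (c * Real.exp (-(lamA / 2) * s)) * ‖C‖ * (c * Real.exp (-(lamA / 2) * s)) := by
      refine (norm_mul_le _ _).trans (mul_le_mul ((norm_mul_le _ _).trans ?_) h0
        (norm_nonneg _) (mul_nonneg ((norm_nonneg _).trans h0) (norm_nonneg _)))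
      rw [hnorm]; gcongr
    refine h1.trans (le_of_eq ?_)
    have : Real.exp (-lamA * s) = Real.exp (-(lamA / 2) * s) * Real.exp (-(lamA / 2) * s) := by
      rw [← Real.exp_add]; ring_nf
    rw [this]; ring
  have hgc : Continuous g := continuous_iff_continuousAt.mpr fun s => (hg s).continuousAt
  have hint : IntegrableOn g (Ioi 0) := by
    have h1 : IntegrableOn (fun s => c ^ 2 * ‖C‖ * Real.exp (-lamA * s)) (Ioi 0) :=
      (exp_neg_integrableOn_Ioi 0 hl).const_mul _
    refine h1.mono' hgc.aestronglyMeasurable.restrict ?_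
    exact (ae_restrict_mem measurableSet_Ioi).mono fun s hs => hgb s (le_of_lt hs)
  have hlim : Tendsto g atTop (𝓝 0) := by
    have h1 : Tendsto (fun s => c ^ 2 * ‖C‖ * Real.exp (-lamA * s)) atTop (𝓝 0) := by
      have : Tendsto (fun s : ℝ => -lamA * s) atTop atBot :=
        tendsto_id.const_mul_atTop_of_neg (by linarith)
      simpa using (Real.tendsto_exp_atBot.comp this).const_mul (c ^ 2 * ‖C‖)
    refine squeeze_zero_norm' ?_ h1
    filter_upwards [eventually_ge_atTop 0] with s hs using hgb s hs
  have hint1 : IntegrableOn (fun s => A' * g s) (Ioi 0) := hint.const_mul A'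
  have hint2 : IntegrableOn (fun s => g s * A) (Ioi 0) := hint.mul_const A
  have h := integral_Ioi_of_hasDerivAt_of_tendsto' (fun s _ => hg s) (hint1.add hint2) hlim
  have hcov : ouCovariance A C = ∫ s in Ioi (0 : ℝ), g s := rfl
  have h1 : ∫ s in Ioi (0 : ℝ), A' * g s = A' * ouCovariance A C := by
    rw [hcov]
    exact ((ContinuousLinearMap.mul ℝ (V →L[ℝ] V)) A').integral_comp_comm hint
  have h2 : ∫ s in Ioi (0 : ℝ), g s * A = ouCovariance A C * A := by
    rw [hcov]
    exact ((ContinuousLinearMap.mul ℝ (V →L[ℝ] V)).flip A).integral_comp_comm hint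
  rw [integral_add hint1 hint2, h1, h2] at h
  change A' * ouCovariance A C + ouCovariance A C * A = -C
  rw [h]
  have h0 : g 0 = C := by simp only [g, zero_smul, NormedSpace.exp_zero, one_mul, mul_one]
  rw [h0, zero_sub]

end Growth

end

noncomputable section
set_option linter.unusedSectionVars false
open Filter Topology

/-! ### A fixed point theorem for Volterra equations -/

section Volterra

variable {V : Type*} [NormedAddCommGroup V] [InnerProductSpace ℝ V] [CompleteSpace V]
variable {𝒜 : Type*} [NormedAddCommGroup 𝒜] [NormedSpace ℝ 𝒜] [CompleteSpace 𝒜]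

/-- Precomposition with a continuous linear map. -/
abbrev precompL (𝒜 : Type*) [NormedAddCommGroup 𝒜] [NormedSpace ℝ 𝒜] (T : V →L[ℝ] V) :
    (V →L[ℝ] 𝒜) →L[ℝ] (V →L[ℝ] 𝒜) :=
  (ContinuousLinearMap.compL ℝ V V 𝒜).flip T

theorem exp_smul_mul_exp_neg_smul (A : V →L[ℝ] V) (s t : ℝ) :
    NormedSpace.exp ((-s) • A) ∘L NormedSpace.exp (t • A) = NormedSpace.exp ((t - s) • A) := by
  rw [← exp_add_smul]; congr 2; ring

theorem exp_weight_mul {ν η t s : ℝ} :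
    Real.exp (ν * s) * Real.exp (-η * (t - s))
      = Real.exp (-η * t) * Real.exp ((ν + η) * s) := by
  rw [← Real.exp_add, ← Real.exp_add]; ring_nf

/-- Convolving a function of size e^{νs} with a semigroup of decay η over (-∞, t] costs the factor
M/(ν + η). Three choices are used: ν = 0 for stationary solutions, ν = -η/2 for relaxation, and A =
0, η = 0 with ν large for bounded intervals. -/
structure VolterraBound (A : V →L[ℝ] V) (M η ν : ℝ) : Prop where
  exp_le : ∀ t : ℝ, 0 ≤ t → ‖NormedSpace.exp (t • A)‖ ≤ M * Real.exp (-η * t)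
  pos : 0 < ν + η

variable {A : V →L[ℝ] V} {M η ν : ℝ} {I : Set ℝ} {h : ℝ → V →L[ℝ] 𝒜} {B : ℝ}

theorem VolterraBound.nonneg (hA : VolterraBound A M η ν) : 0 ≤ M := by
  have := (norm_nonneg _).trans (hA.exp_le 0 le_rfl)
  simpa using this

theorem VolterraBound.norm_le (hA : VolterraBound A M η ν) (hB : 0 ≤ B)
    (hb : ∀ s ∈ I, ‖h s‖ ≤ B * Real.exp (ν * s)) {t s : ℝ} (hs : s ∈ I ∩ Iic t) :
    ‖h s ∘L NormedSpace.exp ((t - s) • A)‖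
      ≤ M * B * Real.exp (-η * t) * Real.exp ((ν + η) * s) := by
  have h0 : 0 ≤ t - s := sub_nonneg.mpr hs.2
  calc _ ≤ (B * Real.exp (ν * s)) * (M * Real.exp (-η * (t - s))) :=
        (ContinuousLinearMap.opNorm_comp_le _ _).trans
          (mul_le_mul (hb s hs.1) (hA.exp_le _ h0) (norm_nonneg _) (by positivity))
    _ = M * B * (Real.exp (ν * s) * Real.exp (-η * (t - s))) := by ring
    _ = _ := by rw [exp_weight_mul]; ring

theorem VolterraBound.integrableOn (hA : VolterraBound A M η ν) (hI : MeasurableSet I)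
    (hc : ContinuousOn h I) (hB : 0 ≤ B) (hb : ∀ s ∈ I, ‖h s‖ ≤ B * Real.exp (ν * s)) (t : ℝ) :
    IntegrableOn (fun s => h s ∘L NormedSpace.exp ((t - s) • A)) (I ∩ Iic t) := by
  have hm : MeasurableSet (I ∩ Iic t) := hI.inter measurableSet_Iic
  have h1 : IntegrableOn (fun s => M * B * Real.exp (-η * t) * Real.exp ((ν + η) * s))
      (I ∩ Iic t) :=
    ((integrableOn_exp_mul_Iic hA.pos t).mono_set inter_subset_right).const_mul _
  refine h1.mono' (ContinuousOn.aestronglyMeasurable ?_ hm) ?_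
  · have h2 : Continuous fun s : ℝ => NormedSpace.exp ((t - s) • A) :=
      (continuous_exp_smul A).comp (continuous_const.sub continuous_id)
    exact (hc.mono inter_subset_left).clm_comp h2.continuousOn
  · exact (ae_restrict_mem hm).mono fun s hs => hA.norm_le hB hb hs

theorem VolterraBound.norm_integral_le (hA : VolterraBound A M η ν) (hI : MeasurableSet I)
    (hB : 0 ≤ B) (hb : ∀ s ∈ I, ‖h s‖ ≤ B * Real.exp (ν * s)) (t : ℝ) :
    ‖∫ s in I ∩ Iic t, h s ∘L NormedSpace.exp ((t - s) • A)‖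
      ≤ M * B / (ν + η) * Real.exp (ν * t) := by
  have hm : MeasurableSet (I ∩ Iic t) := hI.inter measurableSet_Iic
  have h1 : IntegrableOn (fun s => M * B * Real.exp (-η * t) * Real.exp ((ν + η) * s)) (Iic t) :=
    (integrableOn_exp_mul_Iic hA.pos t).const_mul _
  have hM := hA.nonneg
  calc _ ≤ ∫ s in I ∩ Iic t, M * B * Real.exp (-η * t) * Real.exp ((ν + η) * s) :=
        norm_integral_le_of_norm_le (h1.mono_set inter_subset_right)
          ((ae_restrict_mem hm).mono fun s hs => hA.norm_le hB hb hs)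
    _ ≤ ∫ s in Iic t, M * B * Real.exp (-η * t) * Real.exp ((ν + η) * s) :=
        setIntegral_mono_set h1 (ae_of_all _ fun s => by positivity)
          (LE.le.eventuallyLE inter_subset_right)
    _ = _ := by
      rw [integral_const_mul, integral_exp_mul_Iic hA.pos]
      have : Real.exp (ν * t) = Real.exp (-η * t) * Real.exp ((ν + η) * t) := by
        rw [← Real.exp_add]; ring_nf
      rw [this]; ring

/-- Since e^{(t-s)A} = e^{-sA} e^{tA}, the convolution is a primitive of a function independent of
t, composed with e^{tA}. Continuity in t follows from this form. -/
theorem VolterraBound.integral_eq (hA : VolterraBound A M η ν) (hI : MeasurableSet I)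
    (hc : ContinuousOn h I) (hB : 0 ≤ B) (hb : ∀ s ∈ I, ‖h s‖ ≤ B * Real.exp (ν * s)) (t : ℝ) :
    IntegrableOn (I.indicator fun s => h s ∘L NormedSpace.exp ((-s) • A)) (Iic t) ∧
    ∫ s in I ∩ Iic t, h s ∘L NormedSpace.exp ((t - s) • A)
      = (∫ s in Iic t, I.indicator (fun s => h s ∘L NormedSpace.exp ((-s) • A)) s) ∘L
        NormedSpace.exp (t • A) := by
  have h1 := hA.integrableOn hI hc hB hb t
  have h2 : IntegrableOn (fun s => h s ∘L NormedSpace.exp ((-s) • A)) (I ∩ Iic t) := by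
    have := (precompL 𝒜 (NormedSpace.exp ((-t) • A))).integrable_comp h1
    refine this.congr (ae_of_all _ fun s => ?_)
    change (h s ∘L NormedSpace.exp ((t - s) • A)) ∘L NormedSpace.exp ((-t) • A) = _
    rw [ContinuousLinearMap.comp_assoc, ← exp_add_smul]
    congr 3; ring
  have h3 : IntegrableOn (I.indicator fun s => h s ∘L NormedSpace.exp ((-s) • A)) (Iic t) := by
    have h2' : Integrable (fun s => h s ∘L NormedSpace.exp ((-s) • A))
        ((volume.restrict (Iic t)).restrict I) := by
      rw [Measure.restrict_restrict hI]; exact h2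
    exact (integrable_indicator_iff (ε' := V →L[ℝ] 𝒜) hI).mpr h2'
  refine ⟨h3, ?_⟩
  have h4 := (precompL 𝒜 (NormedSpace.exp (t • A))).integral_comp_comm h2
  rw [setIntegral_indicator hI, inter_comm (Iic t)]
  refine Eq.trans ?_ h4
  refine integral_congr_ae (ae_of_all _ fun s => ?_)
  change _ = (h s ∘L NormedSpace.exp ((-s) • A)) ∘L NormedSpace.exp (t • A)
  rw [ContinuousLinearMap.comp_assoc, exp_smul_mul_exp_neg_smul]

theorem VolterraBound.continuous_integral (hA : VolterraBound A M η ν) (hI : MeasurableSet I)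
    (hc : ContinuousOn h I) (hB : 0 ≤ B) (hb : ∀ s ∈ I, ‖h s‖ ≤ B * Real.exp (ν * s)) :
    Continuous fun t => ∫ s in I ∩ Iic t, h s ∘L NormedSpace.exp ((t - s) • A) := by
  have h1 := hA.integral_eq hI hc hB hb
  have h2 : (fun t => ∫ s in I ∩ Iic t, h s ∘L NormedSpace.exp ((t - s) • A)) = fun t =>
      ((∫ s in Iic (0 : ℝ), I.indicator (fun s => h s ∘L NormedSpace.exp ((-s) • A)) s)
        + ∫ s in (0 : ℝ)..t, I.indicator (fun s => h s ∘L NormedSpace.exp ((-s) • A)) s) ∘L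
        NormedSpace.exp (t • A) := by
    ext1 t
    rw [(h1 t).2, ← intervalIntegral.integral_Iic_sub_Iic (h1 0).1 (h1 t).1, add_sub_cancel]
  rw [h2]
  refine Continuous.clm_comp (continuous_const.add ?_) (continuous_exp_smul A)
  refine intervalIntegral.continuous_primitive (fun a b => ?_) 0
  refine ⟨(h1 (max a b)).1.mono_set ?_, (h1 (max a b)).1.mono_set ?_⟩
  · exact fun x hx => hx.2.trans (le_max_right _ _)
  · exact fun x hx => hx.2.trans (le_max_left _ _)

/-- Hahn–Banach: a functional bounded above on a subspace vanishes on it, hence also on the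
integral, so it cannot separate the two. The argument does not average and thus allows half-lines of
infinite measure. -/
theorem integral_clm_mem {O : Submodule ℝ 𝒜} (hO : IsClosed (O : Set 𝒜)) {S : Set ℝ}
    (hS : MeasurableSet S) {k : ℝ → V →L[ℝ] 𝒜} (hk : IntegrableOn k S)
    (hm : ∀ s ∈ S, ∀ v, k s v ∈ O) (v : V) : (∫ s in S, k s) v ∈ O := by
  have e : (∫ s in S, k s) v = ∫ s in S, k s v :=
    ((ContinuousLinearMap.apply ℝ 𝒜 v).integral_comp_comm hk).symm
  have hk' : IntegrableOn (fun s => k s v) S :=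
    (ContinuousLinearMap.apply ℝ 𝒜 v).integrable_comp hk
  have hint := integral_indicator hS (μ := (volume : Measure ℝ)) (f := fun s => k s v)
  rw [e, ← hint]
  by_contra hne
  obtain ⟨f, u, h1, h2⟩ := geometric_hahn_banach_closed_point (O.convex) hO hne
  have hf : ∀ a ∈ O, f a = 0 := fun a ha => by
    by_contra h0
    have := h1 ((u / f a) • a) (O.smul_mem _ ha)
    rw [map_smul, smul_eq_mul, div_mul_cancel₀ _ h0] at this
    exact lt_irrefl _ this
  have h3 : f (∫ s, S.indicator (fun s => k s v) s) = 0 := by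
    rw [← f.integral_comp_comm ((integrable_indicator_iff hS).mpr hk')]
    refine integral_eq_zero_of_ae (ae_of_all _ fun s => hf _ ?_)
    by_cases hs : s ∈ S
    · rw [indicator_of_mem hs]; exact hm s hs v
    · rw [indicator_of_notMem hs]; exact O.zero_mem
  have h4 := h1 0 O.zero_mem
  rw [map_zero] at h4
  rw [h3] at h2
  exact lt_asymm h2 h4

/-- Banach's fixed point theorem for the rescaled unknown w(t) = e^{-νt} u(t), in a closed set of
bounded continuous functions. Condition `h1` makes the ball of radius ρ invariant and `h2` gives
contraction by ½. The integral only looks at the past, so monotonicity of `O` preserves the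
constraint u(t) ∈ O(t). -/
theorem exists_volterra_solution (hA : VolterraBound A M η ν) (hI : MeasurableSet I)
    {O : ℝ → Submodule ℝ 𝒜} (hOc : ∀ t, IsClosed (O t : Set 𝒜)) (hOm : Monotone O)
    {n : ℝ → (V →L[ℝ] 𝒜) → (V →L[ℝ] 𝒜)} {g : ℝ → V →L[ℝ] 𝒜} {ρ ρ₀ Lp : ℝ}
    (hρ : 0 ≤ ρ) (hB : 0 ≤ B) (hLp : 0 ≤ Lp)
    (hn_mem : ∀ s ∈ I, ∀ x : V →L[ℝ] 𝒜, (∀ v, x v ∈ O s) → ‖x‖ ≤ ρ * Real.exp (ν * s) →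
      (∀ v, n s x v ∈ O s) ∧ ‖n s x‖ ≤ B * Real.exp (ν * s))
    (hn_lip : ∀ s ∈ I, ∀ x y : V →L[ℝ] 𝒜, (∀ v, x v ∈ O s) → (∀ v, y v ∈ O s) →
      ‖x‖ ≤ ρ * Real.exp (ν * s) → ‖y‖ ≤ ρ * Real.exp (ν * s) →
      ‖n s x - n s y‖ ≤ Lp * ‖x - y‖)
    (hn_cont : ∀ u : ℝ → V →L[ℝ] 𝒜, Continuous u →
      (∀ t, (∀ v, u t v ∈ O t) ∧ ‖u t‖ ≤ ρ * Real.exp (ν * t)) →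
      ContinuousOn (fun s => n s (u s)) I)
    (hg : Continuous g) (hg_mem : ∀ t v, g t v ∈ O t) (hg_le : ∀ t, ‖g t‖ ≤ ρ₀ * Real.exp (ν * t))
    (h1 : ρ₀ + M * B / (ν + η) ≤ ρ) (h2 : M * Lp / (ν + η) ≤ 1 / 2) :
    ∃ u : ℝ → V →L[ℝ] 𝒜, Continuous u ∧
      (∀ t, (∀ v, u t v ∈ O t) ∧ ‖u t‖ ≤ ρ * Real.exp (ν * t)) ∧
      ∀ t, u t = g t + ∫ s in I ∩ Iic t, n s (u s) ∘L NormedSpace.exp ((t - s) • A) := by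
  let 𝒲 : Set (BoundedContinuousFunction ℝ (V →L[ℝ] 𝒜)) :=
    {w | ∀ t, (∀ v, w t v ∈ O t) ∧ ‖w t‖ ≤ ρ}
  have h𝒲 : IsClosed 𝒲 := by
    have : 𝒲 = ⋂ t, ((⋂ v, {w | w t v ∈ O t}) ∩ {w | ‖w t‖ ≤ ρ}) := by
      ext w; simp [𝒲]
    rw [this]
    refine isClosed_iInter fun t => (isClosed_iInter fun v => ?_).inter ?_
    · refine (hOc t).preimage (f := fun w : BoundedContinuousFunction ℝ (V →L[ℝ] 𝒜) => w t v) ?_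
      exact (ContinuousLinearMap.apply ℝ 𝒜 v).continuous.comp
        (continuous_eval_const t)
    · exact isClosed_le (continuous_eval_const t).norm continuous_const
  let U : BoundedContinuousFunction ℝ (V →L[ℝ] 𝒜) → ℝ → V →L[ℝ] 𝒜 :=
    fun w t => Real.exp (ν * t) • w t
  have hUc : ∀ w, Continuous (U w) := fun w => by
    have := w.continuous
    fun_prop
  have hUn : ∀ w t, ‖U w t‖ = Real.exp (ν * t) * ‖w t‖ := fun w t => by
    simp [U, norm_smul]
  have hU : ∀ w ∈ 𝒲, ∀ t, (∀ v, U w t v ∈ O t) ∧ ‖U w t‖ ≤ ρ * Real.exp (ν * t) := by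
    intro w hw t
    refine ⟨fun v => (O t).smul_mem _ ((hw t).1 v), ?_⟩
    rw [hUn, mul_comm]
    exact mul_le_mul_of_nonneg_right (hw t).2 (Real.exp_pos _).le
  let N : BoundedContinuousFunction ℝ (V →L[ℝ] 𝒜) → ℝ → V →L[ℝ] 𝒜 := fun w s => n s (U w s)
  have hNb : ∀ w ∈ 𝒲, ∀ s ∈ I, ‖N w s‖ ≤ B * Real.exp (ν * s) := fun w hw s hs =>
    (hn_mem s hs _ (hU w hw s).1 (hU w hw s).2).2
  have hNc : ∀ w ∈ 𝒲, ContinuousOn (N w) I := fun w hw => hn_cont _ (hUc w) (hU w hw)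
  let P : BoundedContinuousFunction ℝ (V →L[ℝ] 𝒜) → ℝ → V →L[ℝ] 𝒜 := fun w t =>
    g t + ∫ s in I ∩ Iic t, N w s ∘L NormedSpace.exp ((t - s) • A)
  have hPc : ∀ w ∈ 𝒲, Continuous (P w) := fun w hw =>
    hg.add (hA.continuous_integral hI (hNc w hw) hB (hNb w hw))
  have hPm : ∀ w ∈ 𝒲, ∀ t v, P w t v ∈ O t := fun w hw t v => by
    refine (O t).add_mem (hg_mem t v) (integral_clm_mem (hOc t) (hI.inter measurableSet_Iic)
      (hA.integrableOn hI (hNc w hw) hB (hNb w hw) t) (fun s hs v => ?_) v)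
    exact hOm hs.2 ((hn_mem s hs.1 _ (hU w hw s).1 (hU w hw s).2).1 _)
  have hPn : ∀ w ∈ 𝒲, ∀ t, ‖P w t‖ ≤ ρ * Real.exp (ν * t) := fun w hw t => by
    refine (norm_add_le_of_le (hg_le t) (hA.norm_integral_le hI hB (hNb w hw) t)).trans ?_
    rw [← add_mul]
    exact mul_le_mul_of_nonneg_right h1 (Real.exp_pos _).le
  have hexp : ∀ t, Real.exp (-(ν * t)) * Real.exp (ν * t) = 1 := fun t => by
    rw [← Real.exp_add, neg_add_cancel, Real.exp_zero]
  have hQn : ∀ w ∈ 𝒲, ∀ t, ‖Real.exp (-(ν * t)) • P w t‖ ≤ ρ := fun w hw t => by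
    rw [norm_smul, Real.norm_eq_abs, Real.abs_exp]
    calc _ ≤ Real.exp (-(ν * t)) * (ρ * Real.exp (ν * t)) := by gcongr; exact hPn w hw t
      _ = ρ * (Real.exp (-(ν * t)) * Real.exp (ν * t)) := by ring
      _ = ρ := by rw [hexp, mul_one]
  let Φ : 𝒲 → 𝒲 := fun w => ⟨BoundedContinuousFunction.ofNormedAddCommGroup
    (fun t => Real.exp (-(ν * t)) • P w t)
    ((by fun_prop : Continuous fun t : ℝ => Real.exp (-(ν * t))).smul (hPc w w.2)) ρ (hQn w w.2),
    fun t => ⟨fun v => (O t).smul_mem _ (hPm w w.2 t v), hQn w w.2 t⟩⟩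
  have hΦ : ∀ w : 𝒲, ∀ t, (Φ w).1 t = Real.exp (-(ν * t)) • P w t := fun w t => rfl
  have hcontr : ContractingWith (1 / 2) Φ := by
    refine ⟨by rw [one_div]; exact NNReal.inv_lt_one_iff two_ne_zero |>.mpr one_lt_two,
      LipschitzWith.of_dist_le_mul fun w w' => ?_⟩
    rw [Subtype.dist_eq, Subtype.dist_eq]
    refine (BoundedContinuousFunction.dist_le (by positivity)).mpr fun t => ?_
    rw [dist_eq_norm, hΦ, hΦ, ← smul_sub, norm_smul, Real.norm_eq_abs, Real.abs_exp]
    have e : P w t - P w' t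
        = ∫ s in I ∩ Iic t, (N w s - N w' s) ∘L NormedSpace.exp ((t - s) • A) := by
      simp only [P, ContinuousLinearMap.sub_comp]
      rw [integral_sub (hA.integrableOn hI (hNc w w.2) hB (hNb w w.2) t)
        (hA.integrableOn hI (hNc w' w'.2) hB (hNb w' w'.2) t)]
      abel
    have hd : ∀ s ∈ I, ‖N w s - N w' s‖ ≤ Lp * dist w.1 w'.1
        * Real.exp (ν * s) := fun s hs => by
      refine (hn_lip s hs _ _ (hU w w.2 s).1 (hU w' w'.2 s).1 (hU w w.2 s).2
        (hU w' w'.2 s).2).trans ?_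
      rw [mul_assoc]
      refine mul_le_mul_of_nonneg_left ?_ hLp
      rw [← smul_sub, norm_smul, Real.norm_eq_abs, Real.abs_exp, mul_comm]
      refine mul_le_mul_of_nonneg_right ?_ (Real.exp_pos _).le
      rw [← dist_eq_norm]
      exact BoundedContinuousFunction.dist_coe_le_dist (f := w.1) (g := w'.1) s
    have hle := hA.norm_integral_le hI (mul_nonneg hLp dist_nonneg) hd t
    rw [e]
    calc _ ≤ Real.exp (-(ν * t)) * (M * (Lp * dist w.1 w'.1)
          / (ν + η) * Real.exp (ν * t)) :=
          mul_le_mul_of_nonneg_left hle (Real.exp_pos _).le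
      _ = (Real.exp (-(ν * t)) * Real.exp (ν * t)) * (M * Lp / (ν + η)
          * dist w.1 w'.1) := by ring
      _ ≤ _ := by
        rw [hexp, one_mul]
        refine mul_le_mul_of_nonneg_right ?_ dist_nonneg
        simpa using h2
  have : CompleteSpace 𝒲 := h𝒲.completeSpace_coe
  have : Nonempty 𝒲 := ⟨⟨0, fun t => ⟨fun v => (O t).zero_mem, by simpa using hρ⟩⟩⟩
  obtain ⟨w, hw⟩ : ∃ w, Φ w = w := ⟨_, hcontr.fixedPoint_isFixedPt⟩
  refine ⟨U w, hUc w, hU w w.2, fun t => ?_⟩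
  have h3 := hΦ w t
  rw [hw] at h3
  change Real.exp (ν * t) • w.1 t = P w t
  rw [h3, smul_smul, mul_comm, hexp, one_smul]

end Volterra

end

noncomputable section
set_option linter.unusedSectionVars false
open Filter Topology

/-! ### Solutions with additive forcing -/

section IntegralEquation

variable {V : Type*} [NormedAddCommGroup V] [InnerProductSpace ℝ V] [FiniteDimensional ℝ V]
variable {𝒜 : Type*} [CStarAlgebra 𝒜]

/-- The vector field `ψ ↦ ψ ∘ A + lam F(ψ)`. -/
def vectorField (A : V →L[ℝ] V) (F : V →ₗ[ℝ] ExteriorAlgebra ℝ V) (lam : ℝ) (ψ : V →L[ℝ] 𝒜) :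
    V →L[ℝ] 𝒜 := ψ ∘L A + lam • driftMap F ψ

/-- `Ψ` solves `Ψ_t = y_t + ∫ₐᵗ (Ψ_s ∘ A + lam F(Ψ_s)) ds` on `[a, b]`. -/
structure IsIntegralSolution (A : V →L[ℝ] V) (F : V →ₗ[ℝ] ExteriorAlgebra ℝ V) (lam : ℝ)
    (y : ℝ → V →L[ℝ] 𝒜) (a b : ℝ) (Ψ : ℝ → V →L[ℝ] 𝒜) : Prop where
  continuousOn : ContinuousOn Ψ (Icc a b)
  isNull : ∀ t ∈ Icc a b, IsNull (Ψ t)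
  equation : ∀ t ∈ Icc a b, Ψ t = y t + ∫ s in a..t, vectorField A F lam (Ψ s)

variable {A : V →L[ℝ] V} {F : V →ₗ[ℝ] ExteriorAlgebra ℝ V} {lam a b : ℝ}

theorem continuousOn_vectorField {s : Set ℝ} {u : ℝ → V →L[ℝ] 𝒜} (hu : ContinuousOn u s)
    (hn : ∀ t ∈ s, IsNull (u t)) : ContinuousOn (fun t => vectorField A F lam (u t)) s :=
  (hu.clm_comp continuousOn_const).add ((continuousOn_driftMap F hu hn).const_smul lam)

theorem IsOddSubspace.driftMap_mem {O : Submodule ℝ 𝒜} (hO : IsOddSubspace O)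
    (hF : ∀ v, F v ∈ ExteriorAlgebra.parity V 1) {ψ : V →L[ℝ] 𝒜} (h : ∀ v, ψ v ∈ O) (v : V) :
    driftMap F ψ v ∈ O := hO.evalRV_mem h (hF v)

theorem isOddSubspace_bot : IsOddSubspace (⊥ : Submodule ℝ 𝒜) where
  isClosed := isClosed_singleton
  anticomm a ha b hb := by rw [(Submodule.mem_bot ℝ).mp ha]; simp
  mul_mem a ha b hb c hc := by rw [(Submodule.mem_bot ℝ).mp ha]; simp

/-- Odd elements have no constant term; formally, odd elements preserve every odd subspace, in
particular the zero subspace. -/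
theorem driftMap_zero (hF : ∀ v, F v ∈ ExteriorAlgebra.parity V 1) :
    driftMap F (0 : V →L[ℝ] 𝒜) = 0 := by
  ext v
  exact (Submodule.mem_bot ℝ).mp
    (isOddSubspace_bot.driftMap_mem hF (ψ := (0 : V →L[ℝ] 𝒜)) (fun v => by simp) v)

theorem vectorField_sub_le {c : ℝ} {ψ φ : V →L[ℝ] 𝒜}
    (h : ‖driftMap F ψ - driftMap F φ‖ ≤ c * ‖ψ - φ‖) :
    ‖vectorField A F lam ψ - vectorField A F lam φ‖ ≤ (‖A‖ + |lam| * c) * ‖ψ - φ‖ := by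
  have e : vectorField A F lam ψ - vectorField A F lam φ
      = (ψ - φ) ∘L A + lam • (driftMap F ψ - driftMap F φ) := by
    simp only [vectorField, ContinuousLinearMap.sub_comp, smul_sub]; abel
  have h1 : ‖(ψ - φ) ∘L A‖ ≤ ‖ψ - φ‖ * ‖A‖ := ContinuousLinearMap.opNorm_comp_le _ _
  have h2 : ‖lam • (driftMap F ψ - driftMap F φ)‖ ≤ |lam| * (c * ‖ψ - φ‖) := by
    rw [norm_smul, Real.norm_eq_abs]; gcongr
  rw [e]
  refine (norm_add_le_of_le h1 h2).trans (le_of_eq ?_)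
  ring

theorem hasDerivWithinAt_integral_Ici {E : Type*} [NormedAddCommGroup E] [NormedSpace ℝ E]
    [CompleteSpace E] {k : ℝ → E} (hk : ContinuousOn k (Icc a b)) {t : ℝ} (ht : t ∈ Ico a b) :
    HasDerivWithinAt (fun t => ∫ s in a..t, k s) (k t) (Ici t) t := by
  have hab : a ≤ b := ht.1.trans ht.2.le
  have hext : Continuous (IccExtend hab ((Icc a b).domRestrict k)) :=
    hk.domRestrict.Icc_extend'
  have h1 := (hext.integral_hasStrictDerivAt a t).hasDerivAt.hasDerivWithinAt (s := Ici t)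
  rw [IccExtend_of_mem hab _ ⟨ht.1, ht.2.le⟩] at h1
  have he : ∀ r ∈ Icc a b, ∫ s in a..r, k s
      = ∫ s in a..r, IccExtend hab ((Icc a b).domRestrict k) s := fun r hr => by
    refine intervalIntegral.integral_congr fun s hs => ?_
    rw [uIcc_of_le hr.1] at hs
    rw [IccExtend_of_mem hab _ ⟨hs.1, hs.2.trans hr.2⟩]; rfl
  refine h1.congr_of_eventuallyEq ?_ (he t ⟨ht.1, ht.2.le⟩)
  filter_upwards [Icc_mem_nhdsGE ht.2] with r hr
  exact he r ⟨ht.1.trans hr.1, hr.2⟩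

/-- The forcing, which need not be differentiable, cancels in the difference. Grönwall applies with
a Lipschitz constant on a ball containing both compact trajectories. -/
theorem IsIntegralSolution.unique {y : ℝ → V →L[ℝ] 𝒜} {Ψ Φ : ℝ → V →L[ℝ] 𝒜}
    (hΨ : IsIntegralSolution A F lam y a b Ψ) (hΦ : IsIntegralSolution A F lam y a b Φ) :
    ∀ t ∈ Icc a b, Ψ t = Φ t := by
  obtain ⟨R₁, hR₁⟩ := isCompact_Icc.exists_bound_of_continuousOn hΨ.continuousOn
  obtain ⟨R₂, hR₂⟩ := isCompact_Icc.exists_bound_of_continuousOn hΦ.continuousOn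
  intro t ht
  have hR : 0 ≤ max R₁ R₂ := ((norm_nonneg _).trans (hR₁ t ht)).trans (le_max_left _ _)
  obtain ⟨c, hc, hcb⟩ := exists_driftMap_bound F hR
  have hcΨ := continuousOn_vectorField (A := A) (F := F) (lam := lam) hΨ.continuousOn hΨ.isNull
  have hcΦ := continuousOn_vectorField (A := A) (F := F) (lam := lam) hΦ.continuousOn hΦ.isNull
  have hd : ∀ r ∈ Icc a b, Ψ r - Φ r
      = (∫ s in a..r, vectorField A F lam (Ψ s)) - ∫ s in a..r, vectorField A F lam (Φ s) := by
    intro r hr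
    rw [hΨ.equation r hr, hΦ.equation r hr]; abel
  have hab : a ≤ b := ht.1.trans ht.2
  have key := norm_le_gronwallBound_of_norm_deriv_right_le (f := fun r => Ψ r - Φ r)
    (f' := fun r => vectorField A F lam (Ψ r) - vectorField A F lam (Φ r)) (δ := 0)
    (K := ‖A‖ + |lam| * c) (ε := 0) (a := a) (b := b)
    (hΨ.continuousOn.sub hΦ.continuousOn) (fun r hr => ?_) ?_ (fun r hr => ?_) t ht
  · rw [gronwallBound_ε0_δ0] at key
    exact sub_eq_zero.mp (norm_le_zero_iff.mp key)
  · refine ((hasDerivWithinAt_integral_Ici hcΨ hr).sub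
      (hasDerivWithinAt_integral_Ici hcΦ hr)).congr_of_eventuallyEq ?_ (hd r ⟨hr.1, hr.2.le⟩)
    filter_upwards [Icc_mem_nhdsGE hr.2] with q hq
    exact hd q ⟨hr.1.trans hq.1, hq.2⟩
  · rw [hd a ⟨le_rfl, hab⟩]; simp
  · have hr' : r ∈ Icc a b := ⟨hr.1, hr.2.le⟩
    rw [add_zero]
    exact vectorField_sub_le (hcb 𝒜 _ _ (hΨ.isNull r hr') (hΦ.isNull r hr')
      ((hR₁ r hr').trans (le_max_left _ _)) ((hR₂ r hr').trans (le_max_right _ _))).2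

/-- A right ideal generated by an odd element, whose elements multiply to zero. -/
def oddIdeal (O : Submodule ℝ 𝒜) (θ : 𝒜) : Submodule ℝ 𝒜 :=
  ((Algebra.adjoin ℝ (O : Set 𝒜)).toSubmodule.map
    (LinearMap.mulLeft ℝ θ)).topologicalClosure

/-! ### The ideal generated by one odd element, and affine perturbations -/

section OddIdeal

variable {O : Submodule ℝ 𝒜} {θ : 𝒜}

theorem oddIdeal_induction {p : 𝒜 → Prop} (hp : IsClosed {x | p x})
    (h : ∀ g ∈ Algebra.adjoin ℝ (O : Set 𝒜), p (θ * g)) {x : 𝒜} (hx : x ∈ oddIdeal O θ) : p x := by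
  refine closure_minimal (t := {x | p x}) ?_ hp hx
  rintro _ ⟨g, hg, rfl⟩
  exact h g hg

theorem mul_mem_oddIdeal {g : 𝒜} (hg : g ∈ Algebra.adjoin ℝ (O : Set 𝒜)) : θ * g ∈ oddIdeal O θ :=
  subset_closure ⟨g, hg, rfl⟩

theorem self_mem_oddIdeal : θ ∈ oddIdeal O θ := by
  simpa using mul_mem_oddIdeal (θ := θ) (Subalgebra.one_mem (Algebra.adjoin ℝ (O : Set 𝒜)))

theorem isClosed_oddIdeal : IsClosed (oddIdeal O θ : Set 𝒜) :=
  Submodule.isClosed_topologicalClosure _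

theorem oddIdeal_mul_mem {x o : 𝒜} (hx : x ∈ oddIdeal O θ) (ho : o ∈ O) :
    x * o ∈ oddIdeal O θ := by
  refine oddIdeal_induction (p := fun x => x * o ∈ oddIdeal O θ)
    (isClosed_oddIdeal.preimage (continuous_mul_const o)) (fun g hg => ?_) hx
  rw [mul_assoc]
  exact mul_mem_oddIdeal (mul_mem hg (Algebra.subset_adjoin ho))

theorem exists_mul_eq_mul_of_mem_adjoin (hO : IsOddSubspace O) (hθ : θ ∈ O)
    {g : 𝒜} (hg : g ∈ Algebra.adjoin ℝ (O : Set 𝒜)) :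
    ∃ g' ∈ Algebra.adjoin ℝ (O : Set 𝒜), g * θ = θ * g' := by
  induction hg using Algebra.adjoin_induction with
  | mem x hx =>
    exact ⟨-x, neg_mem (Algebra.subset_adjoin hx), by rw [hO.anticomm x hx θ hθ, mul_neg]⟩
  | algebraMap r => exact ⟨_, Subalgebra.algebraMap_mem _ r, Algebra.commutes r θ⟩
  | add x y _ _ hx hy =>
    obtain ⟨x', hx', e1⟩ := hx
    obtain ⟨y', hy', e2⟩ := hy
    exact ⟨x' + y', add_mem hx' hy', by rw [add_mul, e1, e2, mul_add]⟩
  | mul x y _ _ hx hy =>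
    obtain ⟨x', hx', e1⟩ := hx
    obtain ⟨y', hy', e2⟩ := hy
    exact ⟨x' * y', mul_mem hx' hy', by rw [mul_assoc, e2, ← mul_assoc, e1, mul_assoc]⟩

theorem mul_oddIdeal_mem (hO : IsOddSubspace O) (hθ : θ ∈ O)
    {g x : 𝒜} (hg : g ∈ Algebra.adjoin ℝ (O : Set 𝒜))
    (hx : x ∈ oddIdeal O θ) : g * x ∈ oddIdeal O θ := by
  refine oddIdeal_induction (p := fun x => g * x ∈ oddIdeal O θ)
    (isClosed_oddIdeal.preimage (continuous_const_mul g)) (fun k hk => ?_) hx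
  obtain ⟨g', hg', e⟩ := exists_mul_eq_mul_of_mem_adjoin hO hθ hg
  rw [← mul_assoc, e, mul_assoc]
  exact mul_mem_oddIdeal (mul_mem hg' hk)

/-- Moving θ to the left through a polynomial in odd elements changes only signs, so θ g θ k = θ² g'
k = 0. -/
theorem oddIdeal_mul_oddIdeal (hO : IsOddSubspace O) (hθ : θ ∈ O)
    {x y : 𝒜} (hx : x ∈ oddIdeal O θ) (hy : y ∈ oddIdeal O θ) :
    x * y = 0 := by
  refine oddIdeal_induction (p := fun x => x * y = 0)
    (isClosed_eq (continuous_mul_const y) continuous_const) (fun g hg => ?_) hx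
  refine oddIdeal_induction (p := fun y => θ * g * y = 0)
    (isClosed_eq (continuous_const_mul _) continuous_const) (fun k hk => ?_) hy
  obtain ⟨g', hg', e⟩ := exists_mul_eq_mul_of_mem_adjoin hO hθ hg
  rw [mul_assoc, ← mul_assoc g, e, mul_assoc, ← mul_assoc, hO.mul_self hθ, zero_mul]

/-- Products of two perturbations from the ideal vanish, so G(ψ + D) is affine in D. The Lipschitz
constant therefore involves only the bound on ψ and not the size of D and D', which is what rules
out blow-up. -/
theorem exists_evalRV_oddIdeal_bound (hO : IsOddSubspace O) (hθ : θ ∈ O)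
    (G : ExteriorAlgebra ℝ V) {R : ℝ} (hR : 0 ≤ R) :
    ∃ c : ℝ, 0 ≤ c ∧ ∀ ψ D D' : V →L[ℝ] 𝒜, (∀ v, ψ v ∈ O) → (∀ v, D v ∈ O ⊓ oddIdeal O θ) →
      (∀ v, D' v ∈ O ⊓ oddIdeal O θ) → ‖ψ‖ ≤ R →
      evalRV (ψ + D) G - evalRV (ψ + D') G ∈ oddIdeal O θ ∧
      ‖evalRV (ψ + D) G - evalRV (ψ + D') G‖ ≤ c * ‖D - D'‖ := by
  induction G using ExteriorAlgebra.right_induction with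
  | algebraMap r => exact ⟨0, le_rfl, fun ψ D D' _ _ _ _ => by simp⟩
  | add x y hx hy =>
    obtain ⟨c, hc, h1⟩ := hx
    obtain ⟨d, hd, h2⟩ := hy
    refine ⟨c + d, add_nonneg hc hd, fun ψ D D' hψ hD hD' hψR => ?_⟩
    obtain ⟨a1, a2⟩ := h1 ψ D D' hψ hD hD' hψR
    obtain ⟨b1, b2⟩ := h2 ψ D D' hψ hD hD' hψR
    rw [map_add, map_add, add_sub_add_comm, add_mul]
    exact ⟨add_mem a1 b1, norm_add_le_of_le a2 b2⟩
  | mul_ι x m hx =>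
    obtain ⟨c, hc, h1⟩ := hx
    obtain ⟨d, hd, h2⟩ := exists_evalRV_bound x hR
    refine ⟨c * (R * ‖m‖) + d * ‖m‖, by positivity, fun ψ D D' hψ hD hD' hψR => ?_⟩
    obtain ⟨a1, a2⟩ := h1 ψ D D' hψ hD hD' hψR
    have hm : ‖ψ m‖ ≤ R * ‖m‖ := ψ.le_of_opNorm_le hψR m
    have nψ := hO.isNull hψ
    have nD := hO.isNull (ψ := ψ + D) fun v => O.add_mem (hψ v) (hD v).1
    have nD' := hO.isNull (ψ := ψ + D') fun v => O.add_mem (hψ v) (hD' v).1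
    have a3 := (h2 𝒜 ψ ψ nψ nψ hψR hψR).1
    have a4 : evalRV (ψ + D') x - evalRV ψ x ∈ oddIdeal O θ := by
      have := (h1 ψ D' 0 hψ hD' (fun v => zero_mem _) hψR).1
      rwa [add_zero] at this
    have hDD : (D - D') m ∈ oddIdeal O θ := sub_mem (hD m).2 (hD' m).2
    -- Two further terms appear in the expansion of the difference; each is a product of two
    -- elements of the ideal and hence zero.
    have e : evalRV (ψ + D) (x * ExteriorAlgebra.ι ℝ m) - evalRV (ψ + D') (x * ExteriorAlgebra.ι ℝ m)
        = (evalRV (ψ + D) x - evalRV (ψ + D') x) * ψ m + evalRV ψ x * (D - D') m := by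
      have e1 := oddIdeal_mul_oddIdeal hO hθ a1 (hD m).2
      have e2 := oddIdeal_mul_oddIdeal hO hθ a4 hDD
      rw [map_mul, map_mul, evalRV_ι nD, evalRV_ι nD', add_apply, add_apply]
      rw [sub_apply] at e2 ⊢
      have e3 : evalRV (ψ + D) x * (ψ m + D m) - evalRV (ψ + D') x * (ψ m + D' m)
          = (evalRV (ψ + D) x - evalRV (ψ + D') x) * ψ m + evalRV ψ x * (D m - D' m)
          + (evalRV (ψ + D) x - evalRV (ψ + D') x) * D m
          + (evalRV (ψ + D') x - evalRV ψ x) * (D m - D' m) := by noncomm_ring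
      rw [e3, e1, e2, add_zero, add_zero]
    have e1 : ‖(evalRV (ψ + D) x - evalRV (ψ + D') x) * ψ m‖ ≤ c * ‖D - D'‖ * (R * ‖m‖) :=
      (norm_mul_le _ _).trans (mul_le_mul a2 hm (norm_nonneg _) (by positivity))
    have e2 : ‖evalRV ψ x * (D - D') m‖ ≤ d * (‖D - D'‖ * ‖m‖) :=
      (norm_mul_le _ _).trans (mul_le_mul a3 ((D - D').le_opNorm m) (norm_nonneg _) hd)
    rw [e]
    refine ⟨add_mem (oddIdeal_mul_mem a1 (hψ m)) (mul_oddIdeal_mem hO hθ ?_ hDD),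
      (norm_add_le_of_le e1 e2).trans (le_of_eq (by ring))⟩
    exact evalRV_mem_subalgebra nψ (fun v => Algebra.subset_adjoin (hψ v)) x

theorem exists_driftMap_oddIdeal_bound (hO : IsOddSubspace O) (hθ : θ ∈ O)
    (F : V →ₗ[ℝ] ExteriorAlgebra ℝ V) {R : ℝ} (hR : 0 ≤ R) :
    ∃ c : ℝ, 0 ≤ c ∧ ∀ ψ D D' : V →L[ℝ] 𝒜, (∀ v, ψ v ∈ O) → (∀ v, D v ∈ O ⊓ oddIdeal O θ) →
      (∀ v, D' v ∈ O ⊓ oddIdeal O θ) → ‖ψ‖ ≤ R →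
      (∀ v, (driftMap F (ψ + D) - driftMap F (ψ + D')) v ∈ oddIdeal O θ) ∧
      ‖driftMap F (ψ + D) - driftMap F (ψ + D')‖ ≤ c * ‖D - D'‖ := by
  choose c hc hb using fun i =>
    exists_evalRV_oddIdeal_bound hO hθ (F (Module.finBasis ℝ V i)) hR
  set d := Fintype.card (Fin (Module.finrank ℝ V)) •
      ‖((Module.finBasis ℝ V).equivFunL : V →L[ℝ] (Fin (Module.finrank ℝ V) → ℝ))‖ with hd
  have hd0 : 0 ≤ d := by positivity
  have hs : 0 ≤ ∑ i, c i := Finset.sum_nonneg fun i _ => hc i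
  have hi : ∀ i, c i ≤ ∑ i, c i := fun i =>
    Finset.single_le_sum (fun i _ => hc i) (Finset.mem_univ i)
  refine ⟨d * ∑ i, c i, by positivity, fun ψ D D' hψ hD hD' hψR => ⟨fun v => ?_, ?_⟩⟩
  · obtain ⟨_, _, h⟩ := exists_evalRV_oddIdeal_bound hO hθ (F v) hR
    exact (h ψ D D' hψ hD hD' hψR).1
  · rw [mul_assoc]
    refine clm_norm_le_of_basis _ (by positivity) _ fun i => ?_
    exact ((hb i ψ D D' hψ hD hD' hψR).2).trans
      (mul_le_mul_of_nonneg_right (hi i) (norm_nonneg _))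

end OddIdeal

end IntegralEquation

end

noncomputable section
set_option linter.unusedSectionVars false
open Filter Topology

/-! ### Global existence by nilpotency -/

section GlobalExistence

variable {V : Type*} [NormedAddCommGroup V] [InnerProductSpace ℝ V] [FiniteDimensional ℝ V]
  [CompleteSpace V]
variable {𝒜 : Type*} [CStarAlgebra 𝒜]
variable {A : V →L[ℝ] V} {F : V →ₗ[ℝ] ExteriorAlgebra ℝ V} {lam a b : ℝ} {O : Submodule ℝ 𝒜}

/-- The equation with forcing `y` has a solution on `[a, b]` with values in `O`. -/
def HasSolutionIn (A : V →L[ℝ] V) (F : V →ₗ[ℝ] ExteriorAlgebra ℝ V) (lam a b : ℝ)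
    (O : Submodule ℝ 𝒜) (y : ℝ → V →L[ℝ] 𝒜) : Prop :=
  ∃ Ψ : ℝ → V →L[ℝ] 𝒜, Continuous Ψ ∧ (∀ t v, Ψ t v ∈ O) ∧
    ∀ t ∈ Icc a b, Ψ t = y t + ∫ s in a..t, vectorField A F lam (Ψ s)

theorem volterraBound_zero {ν : ℝ} (hν : 0 < ν) : VolterraBound (0 : V →L[ℝ] V) 1 0 ν where
  exp_le t ht := by
    rw [smul_zero, NormedSpace.exp_zero]
    rw [mul_comm, neg_zero, zero_mul, Real.exp_zero, one_mul]
    exact ContinuousLinearMap.norm_id_le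
  pos := by simpa using hν

/-- The weight e^{νs} with ν = 2 `Lc` + 1 beats the Lipschitz constant, so the length of the
interval imposes no smallness. The semigroup is trivial here; any linear drift is part of `n`. -/
theorem exists_forced_solution (O' : Submodule ℝ 𝒜) (hO' : IsClosed (O' : Set 𝒜))
    {n : ℝ → (V →L[ℝ] 𝒜) → (V →L[ℝ] 𝒜)} {Lc ν ρ : ℝ} (hLc : 0 ≤ Lc) (hν : 2 * Lc + 1 = ν)
    (hρ : 0 ≤ ρ)
    (hn_mem : ∀ s ∈ Ioc a b, ∀ x : V →L[ℝ] 𝒜, (∀ v, x v ∈ O') → ‖x‖ ≤ ρ * Real.exp (ν * s) →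
      (∀ v, n s x v ∈ O') ∧ ‖n s x‖ ≤ 2 * Lc * ρ * Real.exp (ν * s))
    (hn_lip : ∀ s ∈ Ioc a b, ∀ x y : V →L[ℝ] 𝒜, (∀ v, x v ∈ O') → (∀ v, y v ∈ O') →
      ‖x‖ ≤ ρ * Real.exp (ν * s) → ‖y‖ ≤ ρ * Real.exp (ν * s) →
      ‖n s x - n s y‖ ≤ Lc * ‖x - y‖)
    (hn_cont : ∀ u : ℝ → V →L[ℝ] 𝒜, Continuous u → (∀ t v, u t v ∈ O') →
      ContinuousOn (fun s => n s (u s)) (Ioc a b)) :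
    ∃ u : ℝ → V →L[ℝ] 𝒜, Continuous u ∧ (∀ t v, u t v ∈ O') ∧
      ∀ t ∈ Icc a b, u t = ∫ s in a..t, n s (u s) := by
  have hν0 : 0 < ν := by linarith
  have h1 : (0 : ℝ) + 1 * (2 * Lc * ρ) / (ν + 0) ≤ ρ := by
    rw [zero_add, one_mul, add_zero, div_le_iff₀ hν0]; nlinarith
  have h2 : 1 * Lc / (ν + 0) ≤ 1 / 2 := by
    rw [one_mul, add_zero, div_le_iff₀ hν0]; linarith
  obtain ⟨u, hu1, hu2, hu3⟩ := exists_volterra_solution (volterraBound_zero hν0)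
    (measurableSet_Ioc (a := a) (b := b)) (O := fun _ => O') (fun _ => hO') (fun _ _ _ => le_rfl)
    (n := n) (g := 0) hρ (by positivity) hLc hn_mem hn_lip
    (fun u hu hu' => hn_cont u hu fun t => (hu' t).1) continuous_zero
    (fun t v => by simp) (fun t => by simp) h1 h2
  refine ⟨u, hu1, fun t => (hu2 t).1, fun t ht => ?_⟩
  rw [hu3 t, intervalIntegral.integral_of_le ht.1]
  have e : Ioc a b ∩ Iic t = Ioc a t := by
    ext s; simp only [mem_inter_iff, mem_Ioc, mem_Iic]
    constructor
    · rintro ⟨⟨h, -⟩, h'⟩; exact ⟨h, h'⟩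
    · rintro ⟨h, h'⟩; exact ⟨⟨h, h'.trans ht.2⟩, h'⟩
  rw [e, Pi.zero_apply, zero_add]
  refine integral_congr_ae (ae_of_all _ fun s => ?_)
  change n s (u s) ∘L NormedSpace.exp ((t - s) • (0 : V →L[ℝ] V)) = _
  rw [smul_zero, NormedSpace.exp_zero]
  rfl

theorem vectorField_zero (hF : ∀ v, F v ∈ ExteriorAlgebra.parity V 1) :
    vectorField A F lam (0 : V →L[ℝ] 𝒜) = 0 := by
  rw [vectorField, driftMap_zero hF]
  ext v
  change (0 : 𝒜) + lam • (0 : 𝒜) = 0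
  rw [smul_zero, add_zero]

theorem IsOddSubspace.vectorField_mem (hO : IsOddSubspace O)
    (hF : ∀ v, F v ∈ ExteriorAlgebra.parity V 1) {ψ : V →L[ℝ] 𝒜} (h : ∀ v, ψ v ∈ O) (v : V) :
    vectorField A F lam ψ v ∈ O :=
  O.add_mem (h _) (O.smul_mem _ (hO.driftMap_mem hF h v))

theorem exists_hasSolutionIn_of_small (hO : IsOddSubspace O)
    (hF : ∀ v, F v ∈ ExteriorAlgebra.parity V 1) :
    ∃ ε : ℝ, 0 < ε ∧ ∀ y : ℝ → V →L[ℝ] 𝒜, Continuous y → (∀ t v, y t v ∈ O) →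
      (∀ t ∈ Icc a b, ‖y t‖ ≤ ε) → HasSolutionIn A F lam a b O y := by
  obtain ⟨c, hc, hcb⟩ := exists_driftMap_bound F (R := 2) zero_le_two
  set Lc := ‖A‖ + |lam| * c with hLc
  have hLc0 : 0 ≤ Lc := by positivity
  set ν := 2 * Lc + 1 with hν
  have hν0 : 0 ≤ ν := by positivity
  -- With this radius the weighted ball stays below 1 up to time b. The unknown and the forcing each
  -- have norm at most 1, whence the radius 2 for the drift bound; the vector field vanishes at 0,
  -- so it is controlled by its Lipschitz constant.
  set ρ := Real.exp (-(ν * b)) with hρ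
  refine ⟨ρ * Real.exp (ν * a), by positivity, fun y hyc hym hys => ?_⟩
  have hρ1 : ∀ s ≤ b, ρ * Real.exp (ν * s) ≤ 1 := fun s hs => by
    rw [hρ, ← Real.exp_add]
    exact Real.exp_le_one_iff.mpr (by nlinarith)
  have hy1 : ∀ s ∈ Icc a b, ‖y s‖ ≤ ρ * Real.exp (ν * s) := fun s hs => (hys s hs).trans (by
    have : ν * a ≤ ν * s := mul_le_mul_of_nonneg_left hs.1 hν0
    gcongr)
  have hmem : ∀ s x, (∀ v, x v ∈ O) → ∀ v, (x + y s) v ∈ O := fun s x hx v =>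
    O.add_mem (hx v) (hym s v)
  have hnorm : ∀ s ∈ Ioc a b, ∀ x : V →L[ℝ] 𝒜, ‖x‖ ≤ ρ * Real.exp (ν * s) →
      ‖x + y s‖ ≤ 2 * (ρ * Real.exp (ν * s)) := fun s hs x hx =>
    (norm_add_le_of_le hx (hy1 s ⟨hs.1.le, hs.2⟩)).trans (by linarith)
  have hnorm2 : ∀ s ∈ Ioc a b, ∀ x : V →L[ℝ] 𝒜, ‖x‖ ≤ ρ * Real.exp (ν * s) → ‖x + y s‖ ≤ 2 :=
    fun s hs x hx => (hnorm s hs x hx).trans (by linarith [hρ1 s hs.2])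
  obtain ⟨u, hu1, hu2, hu3⟩ := exists_forced_solution (a := a) (b := b) O hO.isClosed
    (n := fun s x => vectorField A F lam (x + y s)) hLc0 hν.symm (Real.exp_pos _).le
    (fun s hs x hx hxn => ⟨hO.vectorField_mem hF (hmem s x hx), by
      have h := vectorField_sub_le (A := A) (lam := lam) (hcb 𝒜 _ 0 (hO.isNull (hmem s x hx)) isNull_zero
        (hnorm2 s hs x hxn) (by simp)).2
      rw [vectorField_zero hF, sub_zero, sub_zero] at h
      refine h.trans ((mul_le_mul_of_nonneg_left (hnorm s hs x hxn) hLc0).trans (le_of_eq ?_))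
      ring⟩)
    (fun s hs x z hx hz hxn hzn => by
      have h := vectorField_sub_le (A := A) (lam := lam) (hcb 𝒜 _ _ (hO.isNull (hmem s x hx))
        (hO.isNull (hmem s z hz)) (hnorm2 s hs x hxn) (hnorm2 s hs z hzn)).2
      rwa [add_sub_add_right_eq_sub] at h)
    (fun u hu hum => continuousOn_vectorField (hu.add hyc).continuousOn
      fun t _ => hO.isNull (hmem t _ (hum t)))
  refine ⟨fun t => u t + y t, hu1.add hyc, fun t => hmem t _ (hu2 t), fun t ht => ?_⟩
  change u t + y t = _
  rw [hu3 t ht, add_comm]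

/-- The new solution is sought as Ψ + D with D in the ideal of θ. The equation for D has a Lipschitz
constant depending on Ψ only, so it is solvable on the whole interval however large α and θ are. -/
theorem HasSolutionIn.add_smulRight (hO : IsOddSubspace O) (hab : a ≤ b)
    (hF : ∀ v, F v ∈ ExteriorAlgebra.parity V 1) {y : ℝ → V →L[ℝ] 𝒜}
    (hy : HasSolutionIn A F lam a b O y) {θ : 𝒜} (hθ : θ ∈ O) {α : ℝ → V →L[ℝ] ℝ}
    (hα : Continuous α) : HasSolutionIn A F lam a b O (fun t => y t + (α t).smulRight θ) := by
  obtain ⟨Ψ, hΨc, hΨm, hΨ⟩ := hy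
  obtain ⟨R, hR⟩ := isCompact_Icc.exists_bound_of_continuousOn (hΨc.continuousOn (s := Icc a b))
  have hR0 : 0 ≤ R := (norm_nonneg _).trans (hR a ⟨le_rfl, hab⟩)
  have hDc : Continuous fun t => (α t).smulRight θ :=
    ((ContinuousLinearMap.smulRightL ℝ V 𝒜).flip θ).continuous.comp hα
  obtain ⟨m, hm⟩ := isCompact_Icc.exists_bound_of_continuousOn (hDc.continuousOn (s := Icc a b))
  have hm0 : 0 ≤ m := (norm_nonneg _).trans (hm a ⟨le_rfl, hab⟩)
  obtain ⟨c, hc, hcb⟩ := exists_driftMap_oddIdeal_bound hO hθ F hR0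
  set O' := O ⊓ oddIdeal O θ with hO'
  have hO'c : IsClosed (O' : Set 𝒜) := hO.isClosed.inter isClosed_oddIdeal
  have hDm : ∀ t v, (α t).smulRight θ v ∈ O' := fun t v =>
    O'.smul_mem _ ⟨hθ, self_mem_oddIdeal⟩
  set Lc := ‖A‖ + |lam| * c with hLc
  have hLc0 : 0 ≤ Lc := by positivity
  set ν := 2 * Lc + 1 with hν
  have hν0 : 0 ≤ ν := by positivity
  -- Here the weighted ball only has to contain the forcing: ρ e^{νs} ≥ m for s ≥ a. No upper bound
  -- is required.
  set ρ := m * Real.exp (-(ν * a)) with hρ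
  have hD1 : ∀ s ∈ Icc a b, ‖(α s).smulRight θ‖ ≤ ρ * Real.exp (ν * s) := fun s hs => by
    refine (hm s hs).trans ?_
    rw [hρ, mul_assoc, ← Real.exp_add]
    refine le_mul_of_one_le_right hm0 (Real.one_le_exp ?_)
    nlinarith [hs.1]
  have hmem : ∀ s x, (∀ v, x v ∈ O') → ∀ v, (x + (α s).smulRight θ) v ∈ O' := fun s x hx v =>
    O'.add_mem (hx v) (hDm s v)
  have hfull : ∀ s x, (∀ v, x v ∈ O') → ∀ v, (Ψ s + (x + (α s).smulRight θ)) v ∈ O :=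
    fun s x hx v => O.add_mem (hΨm s v) (hmem s x hx v).1
  have hcomp : ∀ D : V →L[ℝ] 𝒜, (∀ v, D v ∈ O') → ∀ v, (D ∘L A) v ∈ O' := fun D hD v => hD _
  have hΨ0 : ∀ s, Ψ s + 0 = Ψ s := fun s => add_zero _
  have hlip : ∀ s ∈ Ioc a b, ∀ D D' : V →L[ℝ] 𝒜, (∀ v, D v ∈ O') → (∀ v, D' v ∈ O') →
      (∀ v, (vectorField A F lam (Ψ s + D) - vectorField A F lam (Ψ s + D')) v ∈ O') ∧
      ‖vectorField A F lam (Ψ s + D) - vectorField A F lam (Ψ s + D')‖ ≤ Lc * ‖D - D'‖ := by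
    intro s hs D D' hD hD'
    obtain ⟨k1, k2⟩ := hcb (Ψ s) D D' (hΨm s) hD hD' (hR s ⟨hs.1.le, hs.2⟩)
    have e : (Ψ s + D) - (Ψ s + D') = D - D' := by abel
    constructor
    · intro v
      have e1 : (vectorField A F lam (Ψ s + D) - vectorField A F lam (Ψ s + D')) v
          = (D - D') (A v) + lam • (driftMap F (Ψ s + D) - driftMap F (Ψ s + D')) v := by
        simp only [vectorField, sub_apply, add_apply, smul_apply, ContinuousLinearMap.comp_apply,
          smul_sub]
        abel
      refine ⟨O.sub_mem (hO.vectorField_mem hF (fun v => O.add_mem (hΨm s v) (hD v).1) v)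
        (hO.vectorField_mem hF (fun v => O.add_mem (hΨm s v) (hD' v).1) v), ?_⟩
      rw [e1]
      exact add_mem (sub_mem (hD _).2 (hD' _).2) (Submodule.smul_mem _ _ (k1 v))
    · have := vectorField_sub_le (A := A) (lam := lam) (e.symm ▸ k2)
      rwa [e] at this
  obtain ⟨u, hu1, hu2, hu3⟩ := exists_forced_solution (a := a) (b := b) O' hO'c
    (n := fun s x => vectorField A F lam (Ψ s + (x + (α s).smulRight θ))
      - vectorField A F lam (Ψ s)) (ν := ν) (ρ := ρ) hLc0 hν.symm (by positivity)
    (fun s hs x hx hxn => by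
      have h := hlip s hs _ 0 (hmem s x hx) (fun v => zero_mem _)
      rw [hΨ0, sub_zero] at h
      refine ⟨h.1, h.2.trans ?_⟩
      have := norm_add_le_of_le hxn (hD1 s ⟨hs.1.le, hs.2⟩)
      refine (mul_le_mul_of_nonneg_left this hLc0).trans (le_of_eq ?_)
      ring)
    (fun s hs x z hx hz _ _ => by
      have h := (hlip s hs _ _ (hmem s x hx) (hmem s z hz)).2
      rw [add_sub_add_right_eq_sub] at h
      rwa [sub_sub_sub_cancel_right])
    (fun u hu hum => (continuousOn_vectorField (hΨc.add (hu.add hDc)).continuousOn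
      fun t _ => hO.isNull (hfull t _ (hum t))).sub
      (continuousOn_vectorField hΨc.continuousOn fun t _ => hO.isNull (hΨm t)))
  have hcont1 : Continuous fun s => vectorField A F lam (Ψ s + (u s + (α s).smulRight θ)) :=
    continuousOn_univ.mp (continuousOn_vectorField (hΨc.add (hu1.add hDc)).continuousOn
      fun t _ => hO.isNull (hfull t _ (hu2 t)))
  have hcont2 : Continuous fun s => vectorField A F lam (Ψ s) :=
    continuousOn_univ.mp (continuousOn_vectorField hΨc.continuousOn
      fun t _ => hO.isNull (hΨm t))
  refine ⟨fun t => Ψ t + (u t + (α t).smulRight θ), hΨc.add (hu1.add hDc),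
    fun t => hfull t _ (hu2 t), fun t ht => ?_⟩
  have e : u t = _ := hu3 t ht
  rw [intervalIntegral.integral_sub (hcont1.intervalIntegrable _ _)
    (hcont2.intervalIntegrable _ _)] at e
  change Ψ t + (u t + (α t).smulRight θ) = y t + (α t).smulRight θ
    + ∫ s in a..t, vectorField A F lam (Ψ s + (u s + (α s).smulRight θ))
  rw [show (∫ s in a..t, vectorField A F lam (Ψ s + (u s + (α s).smulRight θ)))
    = u t + ∫ s in a..t, vectorField A F lam (Ψ s) by rw [e]; abel, hΨ t ht]
  abel

theorem HasSolutionIn.add_sum (hO : IsOddSubspace O) (hab : a ≤ b)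
    (hF : ∀ v, F v ∈ ExteriorAlgebra.parity V 1) {y : ℝ → V →L[ℝ] 𝒜}
    (hy : HasSolutionIn A F lam a b O y) {ι : Type*} (S : Finset ι) {θ : ι → 𝒜}
    (hθ : ∀ i, θ i ∈ O) {α : ι → ℝ → V →L[ℝ] ℝ} (hα : ∀ i, Continuous (α i)) :
    HasSolutionIn A F lam a b O (fun t => y t + ∑ i ∈ S, (α i t).smulRight (θ i)) := by
  classical
  induction S using Finset.induction_on with
  | empty => simpa using hy
  | insert i S hi ih =>
    have := ih.add_smulRight hO hab hF (hθ i) (hα i)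
    convert this using 2 with t
    rw [Finset.sum_insert hi]; abel

/-- The coefficients of Bernstein approximations are values of y, so they take values in `O`.
Expanding each coefficient in a basis of `V` gives operators of rank at most one. -/
theorem exists_finite_rank_approx (hab : a ≤ b) {y : ℝ → V →L[ℝ] 𝒜} (hy : Continuous y)
    (hm : ∀ t v, y t v ∈ O) {ε : ℝ} (hε : 0 < ε) :
    ∃ (N : ℕ) (θ : Fin (N + 1) × Fin (Module.finrank ℝ V) → 𝒜)
      (α : Fin (N + 1) × Fin (Module.finrank ℝ V) → ℝ → V →L[ℝ] ℝ),
      (∀ i, θ i ∈ O) ∧ (∀ i, Continuous (α i)) ∧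
      ∀ t ∈ Icc a b, ‖y t - ∑ i, (α i t).smulRight (θ i)‖ ≤ ε := by
  let f : C(unitInterval, V →L[ℝ] 𝒜) := ⟨fun x => y (a + x * (b - a)), by fun_prop⟩
  have hlim := ContinuousMap.tendsto_iff_tendstoUniformly.mp (bernsteinApproximation_uniform f)
  obtain ⟨N, hN⟩ := (Metric.tendstoUniformly_iff.mp hlim ε hε).exists
  let e := Module.finBasis ℝ V
  let p : ℝ → unitInterval := fun t => projIcc 0 1 zero_le_one ((t - a) / (b - a))
  have hp : Continuous p := continuous_projIcc.comp (by fun_prop)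
  let τ : Fin (N + 1) → V →L[ℝ] 𝒜 := fun k => f (bernstein.z k)
  refine ⟨N, fun i => τ i.1 (e i.2),
    fun i t => bernstein N i.1 (p t) • LinearMap.toContinuousLinearMap (e.coord i.2),
    fun i => hm _ _, fun i => ?_, fun t ht => ?_⟩
  · exact ((bernstein N i.1).continuous.comp hp).smul continuous_const
  · have hpt : f (p t) = y t := by
      have hx : (t - a) / (b - a) ∈ Icc (0 : ℝ) 1 :=
        ⟨div_nonneg (sub_nonneg.mpr ht.1) (sub_nonneg.mpr hab),
          div_le_one_of_le₀ (by linarith [ht.2]) (sub_nonneg.mpr hab)⟩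
      change y (a + (p t : ℝ) * (b - a)) = y t
      rw [show (p t : ℝ) = (t - a) / (b - a) by rw [show p t = ⟨_, hx⟩ from projIcc_of_mem _ hx]]
      congr 1
      -- For a = b the rescaled time is 0 because division by zero gives 0, and t = a.
      rcases eq_or_ne (b - a) 0 with h0 | h0
      · rw [h0]; linarith [ht.1, ht.2]
      · rw [div_mul_cancel₀ _ h0]; ring
    have hsum : ∑ i : Fin (N + 1) × Fin (Module.finrank ℝ V),
        (bernstein N i.1 (p t) • LinearMap.toContinuousLinearMap (e.coord i.2)).smulRight
          (τ i.1 (e i.2)) = bernsteinApproximation N f (p t) := by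
      rw [bernsteinApproximation.apply, Fintype.sum_prod_type]
      refine Finset.sum_congr rfl fun k _ => ?_
      ext v
      have hv : τ k v = ∑ j, e.coord j v • τ k (e j) := by
        conv_lhs => rw [← e.sum_repr v]
        rw [map_sum]
        exact Finset.sum_congr rfl fun j _ => by rw [map_smul]; rfl
      have hl : (∑ j, (bernstein N k (p t) • LinearMap.toContinuousLinearMap
          (e.coord j)).smulRight (τ k (e j))) v
          = ∑ j, bernstein N k (p t) • e.coord j v • τ k (e j) := by
        rw [sum_apply]
        refine Finset.sum_congr rfl fun j _ => ?_
        rw [smul_smul]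
        rfl
      rw [hl, ← Finset.smul_sum, ← hv]
      rfl
    rw [hsum, ← hpt, ← dist_eq_norm]
    exact (hN (p t)).le

/-- Solve first with the small remainder of the finite rank approximation as forcing, then restore
the rank-one terms one at a time. -/
theorem exists_hasSolutionIn (hO : IsOddSubspace O) (hab : a ≤ b)
    (hF : ∀ v, F v ∈ ExteriorAlgebra.parity V 1) {y : ℝ → V →L[ℝ] 𝒜} (hy : Continuous y)
    (hm : ∀ t v, y t v ∈ O) : HasSolutionIn A F lam a b O y := by
  obtain ⟨ε, hε, hsmall⟩ := exists_hasSolutionIn_of_small (a := a) (b := b) (A := A) (lam := lam) hO hF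
  obtain ⟨N, θ, α, hθ, hα, happ⟩ := exists_finite_rank_approx hab hy hm hε
  have hcont : Continuous fun t => ∑ i, (α i t).smulRight (θ i) :=
    continuous_finsetSum _ fun i _ =>
      ((ContinuousLinearMap.smulRightL ℝ V 𝒜).flip (θ i)).continuous.comp (hα i)
  have h := hsmall (fun t => y t - ∑ i, (α i t).smulRight (θ i)) (hy.sub hcont)
    (fun t v => O.sub_mem (hm t v) (by
      have e : (∑ i, (α i t).smulRight (θ i)) v = ∑ i, (α i t).smulRight (θ i) v := by
        rw [sum_apply]
      exact e.symm ▸ O.sum_mem fun i _ => O.smul_mem _ (hθ i))) happ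
  have := h.add_sum hO hab hF Finset.univ hθ hα
  simpa using this

theorem HasSolutionIn.exists_isIntegralSolution (hO : IsOddSubspace O) {y : ℝ → V →L[ℝ] 𝒜}
    (h : HasSolutionIn A F lam a b O y) :
    ∃ Ψ : ℝ → V →L[ℝ] 𝒜, IsIntegralSolution A F lam y a b Ψ ∧ ∀ t v, Ψ t v ∈ O := by
  obtain ⟨Ψ, h1, h2, h3⟩ := h
  exact ⟨Ψ, ⟨h1.continuousOn, fun t _ => hO.isNull (h2 t), h3⟩, h2⟩

theorem IsIntegralSolution.mono {y Ψ : ℝ → V →L[ℝ] 𝒜} {b' : ℝ} (hb : b' ≤ b)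
    (h : IsIntegralSolution A F lam y a b Ψ) : IsIntegralSolution A F lam y a b' Ψ :=
  ⟨h.1.mono (Icc_subset_Icc_right hb), fun t ht => h.2 t (Icc_subset_Icc_right hb ht),
    fun t ht => h.3 t (Icc_subset_Icc_right hb ht)⟩

/-- Global existence of solutions with additive forcing. -/
theorem exists_global_solution (hO : IsOddSubspace O)
    (hF : ∀ v, F v ∈ ExteriorAlgebra.parity V 1) {y : ℝ → V →L[ℝ] 𝒜} (hy : Continuous y)
    (hm : ∀ t v, y t v ∈ O) (a : ℝ) :
    ∃ Ψ : ℝ → V →L[ℝ] 𝒜, (∀ t, IsNull (Ψ t)) ∧ ∀ b, IsIntegralSolution A F lam y a b Ψ := by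
  have hab : ∀ b, a ≤ max a b := fun b => le_max_left _ _
  choose Φ hΦ hΦm using fun b => HasSolutionIn.exists_isIntegralSolution (O := O) hO
    (exists_hasSolutionIn (A := A) (lam := lam) hO (hab b) hF hy hm)
  have huniq : ∀ b b' t, t ∈ Icc a b → t ∈ Icc a b' → Φ b t = Φ b' t := by
    intro b b' t ht ht'
    exact ((hΦ b).mono (b' := t) (ht.2.trans (le_max_right _ _))).unique
      ((hΦ b').mono (b' := t) (ht'.2.trans (le_max_right _ _))) t ⟨ht.1, le_rfl⟩
  have hΨ : ∀ b, ∀ t ∈ Icc a b, Φ t t = Φ b t := fun b t ht => huniq t b t ⟨ht.1, le_rfl⟩ ht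
  -- The solutions on the intervals from a to `max a b` agree on overlaps by uniqueness, so the
  -- diagonal glues them.
  refine ⟨fun t => Φ t t, fun t => hO.isNull (hΦm t t), fun b => ⟨?_, ?_, ?_⟩⟩
  · exact ((hΦ b).mono (le_max_right _ _)).continuousOn.congr (hΨ b)
  · exact fun t _ => hO.isNull (hΦm t t)
  · intro t ht
    rw [hΨ b t ht, ((hΦ b).mono (le_max_right _ _)).equation t ht]
    congr 1
    refine intervalIntegral.integral_congr fun s hs => ?_
    rw [uIcc_of_le ht.1] at hs
    change _ = vectorField A F lam (Φ s s)
    rw [hΨ b s ⟨hs.1, hs.2.trans ht.2⟩]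

end GlobalExistence

end

noncomputable section
set_option linter.unusedSectionVars false
open Filter Topology

/-! ### The Ornstein-Uhlenbeck kernels in `L²` -/

section Kernel

variable {V : Type*} [NormedAddCommGroup V] [InnerProductSpace ℝ V] [FiniteDimensional ℝ V]
  [CompleteSpace V]

/-- The space `L²(ℝ; V)`. -/
abbrev L2 (V : Type*) [NormedAddCommGroup V] : Type _ := Lp V 2 (volume : Measure ℝ)

theorem inner_eq_of_ae_indicator {f g : L2 V} {S : Set ℝ} (hS : MeasurableSet S) {φ ψ : ℝ → V}
    (hf : f =ᵐ[volume] S.indicator φ) (hg : g =ᵐ[volume] S.indicator ψ) :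
    inner ℝ f g = ∫ s in S, inner ℝ (φ s) (ψ s) := by
  rw [L2.inner_def, ← integral_indicator hS]
  refine integral_congr_ae ?_
  filter_upwards [hf, hg] with s h1 h2
  rw [h1, h2]
  by_cases hs : s ∈ S <;> simp [hs]

theorem inner_eq_zero_of_disjoint {f g : L2 V} {S S' : Set ℝ} {φ ψ : ℝ → V}
    (hf : f =ᵐ[volume] S.indicator φ) (hg : g =ᵐ[volume] S'.indicator ψ) (h : Disjoint S S') :
    inner ℝ f g = 0 := by
  rw [L2.inner_def]
  refine integral_eq_zero_of_ae ?_
  filter_upwards [hf, hg] with s h1 h2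
  rw [h1, h2]
  by_cases hs : s ∈ S
  · have : s ∉ S' := disjoint_left.mp h hs
    simp [this]
  · simp [hs]

theorem norm_le_of_ae_indicator {f : L2 V} {a b c : ℝ} (hab : a ≤ b) (hc : 0 ≤ c) {φ : ℝ → V}
    (hf : f =ᵐ[volume] (Ioc a b).indicator φ) (hb : ∀ s ∈ Ioc a b, ‖φ s‖ ≤ c) :
    ‖f‖ ≤ c * √(b - a) := by
  have h1 : ‖f‖ ^ 2 ≤ c ^ 2 * (b - a) := by
    rw [← real_inner_self_eq_norm_sq, inner_eq_of_ae_indicator measurableSet_Ioc hf hf]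
    have h2 := norm_setIntegral_le_of_norm_le_const (μ := (volume : Measure ℝ)) (s := Ioc a b)
      (f := fun s => inner ℝ (φ s) (φ s)) (C := c ^ 2) measure_Ioc_lt_top (fun s hs => by
        rw [real_inner_self_eq_norm_sq, Real.norm_eq_abs, abs_of_nonneg (by positivity)]
        exact pow_le_pow_left₀ (norm_nonneg _) (hb s hs) 2)
    rw [Real.volume_real_Ioc_of_le hab] at h2
    exact (le_abs_self _).trans h2
  have h3 : c ^ 2 * (b - a) = (c * √(b - a)) ^ 2 := by
    rw [mul_pow, Real.sq_sqrt (sub_nonneg.mpr hab)]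
  rw [h3] at h1
  exact le_of_sq_le_sq h1 (by positivity)

variable {A : V →L[ℝ] V} {M η : ℝ}

theorem norm_exp_apply_le (hA : VolterraBound A M η 0) {t : ℝ} (ht : 0 ≤ t) (v : V) :
    ‖NormedSpace.exp (t • A) v‖ ≤ M * ‖v‖ := by
  have hη : 0 < η := by simpa using hA.pos
  refine (ContinuousLinearMap.le_opNorm _ _).trans (mul_le_mul_of_nonneg_right
    ((hA.exp_le t ht).trans ?_) (norm_nonneg _))
  exact mul_le_of_le_one_right hA.nonneg (Real.exp_le_one_iff.mpr (by nlinarith))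

theorem continuous_exp_sub_apply (A : V →L[ℝ] V) (t : ℝ) (v : V) :
    Continuous fun s : ℝ => NormedSpace.exp ((t - s) • A) v :=
  ((continuous_exp_smul A).comp (continuous_const.sub continuous_id)).clm_apply continuous_const

theorem integrableOn_ouFun_sq (hA : VolterraBound A M η 0) (t : ℝ) (v : V) :
    IntegrableOn (fun s => ‖NormedSpace.exp ((t - s) • A) v‖ ^ 2) (Iic t) ∧
    ∫ s in Iic t, ‖NormedSpace.exp ((t - s) • A) v‖ ^ 2 ≤ M ^ 2 / (2 * η) * ‖v‖ ^ 2 := by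
  have hη : 0 < η := by simpa using hA.pos
  have h1 : IntegrableOn (fun s => (M * ‖v‖) ^ 2 * Real.exp (-(2 * η) * t)
      * Real.exp ((2 * η) * s)) (Iic t) :=
    (integrableOn_exp_mul_Iic (by positivity) t).const_mul _
  have hb : ∀ s ∈ Iic t, ‖NormedSpace.exp ((t - s) • A) v‖ ^ 2
      ≤ (M * ‖v‖) ^ 2 * Real.exp (-(2 * η) * t) * Real.exp ((2 * η) * s) := fun s hs => by
    have h0 : ‖NormedSpace.exp ((t - s) • A) v‖ ≤ M * Real.exp (-η * (t - s)) * ‖v‖ :=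
      ContinuousLinearMap.le_of_opNorm_le _ (hA.exp_le _ (sub_nonneg.mpr hs)) v
    refine (pow_le_pow_left₀ (norm_nonneg _) h0 2).trans (le_of_eq ?_)
    have e : Real.exp (-(2 * η) * t) * Real.exp ((2 * η) * s)
        = Real.exp (-η * (t - s)) ^ 2 := by
      rw [← Real.exp_add, ← Real.exp_nat_mul]; push_cast; ring_nf
    rw [mul_assoc _ (Real.exp (-(2 * η) * t)), e]; ring
  have hi : IntegrableOn (fun s => ‖NormedSpace.exp ((t - s) • A) v‖ ^ 2) (Iic t) := by
    refine h1.mono' ((continuous_exp_sub_apply A t v).norm.pow 2).aestronglyMeasurable ?_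
    refine (ae_restrict_mem measurableSet_Iic).mono fun s hs => ?_
    rw [Real.norm_eq_abs, abs_of_nonneg (by positivity)]
    exact hb s hs
  refine ⟨hi, (setIntegral_mono_on hi h1 measurableSet_Iic hb).trans (le_of_eq ?_)⟩
  rw [integral_const_mul, integral_exp_mul_Iic (by positivity)]
  have : Real.exp (-(2 * η) * t) * Real.exp ((2 * η) * t) = 1 := by
    rw [← Real.exp_add]; ring_nf; exact Real.exp_zero
  calc _ = (M * ‖v‖) ^ 2 * (Real.exp (-(2 * η) * t) * Real.exp ((2 * η) * t)) / (2 * η) := by ring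
    _ = _ := by rw [this]; ring

theorem memLp_ouFun (hA : VolterraBound A M η 0) (t : ℝ) (v : V) :
    MemLp (ouFun A t v) 2 (volume : Measure ℝ) := by
  refine (memLp_indicator_iff_restrict measurableSet_Iic).mpr ?_
  refine (memLp_two_iff_integrable_sq_norm
    (continuous_exp_sub_apply A t v).aestronglyMeasurable).mpr ?_
  exact (integrableOn_ouFun_sq hA t v).1

theorem ouKernel_apply (hA : VolterraBound A M η 0) (t : ℝ) (v : V) :
    ouKernel A t v = (memLp_ouFun hA t v).toLp (ouFun A t v) := by
  rw [ouKernel, dif_pos fun v => memLp_ouFun hA t v]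
  rfl

theorem coeFn_ouKernel (hA : VolterraBound A M η 0) (t : ℝ) (v : V) :
    ouKernel A t v =ᵐ[volume] (Iic t).indicator fun s => NormedSpace.exp ((t - s) • A) v := by
  rw [ouKernel_apply hA]
  exact (memLp_ouFun hA t v).coeFn_toLp

theorem exists_norm_ouKernel_le (hA : VolterraBound A M η 0) :
    ∃ c : ℝ, 0 ≤ c ∧ ∀ t v, ‖ouKernel A t v‖ ≤ c * ‖v‖ := by
  have hη : 0 < η := by simpa using hA.pos
  refine ⟨√(M ^ 2 / (2 * η)), Real.sqrt_nonneg _, fun t v => ?_⟩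
  refine le_of_sq_le_sq ?_ (by positivity)
  rw [← real_inner_self_eq_norm_sq, inner_eq_of_ae_indicator measurableSet_Iic
    (coeFn_ouKernel hA t v) (coeFn_ouKernel hA t v), mul_pow, Real.sq_sqrt (by positivity)]
  simpa only [real_inner_self_eq_norm_sq] using (integrableOn_ouFun_sq hA t v).2

/-- The increment `𝟙_{(t,t+h]}(·) e^{A(t+h-·)} v` of the Ornstein-Uhlenbeck kernel. -/
def ouIncrement (A : V →L[ℝ] V) (t h : ℝ) (v : V) : L2 V :=
  ouKernel A (t + h) v - ouKernel A t (NormedSpace.exp (h • A) v)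

theorem coeFn_ouIncrement (hA : VolterraBound A M η 0) (t : ℝ) {h : ℝ} (hh : 0 ≤ h) (v : V) :
    ouIncrement A t h v =ᵐ[volume]
      (Ioc t (t + h)).indicator fun s => NormedSpace.exp ((t + h - s) • A) v := by
  filter_upwards [Lp.coeFn_sub (ouKernel A (t + h) v) (ouKernel A t (NormedSpace.exp (h • A) v)),
    coeFn_ouKernel hA (t + h) v, coeFn_ouKernel hA t (NormedSpace.exp (h • A) v)] with s h1 h2 h3
  rw [ouIncrement, h1, Pi.sub_apply, h2, h3]
  by_cases hs : s ≤ t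
  · have e : NormedSpace.exp ((t - s) • A) (NormedSpace.exp (h • A) v)
        = NormedSpace.exp ((t + h - s) • A) v := by
      rw [show t + h - s = (t - s) + h by ring, exp_add_smul]; rfl
    have hs' : s ≤ t + h := by linarith
    simp [indicator, hs, hs', e]
  · by_cases hs' : s ≤ t + h <;> simp [indicator, hs, hs', not_le.mp hs]

theorem norm_ouIncrement_le (hA : VolterraBound A M η 0) (t : ℝ) {h : ℝ} (hh : 0 ≤ h) (v : V) :
    ‖ouIncrement A t h v‖ ≤ M * ‖v‖ * √h := by
  have := norm_le_of_ae_indicator (c := M * ‖v‖) (by linarith) (mul_nonneg hA.nonneg (norm_nonneg _))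
    (coeFn_ouIncrement hA t hh v) (fun s hs => norm_exp_apply_le hA (by linarith [hs.2]) v)
  rwa [add_sub_cancel_left] at this

theorem coeFn_compLpL_indicator (C : V →L[ℝ] V) {f : L2 V} {S : Set ℝ} {φ : ℝ → V}
    (hf : f =ᵐ[volume] S.indicator φ) :
    C.compLpL 2 (volume : Measure ℝ) f =ᵐ[volume] S.indicator fun s => C (φ s) := by
  filter_upwards [C.coeFn_compLpL (p := 2) f, hf] with s h1 h2
  rw [h1, h2]
  by_cases hs : s ∈ S <;> simp [hs]

/-- The supports (-∞, s] and (t, t + h] are disjoint: a noise increment is uncorrelated with the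
past. -/
theorem inner_ouKernel_ouIncrement (hA : VolterraBound A M η 0) (C : V →L[ℝ] V) {s t h : ℝ}
    (hst : s ≤ t) (hh : 0 ≤ h) (v w : V) :
    inner ℝ (ouKernel A s v) (C.compLpL 2 (volume : Measure ℝ) (ouIncrement A t h w)) = 0 :=
  inner_eq_zero_of_disjoint (coeFn_ouKernel hA s v)
    (coeFn_compLpL_indicator C (coeFn_ouIncrement hA t hh w))
    (disjoint_left.mpr fun _ h1 h2 => absurd (le_trans h1 hst) (not_le.mpr h2.1))

/-- The covariance of the increments of the Ornstein-Uhlenbeck process. -/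
def incrementCov (A C : V →L[ℝ] V) (v w : V) (h : ℝ) : ℝ :=
  ∫ s in (0 : ℝ)..h, inner ℝ (NormedSpace.exp (s • A) v) (C (NormedSpace.exp (s • A) w))

theorem inner_ouIncrement (hA : VolterraBound A M η 0) (C : V →L[ℝ] V) (t : ℝ) {h : ℝ}
    (hh : 0 ≤ h) (v w : V) :
    inner ℝ (ouIncrement A t h v) (C.compLpL 2 (volume : Measure ℝ) (ouIncrement A t h w))
      = incrementCov A C v w h := by
  rw [inner_eq_of_ae_indicator measurableSet_Ioc (coeFn_ouIncrement hA t hh v)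
    (coeFn_compLpL_indicator C (coeFn_ouIncrement hA t hh w)),
    ← intervalIntegral.integral_of_le (by linarith),
    intervalIntegral.integral_comp_sub_left
      (fun s => inner ℝ (NormedSpace.exp (s • A) v) (C (NormedSpace.exp (s • A) w))) (t + h),
    sub_self, add_sub_cancel_left]
  rfl

theorem hasDerivAt_incrementCov (A C : V →L[ℝ] V) (v w : V) :
    HasDerivAt (incrementCov A C v w) (inner ℝ v (C w)) 0 := by
  have h1 : Continuous fun s : ℝ => inner ℝ (NormedSpace.exp (s • A) v)
      (C (NormedSpace.exp (s • A) w)) := by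
    have := continuous_exp_smul A
    exact (this.clm_apply continuous_const).inner
      (C.continuous.comp (this.clm_apply continuous_const))
  have h2 := (h1.integral_hasStrictDerivAt 0 0).hasDerivAt
  simp only [zero_smul, NormedSpace.exp_zero] at h2
  exact h2

theorem incrementCov_zero (A C : V →L[ℝ] V) (v w : V) : incrementCov A C v w 0 = 0 := by
  simp [incrementCov]

theorem continuousOn_of_modulus {E : Type*} [NormedAddCommGroup E] {f : ℝ → E} {S : Set ℝ}
    {m : ℝ → ℝ} (hm : Continuous m) (hm0 : m 0 = 0)
    (h : ∀ s ∈ S, ∀ t ∈ S, s ≤ t → ‖f t - f s‖ ≤ m (t - s)) : ContinuousOn f S := by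
  intro t ht
  rw [ContinuousWithinAt, tendsto_iff_norm_sub_tendsto_zero]
  have hlim : Tendsto (fun s => m |s - t|) (𝓝[S] t) (𝓝 0) := by
    have h1 : Continuous fun s => m |s - t| := hm.comp (by fun_prop)
    have := (h1.tendsto t).mono_left (nhdsWithin_le_nhds (s := S))
    simpa [hm0] using this
  refine squeeze_zero' (Eventually.of_forall fun _ => norm_nonneg _) ?_ hlim
  filter_upwards [self_mem_nhdsWithin] with s hs
  rcases le_total t s with hts | hts
  · rw [abs_of_nonneg (sub_nonneg.mpr hts)]
    exact h t ht s hs hts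
  · rw [abs_sub_comm, abs_of_nonneg (sub_nonneg.mpr hts), norm_sub_rev]
    exact h s hs t ht hts

theorem continuous_ouKernel (hA : VolterraBound A M η 0) (v : V) :
    Continuous fun t => ouKernel A t v := by
  obtain ⟨c, hc, hcb⟩ := exists_norm_ouKernel_le hA
  let m : ℝ → ℝ := fun h => M * ‖v‖ * √h + c * ‖NormedSpace.exp (h • A) v - v‖
  have hm : Continuous m := by
    have := (continuous_exp_smul A).clm_apply (continuous_const (y := v))
    fun_prop
  have hm0 : m 0 = 0 := by simp [m, NormedSpace.exp_zero]
  have key : ∀ s h : ℝ, 0 ≤ h → ‖ouKernel A (s + h) v - ouKernel A s v‖ ≤ m h := by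
    intro s h hh
    have e : ouKernel A (s + h) v - ouKernel A s v
        = ouIncrement A s h v + ouKernel A s (NormedSpace.exp (h • A) v - v) := by
      rw [ouIncrement, map_sub]; abel
    rw [e]
    exact norm_add_le_of_le (norm_ouIncrement_le hA s hh v) (hcb _ _)
  refine continuousOn_univ.mp (continuousOn_of_modulus hm hm0 fun s _ t _ hst => ?_)
  simpa using key s (t - s) (sub_nonneg.mpr hst)

theorem norm_exp_apply_sub_le (hA : VolterraBound A M η 0) {u : ℝ} (hu : 0 ≤ u) (v : V) :
    ‖NormedSpace.exp (u • A) v - v‖ ≤ M * ‖A v‖ * u := by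
  have hd : ∀ s : ℝ, HasDerivAt (fun s : ℝ => NormedSpace.exp (s • A) v)
      (NormedSpace.exp (s • A) (A v)) s := fun s => by
    have := (hasDerivAt_exp_smul_const A s).clm_apply (hasDerivAt_const s v)
    simpa using this
  have := norm_image_sub_le_of_norm_deriv_le_segment' (f := fun s : ℝ => NormedSpace.exp (s • A) v)
    (C := M * ‖A v‖) (a := 0) (b := u) (fun s _ => (hd s).hasDerivWithinAt)
    (fun s hs => norm_exp_apply_le hA hs.1 _) u ⟨hu, le_rfl⟩
  simpa [NormedSpace.exp_zero] using this

/-- The indicator function `𝟙_{[0,t]} v`. -/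
def indicatorKernel (t : ℝ) (v : V) : L2 V :=
  indicatorConstLp 2 (measurableSet_Icc (a := (0 : ℝ)) (b := t))
    (measure_Icc_lt_top (μ := (volume : Measure ℝ))).ne v

theorem coeFn_indicatorKernel (t : ℝ) (v : V) :
    indicatorKernel t v =ᵐ[volume] (Icc 0 t).indicator fun _ => v := indicatorConstLp_coeFn

/-- The two increments differ by e^{(t+h-s)A}v - v = O(h) on an interval of length h, hence by
O(h^{3/2}) = o(h) in L². Each increment alone is only controlled to order √h. The condition t ≥ 0
matters since the Brownian indicator starts at 0. -/
theorem norm_remainder_le (hA : VolterraBound A M η 0) {t h : ℝ} (ht : 0 ≤ t) (hh : 0 ≤ h) (v : V) :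
    ‖ouIncrement A t h v - (indicatorKernel (t + h) v - indicatorKernel t v)‖
      ≤ M * ‖A v‖ * h * √h := by
  have hae : (ouIncrement A t h v - (indicatorKernel (t + h) v - indicatorKernel t v) : L2 V)
      =ᵐ[volume] (Ioc t (t + h)).indicator fun s => NormedSpace.exp ((t + h - s) • A) v - v := by
    filter_upwards [Lp.coeFn_sub (ouIncrement A t h v)
        (indicatorKernel (t + h) v - indicatorKernel t v),
      Lp.coeFn_sub (indicatorKernel (t + h) v) (indicatorKernel t v),
      coeFn_ouIncrement hA t hh v, coeFn_indicatorKernel (t + h) v,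
      coeFn_indicatorKernel t v] with s h1 h2 h3 h4 h5
    rw [h1, Pi.sub_apply, h2, Pi.sub_apply, h3, h4, h5]
    by_cases h0 : 0 ≤ s <;> by_cases h1 : s ≤ t <;> by_cases h2 : s ≤ t + h
    all_goals first
      | (exfalso; linarith)
      | simp [indicator, h0, h1, h2, not_le.mp h1]
      | simp [indicator, h0, h1, h2, not_lt.mpr h1]
  have := norm_le_of_ae_indicator (c := M * ‖A v‖ * h) (by linarith)
    (mul_nonneg (mul_nonneg hA.nonneg (norm_nonneg _)) hh) hae (fun s hs => by
      refine (norm_exp_apply_sub_le hA (by linarith [hs.2]) v).trans ?_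
      exact mul_le_mul_of_nonneg_left (by linarith [hs.1])
        (mul_nonneg hA.nonneg (norm_nonneg _)))
  rwa [add_sub_cancel_left] at this

theorem hasDerivWithinAt_zero_of_norm_le {E : Type*} [NormedAddCommGroup E] [NormedSpace ℝ E]
    {f : ℝ → E} {t c : ℝ} (h : ∀ r, t ≤ r → ‖f r - f t‖ ≤ c * (r - t) * √(r - t)) :
    HasDerivWithinAt f 0 (Ici t) t := by
  rw [hasDerivWithinAt_iff_isLittleO]
  have h1 : (fun r => f r - f t - (r - t) • (0 : E)) =O[𝓝[Ici t] t]
      fun r => (r - t) * √(r - t) := by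
    refine Asymptotics.IsBigO.of_bound c ?_
    filter_upwards [self_mem_nhdsWithin] with r hr
    have hr' : 0 ≤ r - t := sub_nonneg.mpr hr
    rw [smul_zero, sub_zero, Real.norm_eq_abs, abs_of_nonneg (by positivity), ← mul_assoc]
    exact h r hr
  refine h1.trans_isLittleO ?_
  have h2 : (fun r => √(r - t)) =o[𝓝[Ici t] t] fun _ => (1 : ℝ) := by
    rw [Asymptotics.isLittleO_one_iff]
    have : Continuous fun r => √(r - t) := by fun_prop
    have h3 := (this.tendsto t).mono_left (nhdsWithin_le_nhds (s := Ici t))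
    simpa using h3
  simpa using (Asymptotics.isBigO_refl (fun r => r - t) (𝓝[Ici t] t)).mul_isLittleO h2

/-- The Brownian kernel in terms of the Ornstein-Uhlenbeck kernels. -/
theorem indicatorKernel_eq (hA : VolterraBound A M η 0) {T : ℝ} (hT : 0 ≤ T) (v : V) :
    indicatorKernel T v
      = ouKernel A T v - ouKernel A 0 v - ∫ s in (0 : ℝ)..T, ouKernel A s (A v) := by
  have hk := continuous_ouKernel hA (A v)
  -- The combination has zero right derivative, without differentiating the kernel and the indicator
  -- separately: their difference is the o(h) remainder plus the smooth term `ouKernel A t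
  -- (e^{(r-t)A} v)`, whose derivative cancels that of the integral.
  let Q : ℝ → L2 V := fun t => ouKernel A t v - (∫ s in (0 : ℝ)..t, ouKernel A s (A v))
    - indicatorKernel t v
  have hQ : ∀ t, 0 ≤ t → HasDerivWithinAt Q 0 (Ici t) t := by
    intro t ht
    let R : ℝ → L2 V := fun r =>
      ouIncrement A t (r - t) v - (indicatorKernel (t + (r - t)) v - indicatorKernel t v)
    have hR : HasDerivWithinAt R 0 (Ici t) t := by
      refine hasDerivWithinAt_zero_of_norm_le (c := M * ‖A v‖) fun r hr => ?_
      have hR0 : R t = 0 := by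
        simp only [R, sub_self, add_zero, ouIncrement, zero_smul, NormedSpace.exp_zero, sub_zero]
        exact sub_self _
      rw [hR0, sub_zero]
      exact norm_remainder_le hA ht (sub_nonneg.mpr hr) v
    have h2 : HasDerivAt (fun r : ℝ => ouKernel A t (NormedSpace.exp ((r - t) • A) v))
        (ouKernel A t (A v)) t := by
      have h3 : HasDerivAt (fun r : ℝ => NormedSpace.exp ((r - t) • A)) A t := by
        have := (hasDerivAt_exp_smul_const A (0 : ℝ))
        rw [zero_smul, NormedSpace.exp_zero, one_mul, ← sub_self t] at this
        exact this.comp_sub_const t t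
      have h4 := h3.clm_apply (hasDerivAt_const t v)
      simp only [map_zero, add_zero] at h4
      exact ((LinearMap.toContinuousLinearMap (ouKernel A t)).hasFDerivAt).comp_hasDerivAt t h4
    have h5 := (hk.integral_hasStrictDerivAt 0 t).hasDerivAt
    have h6 := ((hR.add h2.hasDerivWithinAt).sub h5.hasDerivWithinAt)
    have e : ∀ r, Q r = R r + ouKernel A t (NormedSpace.exp ((r - t) • A) v)
        - (∫ s in (0 : ℝ)..r, ouKernel A s (A v)) - indicatorKernel t v := fun r => by
      simp only [Q, R, ouIncrement, add_sub_cancel]; abel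
    have h7 := h6.sub_const (indicatorKernel t v)
    rw [zero_add, sub_self] at h7
    exact h7.congr (fun r _ => e r) (e t)
  have hI : ContinuousOn (fun t => indicatorKernel t v) (Icc 0 T) := by
    refine continuousOn_of_modulus (m := fun h => M * ‖v‖ * √h + M * ‖A v‖ * h * √h)
      (by fun_prop) (by simp) fun s hs t _ hst => ?_
    have h1 := norm_ouIncrement_le hA s (sub_nonneg.mpr hst) v
    have h2 := norm_remainder_le hA hs.1 (sub_nonneg.mpr hst) v
    have h3 := norm_sub_le_of_le h1 h2
    rwa [sub_sub_cancel, add_sub_cancel] at h3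
  have hQc : ContinuousOn Q (Icc 0 T) :=
    ((continuous_ouKernel hA v).continuousOn.sub
      (intervalIntegral.continuous_primitive (fun a b => hk.intervalIntegrable a b) 0).continuousOn
      ).sub hI
  have hconst := constant_of_has_deriv_right_zero hQc (fun t ht => hQ t ht.1) T ⟨hT, le_rfl⟩
  have h0 : indicatorKernel 0 v = 0 := by
    refine Lp.ext ?_
    filter_upwards [coeFn_indicatorKernel 0 v, Lp.coeFn_zero V 2 (volume : Measure ℝ),
      Measure.ae_ne (volume : Measure ℝ) 0] with s h1 h2 h3
    rw [h1, h2, Icc_self, indicator_of_notMem (by simpa using h3)]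
    rfl
  have h1 : ouKernel A T v - (∫ s in (0 : ℝ)..T, ouKernel A s (A v)) - indicatorKernel T v
      = ouKernel A 0 v := by
    refine hconst.trans ?_
    simp only [Q, intervalIntegral.integral_same, h0, sub_zero]
  rw [← h1]; abel

end Kernel

end

noncomputable section
set_option linter.unusedSectionVars false
open Filter Topology

/-! ### The noise and its joint law with the initial condition -/

section Noise

variable {V : Type*} [NormedAddCommGroup V] [InnerProductSpace ℝ V] [FiniteDimensional ℝ V]
  [CompleteSpace V]
variable {𝒜 : Type*} [CStarAlgebra 𝒜] {ω : 𝒜 →L[ℂ] ℂ} {A C : V →L[ℝ] V} {M η : ℝ}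
variable {Ξ : GrassmannRV (L2 V) 𝒜}

theorem IsWhiteNoise.exists_clm (hΞ : IsWhiteNoise ω C Ξ) :
    ∃ N : L2 V →L[ℝ] 𝒜, ∀ f, N f = Ξ (ExteriorAlgebra.ι ℝ f) := by
  obtain ⟨c, hc⟩ := hΞ.1
  exact ⟨LinearMap.mkContinuous (Ξ.toLinearMap ∘ₗ ExteriorAlgebra.ι ℝ) c hc, fun f => rfl⟩

theorem ouMotion_lin_apply (A : V →L[ℝ] V) (Ξ : GrassmannRV (L2 V) 𝒜) (t : ℝ) (v : V) :
    (ouMotion A Ξ t).lin v = Ξ (ExteriorAlgebra.ι ℝ (ouKernel A t v)) := by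
  rw [GrassmannRV.lin_apply, ouMotion, AlgHom.comp_apply, ExteriorAlgebra.map_apply_ι]

theorem continuous_ouMotion (hA : VolterraBound A M η 0) (hΞ : IsWhiteNoise ω C Ξ) :
    Continuous fun t => (ouMotion A Ξ t).lin := by
  obtain ⟨N, hN⟩ := hΞ.exists_clm
  refine continuous_iff_continuousAt.mpr fun t => tendsto_clm_of_apply fun v => ?_
  simp only [ouMotion_lin_apply, ← hN]
  exact ((N.continuous.comp (continuous_ouKernel hA v)).tendsto t)

theorem exists_norm_ouMotion_le (hA : VolterraBound A M η 0) (hΞ : IsWhiteNoise ω C Ξ) :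
    ∃ c : ℝ, ∀ t, ‖(ouMotion A Ξ t).lin‖ ≤ c := by
  obtain ⟨N, hN⟩ := hΞ.exists_clm
  obtain ⟨c, hc, hcb⟩ := exists_norm_ouKernel_le hA
  refine ⟨‖N‖ * c, fun t => ContinuousLinearMap.opNorm_le_bound _ (by positivity) fun v => ?_⟩
  rw [ouMotion_lin_apply, ← hN, mul_assoc]
  exact (N.le_opNorm _).trans (mul_le_mul_of_nonneg_left (hcb t v) (norm_nonneg _))

/-- The image of `indicatorKernel_eq` under the bounded linear noise map. It expresses the forcing
of the equation through the Ornstein–Uhlenbeck process, the only part of the noise that is assumed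
independent of X. -/
theorem brownianMotion_eq (hA : VolterraBound A M η 0) (hΞ : IsWhiteNoise ω C Ξ) {t : ℝ}
    (ht : 0 ≤ t) (v : V) :
    brownianMotion Ξ t v = (ouMotion A Ξ t).lin v - (ouMotion A Ξ 0).lin v
      - ∫ s in (0 : ℝ)..t, (ouMotion A Ξ s).lin (A v) := by
  obtain ⟨N, hN⟩ := hΞ.exists_clm
  have h1 : brownianMotion Ξ t v = N (indicatorKernel t v) := (hN _).symm
  have hk := continuous_ouKernel hA (A v)
  rw [h1, indicatorKernel_eq hA ht, map_sub, map_sub,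
    ← N.intervalIntegral_comp_comm (hk.intervalIntegrable _ _)]
  simp only [hN, ouMotion_lin_apply]

/-- The sum of the kernels of a finite family of times. -/
def processKernel (A : V →L[ℝ] V) : (ℝ →₀ V) →ₗ[ℝ] L2 V :=
  Finsupp.lsum ℝ fun t : ℝ => ouKernel A t

/-- The index of the increment of the Ornstein-Uhlenbeck process. -/
def incrementIndex (A : V →L[ℝ] V) (t h : ℝ) (v : V) : ℝ →₀ V :=
  Finsupp.single (t + h) v - Finsupp.single t (NormedSpace.exp (h • A) v)

theorem processKernel_incrementIndex (A : V →L[ℝ] V) (t h : ℝ) (v : V) :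
    processKernel A (incrementIndex A t h v) = ouIncrement A t h v := by
  rw [processKernel, incrementIndex, map_sub, Finsupp.lsum_single, Finsupp.lsum_single,
    ouIncrement]

/-- The linear form of the covariance of the noise, on the index space. -/
def covForm (A C : V →L[ℝ] V) (f : ℝ →₀ V) : Module.Dual ℝ (V × (ℝ →₀ V)) :=
  (innerₛₗ ℝ (C.compLpL 2 (volume : Measure ℝ) (processKernel A f))) ∘ₗ processKernel A ∘ₗ
    LinearMap.snd ℝ V (ℝ →₀ V)

theorem covForm_apply (A C : V →L[ℝ] V) (f g : ℝ →₀ V) (v : V) :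
    covForm A C f (v, g) = inner ℝ (processKernel A g)
      (C.compLpL 2 (volume : Measure ℝ) (processKernel A f)) := by
  change inner ℝ _ (processKernel A g) = _
  exact real_inner_comm _ _

/-! ### The exterior algebra of a direct sum -/

section Product

variable {W W' : Type*} [AddCommGroup W] [Module ℝ W] [AddCommGroup W'] [Module ℝ W']

theorem ExteriorAlgebra.involute_involute (G : ExteriorAlgebra ℝ W) :
    ExteriorAlgebra.involute (ExteriorAlgebra.involute G) = G :=
  CliffordAlgebra.involute_involute (Q := (0 : QuadraticForm ℝ W)) G

theorem ExteriorAlgebra.ι_mul_eq (G : ExteriorAlgebra ℝ W) (w : W) :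
    ExteriorAlgebra.ι ℝ w * G = ExteriorAlgebra.involute G * ExteriorAlgebra.ι ℝ w := by
  rw [ExteriorAlgebra.mul_ι_eq, ExteriorAlgebra.involute_involute]

theorem ExteriorAlgebra.map_involute (f : W →ₗ[ℝ] W') (G : ExteriorAlgebra ℝ W) :
    ExteriorAlgebra.involute (ExteriorAlgebra.map f G)
      = ExteriorAlgebra.map f (ExteriorAlgebra.involute G) := by
  induction G using ExteriorAlgebra.right_induction with
  | algebraMap r => simp only [AlgHom.commutes]
  | add x y hx hy => simp only [map_add, hx, hy]
  | mul_ι x m hx => simp only [map_mul, ExteriorAlgebra.map_apply_ι, hx,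
      ExteriorAlgebra.involute_ι, map_neg]

/-- Products of elements of the two factors span the exterior algebra of a product. -/
theorem ExteriorAlgebra.prod_induction {p : ExteriorAlgebra ℝ (W × W') → Prop}
    (zero : p 0) (add : ∀ x y, p x → p y → p (x + y))
    (mul : ∀ (G : ExteriorAlgebra ℝ W) (H : ExteriorAlgebra ℝ W'),
      p (ExteriorAlgebra.map (LinearMap.inl ℝ W W') G *
        ExteriorAlgebra.map (LinearMap.inr ℝ W W') H)) (x : ExteriorAlgebra ℝ (W × W')) : p x := by
  let S : AddSubmonoid (ExteriorAlgebra ℝ (W × W')) := AddSubmonoid.closure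
    {x | ∃ (G : ExteriorAlgebra ℝ W) (H : ExteriorAlgebra ℝ W'),
      ExteriorAlgebra.map (LinearMap.inl ℝ W W') G *
        ExteriorAlgebra.map (LinearMap.inr ℝ W W') H = x}
  have hmem : ∀ G H, ExteriorAlgebra.map (LinearMap.inl ℝ W W') G *
      ExteriorAlgebra.map (LinearMap.inr ℝ W W') H ∈ S := fun G H =>
    AddSubmonoid.subset_closure ⟨G, H, rfl⟩
  have hall : ∀ x, x ∈ S := fun x => by
    induction x using ExteriorAlgebra.right_induction with
    | algebraMap r =>
      have := hmem (algebraMap ℝ _ r) 1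
      rwa [AlgHom.commutes, map_one, mul_one] at this
    | add x y hx hy => exact S.add_mem hx hy
    | mul_ι x m hx =>
      induction hx using AddSubmonoid.closure_induction with
      | mem y hy =>
        obtain ⟨G, H, rfl⟩ := hy
        have hm : ExteriorAlgebra.ι ℝ m = ExteriorAlgebra.map (LinearMap.inl ℝ W W')
            (ExteriorAlgebra.ι ℝ m.1) + ExteriorAlgebra.map (LinearMap.inr ℝ W W')
            (ExteriorAlgebra.ι ℝ m.2) := by
          rw [ExteriorAlgebra.map_apply_ι, ExteriorAlgebra.map_apply_ι, ← map_add]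
          simp
        rw [hm, mul_add]
        refine S.add_mem ?_ ?_
        · have := hmem (G * ExteriorAlgebra.ι ℝ m.1) (ExteriorAlgebra.involute H)
          rw [map_mul, ← ExteriorAlgebra.map_involute] at this
          rw [mul_assoc, ExteriorAlgebra.map_apply_ι, ExteriorAlgebra.mul_ι_eq, ← mul_assoc]
          rwa [ExteriorAlgebra.map_apply_ι] at this
        · have := hmem G (H * ExteriorAlgebra.ι ℝ m.2)
          rwa [map_mul, ← mul_assoc] at this
      | zero => rw [zero_mul]; exact S.zero_mem
      | add y z _ _ hy hz => rw [add_mul]; exact S.add_mem hy hz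
  induction hall x using AddSubmonoid.closure_induction with
  | mem y hy => obtain ⟨G, H, rfl⟩ := hy; exact mul G H
  | zero => exact zero
  | add y z _ _ hy hz => exact add _ _ hy hz

end Product

variable {X : GrassmannRV V 𝒜}

/-- `Z` extends both `X` and the Ornstein-Uhlenbeck process. -/
def IsJoint (A : V →L[ℝ] V) (Ξ : GrassmannRV (L2 V) 𝒜) (X : GrassmannRV V 𝒜)
    (Z : GrassmannRV (V × (ℝ →₀ V)) 𝒜) : Prop :=
  ∀ (v : V) (w : ℝ →₀ V), Z (ExteriorAlgebra.ι ℝ (v, w))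
    = X (ExteriorAlgebra.ι ℝ v) + ouProcess A Ξ (ExteriorAlgebra.ι ℝ w)

variable {Z : GrassmannRV (V × (ℝ →₀ V)) 𝒜}

theorem IsJoint.comp_inl (hZ : IsJoint A Ξ X Z) :
    Z.comp (ExteriorAlgebra.map (LinearMap.inl ℝ V (ℝ →₀ V))) = X := by
  ext v
  have := hZ v 0
  simpa using this

theorem IsJoint.comp_inr (hZ : IsJoint A Ξ X Z) :
    Z.comp (ExteriorAlgebra.map (LinearMap.inr ℝ V (ℝ →₀ V))) = ouProcess A Ξ := by
  refine ExteriorAlgebra.hom_ext (LinearMap.ext fun w => ?_)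
  have := hZ 0 w
  simpa using this

theorem IsJoint.apply_single (hZ : IsJoint A Ξ X Z) (t : ℝ) (v : V) :
    Z (ExteriorAlgebra.ι ℝ (0, Finsupp.single t v)) = (ouMotion A Ξ t).lin v := by
  rw [hZ, map_zero, map_zero, zero_add, ouProcess_single, GrassmannRV.lin_apply]

theorem IsJoint.apply_incrementIndex (hZ : IsJoint A Ξ X Z) (t h : ℝ) (v : V) :
    Z (ExteriorAlgebra.ι ℝ (0, incrementIndex A t h v))
      = (ouMotion A Ξ (t + h)).lin v - (ouMotion A Ξ t).lin (NormedSpace.exp (h • A) v) := by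
  have : ((0, incrementIndex A t h v) : V × (ℝ →₀ V)) = (0, Finsupp.single (t + h) v)
      - (0, Finsupp.single t (NormedSpace.exp (h • A) v)) := by
    rw [incrementIndex, Prod.mk_sub_mk, sub_zero]
  rw [this, map_sub, map_sub, hZ.apply_single, hZ.apply_single]

/-- On a product G(X) H(noise) the contraction does not see G, independence splits off ω(G(X)), and
the Gaussian formula acts on H. Such products span. -/
theorem IsWhiteNoise.integration_by_parts (hΞ : IsWhiteNoise ω C Ξ)
    (hi : Independent ω X (ouProcess A Ξ)) (hZ : IsJoint A Ξ X Z)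
    (G : ExteriorAlgebra ℝ (V × (ℝ →₀ V))) (f : ℝ →₀ V) :
    ω (Z G * Z (ExteriorAlgebra.ι ℝ (0, f)))
      = ω (Z (ExteriorAlgebra.contractRight G (covForm A C f))) := by
  induction G using ExteriorAlgebra.prod_induction with
  | zero => simp [ExteriorAlgebra.contractRight]
  | add x y hx hy =>
    have e : ExteriorAlgebra.contractRight (x + y) (covForm A C f)
        = ExteriorAlgebra.contractRight x (covForm A C f)
          + ExteriorAlgebra.contractRight y (covForm A C f) := by
      simp [ExteriorAlgebra.contractRight]
    rw [e, map_add, map_add, map_add, add_mul, map_add, hx, hy]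
  | mul G H =>
    have hX : ∀ G, Z (ExteriorAlgebra.map (LinearMap.inl ℝ V (ℝ →₀ V)) G) = X G := fun G =>
      DFunLike.congr_fun hZ.comp_inl G
    have hY : ∀ H, Z (ExteriorAlgebra.map (LinearMap.inr ℝ V (ℝ →₀ V)) H) = ouProcess A Ξ H :=
      fun H => DFunLike.congr_fun hZ.comp_inr H
    set d := covForm A C f with hd
    have h1 : ExteriorAlgebra.contractRight
        (ExteriorAlgebra.map (LinearMap.inl ℝ V (ℝ →₀ V)) G) d = 0 := by
      rw [ExteriorAlgebra.contractRight_map]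
      have : d ∘ₗ LinearMap.inl ℝ V (ℝ →₀ V) = 0 := by
        ext v; simp [hd, covForm]
      rw [this, ExteriorAlgebra.contractRight_zero, map_zero]
    have hYι : Z (ExteriorAlgebra.ι ℝ (0, f)) = ouProcess A Ξ (ExteriorAlgebra.ι ℝ f) := by
      rw [hZ, map_zero, map_zero, zero_add]
    have hYΞ : ∀ H, ouProcess A Ξ H = Ξ (ExteriorAlgebra.map (processKernel A) H) := fun H => rfl
    have hform : (innerₛₗ ℝ (C.compLpL 2 (volume : Measure ℝ) (processKernel A f)) :
        Module.Dual ℝ (L2 V)) ∘ₗ processKernel A = d ∘ₗ LinearMap.inr ℝ V (ℝ →₀ V) := by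
      ext v; simp [hd, covForm]
    rw [ExteriorAlgebra.contractRight_mul, h1, zero_mul, add_zero,
      ExteriorAlgebra.contractRight_map, map_mul Z, map_mul Z, hX, hY, hY, hYι, mul_assoc,
      ← map_mul (ouProcess A Ξ), hi.2, hi.2, map_mul (ouProcess A Ξ)]
    congr 1
    rw [hYΞ H, hYΞ (ExteriorAlgebra.ι ℝ f), ExteriorAlgebra.map_apply_ι, hΞ.2, hYΞ, ← hform,
      ← ExteriorAlgebra.contractRight_map]
    rfl

/-- The indices of the history up to time `t`. -/
def history (V : Type*) [NormedAddCommGroup V] [InnerProductSpace ℝ V] (t : ℝ) :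
    Submodule ℝ (V × (ℝ →₀ V)) :=
  (⊤ : Submodule ℝ V).prod (Finsupp.supported V ℝ (Iic t))

/-- The restriction of a Grassmann random variable to a subspace. -/
abbrev restrictRV {W : Type*} [AddCommGroup W] [Module ℝ W] (Z : GrassmannRV W 𝒜)
    (P : Submodule ℝ W) : GrassmannRV P 𝒜 := Z.comp (ExteriorAlgebra.map P.subtype)

theorem oddClosure_restrictRV_le {W : Type*} [AddCommGroup W] [Module ℝ W]
    (Z : GrassmannRV W 𝒜) (P : Submodule ℝ W) : oddClosure (restrictRV Z P) ≤ oddClosure Z :=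
  oddClosure_comp_map_le _ _

theorem apply_ι_mem_oddClosure_restrictRV {W : Type*} [AddCommGroup W] [Module ℝ W]
    (Z : GrassmannRV W 𝒜) {P : Submodule ℝ W} {w : W} (hw : w ∈ P) :
    Z (ExteriorAlgebra.ι ℝ w) ∈ oddClosure (restrictRV Z P) := by
  have := apply_ι_mem_oddClosure (restrictRV Z P) ⟨w, hw⟩
  simpa using this

theorem single_mem_history {s t : ℝ} (h : s ≤ t) (v : V) :
    ((0, Finsupp.single s v) : V × (ℝ →₀ V)) ∈ history V t :=
  ⟨trivial, Finsupp.single_mem_supported ℝ v h⟩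

theorem fst_mem_history (t : ℝ) (v : V) : ((v, 0) : V × (ℝ →₀ V)) ∈ history V t :=
  ⟨trivial, Submodule.zero_mem _⟩

/-- The form ignores the X-component, and the kernels of times up to t have support disjoint from
that of the increment. -/
theorem covForm_comp_history (hA : VolterraBound A M η 0) (t : ℝ) {h : ℝ} (hh : 0 ≤ h) (v : V) :
    covForm A C (incrementIndex A t h v) ∘ₗ (history V t).subtype = 0 := by
  refine LinearMap.ext fun ⟨⟨x, g⟩, hg⟩ => ?_
  change covForm A C (incrementIndex A t h v) (x, g) = 0
  rw [covForm_apply, processKernel_incrementIndex, processKernel, Finsupp.lsum_apply,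
    Finsupp.sum, sum_inner]
  refine Finset.sum_eq_zero fun s hs => ?_
  exact inner_ouKernel_ouIncrement hA C (hg.2 hs) hh _ _

/-- The algebra generated by the history up to time `t`. -/
abbrev historyAlg (Z : GrassmannRV (V × (ℝ →₀ V)) 𝒜) (t : ℝ) : Subalgebra ℝ 𝒜 :=
  algClosure (restrictRV Z (history V t))

theorem algClosure_induction₂ {W : Type*} [AddCommGroup W] [Module ℝ W] {Y : GrassmannRV W 𝒜}
    {p : 𝒜 → 𝒜 → Prop} (hp : IsClosed {x : 𝒜 × 𝒜 | p x.1 x.2}) (h : ∀ G H, p (Y G) (Y H)) {a b : 𝒜}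
    (ha : a ∈ algClosure Y) (hb : b ∈ algClosure Y) : p a b := by
  have hab : (a, b) ∈ closure ((Y.range : Set 𝒜) ×ˢ (Y.range : Set 𝒜)) := by
    rw [closure_prod_eq]; exact ⟨ha, hb⟩
  refine closure_minimal (t := {x : 𝒜 × 𝒜 | p x.1 x.2}) ?_ hp hab
  rintro ⟨_, _⟩ ⟨⟨G, rfl⟩, ⟨H, rfl⟩⟩
  exact h G H

/-- The increment is moved to the right of b, at the price of a grade involution, and integrated by
parts; contraction with the history is zero. -/
theorem expectation_increment (hA : VolterraBound A M η 0) (hΞ : IsWhiteNoise ω C Ξ)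
    (hi : Independent ω X (ouProcess A Ξ)) (hZ : IsJoint A Ξ X Z) (t : ℝ) {h : ℝ} (hh : 0 ≤ h)
    (v : V) {a b : 𝒜} (ha : a ∈ historyAlg Z t) (hb : b ∈ historyAlg Z t) :
    ω (a * Z (ExteriorAlgebra.ι ℝ (0, incrementIndex A t h v)) * b) = 0 := by
  refine algClosure_induction₂ (p := fun a b =>
    ω (a * Z (ExteriorAlgebra.ι ℝ (0, incrementIndex A t h v)) * b) = 0)
    (isClosed_eq (by fun_prop) continuous_const) (fun G H => ?_) ha hb
  set f := incrementIndex A t h v with hf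
  rw [AlgHom.comp_apply, AlgHom.comp_apply, mul_assoc, ← map_mul Z (ExteriorAlgebra.ι ℝ (0, f)),
    ExteriorAlgebra.ι_mul_eq, ExteriorAlgebra.map_involute, map_mul Z, ← mul_assoc, ← map_mul Z,
    ← map_mul (ExteriorAlgebra.map _), hΞ.integration_by_parts hi hZ, ExteriorAlgebra.contractRight_map,
    covForm_comp_history hA t hh, ExteriorAlgebra.contractRight_zero, map_zero, map_zero, map_zero]

/-- The product of two increments is even, so it passes b without sign; after integration by parts
only the contraction of the increments with each other survives. -/
theorem expectation_increment_mul (hA : VolterraBound A M η 0) (hΞ : IsWhiteNoise ω C Ξ)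
    (hi : Independent ω X (ouProcess A Ξ)) (hZ : IsJoint A Ξ X Z) (t : ℝ) {h : ℝ} (hh : 0 ≤ h)
    (v w : V) {a b : 𝒜} (ha : a ∈ historyAlg Z t) (hb : b ∈ historyAlg Z t) :
    ω (a * Z (ExteriorAlgebra.ι ℝ (0, incrementIndex A t h v))
      * Z (ExteriorAlgebra.ι ℝ (0, incrementIndex A t h w)) * b)
      = incrementCov A C v w h • ω (a * b) := by
  refine algClosure_induction₂ (p := fun a b =>
    ω (a * Z (ExteriorAlgebra.ι ℝ (0, incrementIndex A t h v))
      * Z (ExteriorAlgebra.ι ℝ (0, incrementIndex A t h w)) * b)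
      = incrementCov A C v w h • ω (a * b))
    (isClosed_eq (by fun_prop) (by fun_prop)) (fun G H => ?_) ha hb
  set f := incrementIndex A t h v with hf
  set g := incrementIndex A t h w with hg
  have hcomm : ExteriorAlgebra.ι ℝ ((0, f) : V × (ℝ →₀ V)) * ExteriorAlgebra.ι ℝ (0, g)
      * ExteriorAlgebra.map (history V t).subtype H
      = ExteriorAlgebra.map (history V t).subtype H * (ExteriorAlgebra.ι ℝ (0, f)
      * ExteriorAlgebra.ι ℝ (0, g)) :=
    ExteriorAlgebra.even_commute (CliffordAlgebra.ι_mul_ι_mem_evenOdd_zero _ _ _) _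
  have e : (restrictRV Z (history V t)) G * Z (ExteriorAlgebra.ι ℝ (0, f))
      * Z (ExteriorAlgebra.ι ℝ (0, g)) * (restrictRV Z (history V t)) H
      = Z (ExteriorAlgebra.map (history V t).subtype (G * H) * ExteriorAlgebra.ι ℝ (0, f))
        * Z (ExteriorAlgebra.ι ℝ (0, g)) := by
    have := congrArg (fun x => Z (ExteriorAlgebra.map (history V t).subtype G) * Z x) hcomm
    simpa only [restrictRV, AlgHom.comp_apply, map_mul, mul_assoc] using this
  rw [e, hΞ.integration_by_parts hi hZ, ExteriorAlgebra.contractRight_mul_ι,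
    ExteriorAlgebra.contractRight_map, covForm_comp_history hA t hh,
    ExteriorAlgebra.contractRight_zero, map_zero, zero_mul, sub_zero, covForm_apply,
    processKernel_incrementIndex, processKernel_incrementIndex, inner_ouIncrement hA C t hh,
    map_smul, map_mul, map_mul]
  exact ω.map_smul_of_tower _ _

end Noise

end

noncomputable section
set_option linter.unusedSectionVars false
open Filter Topology

/-! ### The generator and the tilted integration by parts formula -/

section Generator

variable {V : Type*} [NormedAddCommGroup V] [InnerProductSpace ℝ V]

/-- The right derivative as a linear map of the direction. -/
def rightDerivₗ (G : ExteriorAlgebra ℝ V) : V →ₗ[ℝ] ExteriorAlgebra ℝ V :=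
  (CliffordAlgebra.contractRight (Q := (0 : QuadraticForm ℝ V)) G) ∘ₗ innerₛₗ ℝ

theorem rightDerivₗ_apply (G : ExteriorAlgebra ℝ V) (w : V) : rightDerivₗ G w = rightDeriv G w :=
  rfl

theorem rightDeriv_add (G H : ExteriorAlgebra ℝ V) (w : V) :
    rightDeriv (G + H) w = rightDeriv G w + rightDeriv H w := by
  rw [rightDeriv, map_add]; rfl

theorem rightDeriv_sub (G H : ExteriorAlgebra ℝ V) (w : V) :
    rightDeriv (G - H) w = rightDeriv G w - rightDeriv H w := by
  rw [rightDeriv, map_sub]; rfl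

theorem rightDeriv_smul (r : ℝ) (G : ExteriorAlgebra ℝ V) (w : V) :
    rightDeriv (r • G) w = r • rightDeriv G w := by
  rw [rightDeriv, map_smul]; rfl

theorem rightDeriv_smul_right (r : ℝ) (G : ExteriorAlgebra ℝ V) (w : V) :
    rightDeriv G (r • w) = r • rightDeriv G w := (rightDerivₗ G).map_smul r w

theorem rightDeriv_algebraMap (r : ℝ) (w : V) :
    rightDeriv (algebraMap ℝ (ExteriorAlgebra ℝ V) r) w = 0 :=
  ExteriorAlgebra.contractRight_algebraMap _ _

theorem rightDeriv_mul (G H : ExteriorAlgebra ℝ V) (w : V) :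
    rightDeriv (G * H) w
      = G * rightDeriv H w + rightDeriv G w * ExteriorAlgebra.involute H :=
  ExteriorAlgebra.contractRight_mul _ _ _

theorem ExteriorAlgebra.involute_of_even {H : ExteriorAlgebra ℝ V}
    (hH : H ∈ ExteriorAlgebra.parity V 0) : ExteriorAlgebra.involute H = H :=
  CliffordAlgebra.involute_eq_of_mem_even hH

theorem ExteriorAlgebra.even_pow {H : ExteriorAlgebra ℝ V}
    (hH : H ∈ ExteriorAlgebra.parity V 0) (k : ℕ) : H ^ k ∈ ExteriorAlgebra.parity V 0 := by
  have := SetLike.pow_mem_graded k hH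
  rwa [smul_zero] at this

theorem rightDeriv_pow {H : ExteriorAlgebra ℝ V} (hH : H ∈ ExteriorAlgebra.parity V 0) (w : V)
    (k : ℕ) : rightDeriv (H ^ (k + 1)) w = ((k : ℝ) + 1) • (rightDeriv H w * H ^ k) := by
  induction k with
  | zero => simp
  | succ k ih =>
    rw [pow_succ, rightDeriv_mul, ExteriorAlgebra.involute_of_even hH, ih,
      ExteriorAlgebra.even_commute (ExteriorAlgebra.even_pow hH _), smul_mul_assoc, mul_assoc,
      ← pow_succ, Nat.cast_succ, add_smul ((k : ℝ) + 1) (1 : ℝ), one_smul, add_comm]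

variable [FiniteDimensional ℝ V]

theorem sum_inner_smul_map {E : Type*} [AddCommGroup E] [Module ℝ E] (T : V →ₗ[ℝ] E) (w : V) :
    ∑ i, inner ℝ w (stdOrthonormalBasis ℝ V i) • T (stdOrthonormalBasis ℝ V i) = T w := by
  conv_rhs => rw [← (stdOrthonormalBasis ℝ V).sum_repr' w, map_sum]
  refine Finset.sum_congr rfl fun i _ => ?_
  rw [map_smul, real_inner_comm]

/-- The generator of the dynamics with drift `β` and noise of correlation `C`. -/
def generator (C : V →L[ℝ] V) (β : V →ₗ[ℝ] ExteriorAlgebra ℝ V) (G : ExteriorAlgebra ℝ V) :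
    ExteriorAlgebra ℝ V :=
  ∑ i, ((1 / 2 : ℝ) • rightDeriv (rightDeriv G (stdOrthonormalBasis ℝ V i))
      (C (stdOrthonormalBasis ℝ V i))
    + rightDeriv G (stdOrthonormalBasis ℝ V i) * β (stdOrthonormalBasis ℝ V i))

variable {C : V →L[ℝ] V} {β : V →ₗ[ℝ] ExteriorAlgebra ℝ V}

theorem generator_add (G H : ExteriorAlgebra ℝ V) :
    generator C β (G + H) = generator C β G + generator C β H := by
  simp only [generator, ← Finset.sum_add_distrib, rightDeriv_add, smul_add, add_mul]
  exact Finset.sum_congr rfl fun i _ => by abel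

theorem generator_algebraMap (r : ℝ) :
    generator C β (algebraMap ℝ (ExteriorAlgebra ℝ V) r) = 0 := by
  refine Finset.sum_eq_zero fun i _ => ?_
  have h0 : rightDeriv (0 : ExteriorAlgebra ℝ V) (C (stdOrthonormalBasis ℝ V i)) = 0 := by
    simpa using rightDeriv_algebraMap (V := V) 0 (C (stdOrthonormalBasis ℝ V i))
  rw [rightDeriv_algebraMap, h0, smul_zero, zero_mul, add_zero]

/-- The product rule behind the induction in the Itô formula. Applying two right derivatives to Gw
leaves two cross terms with coefficient ½; antisymmetry of C makes them equal, and together they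
form the covariation term. -/
theorem generator_mul_ι (hC : ∀ v w : V, inner ℝ (C v) w = -inner ℝ v (C w))
    (hβ : ∀ v, β v ∈ ExteriorAlgebra.parity V 1) (G : ExteriorAlgebra ℝ V) (w : V) :
    generator C β (G * ExteriorAlgebra.ι ℝ w)
      = generator C β G * ExteriorAlgebra.ι ℝ w + G * β w + rightDeriv G (C w) := by
  have h1 : G * β w = ∑ i, inner ℝ w (stdOrthonormalBasis ℝ V i) •
      (G * β (stdOrthonormalBasis ℝ V i)) :=
    (sum_inner_smul_map (LinearMap.mulLeft ℝ G ∘ₗ β) w).symm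
  have h2 : rightDeriv G (C w) = ∑ i, inner ℝ w (stdOrthonormalBasis ℝ V i) •
      rightDeriv G (C (stdOrthonormalBasis ℝ V i)) :=
    (sum_inner_smul_map (rightDerivₗ G ∘ₗ (C : V →ₗ[ℝ] V)) w).symm
  have h3 : -rightDeriv G (C w) = ∑ i, inner ℝ w (C (stdOrthonormalBasis ℝ V i)) •
      rightDeriv G (stdOrthonormalBasis ℝ V i) := by
    have := sum_inner_smul_map (rightDerivₗ G) (C w)
    rw [← rightDerivₗ_apply, ← this, ← Finset.sum_neg_distrib]
    refine Finset.sum_congr rfl fun i _ => ?_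
    rw [hC, neg_smul, neg_neg]; rfl
  have h4 : rightDeriv G (C w) = (1 / 2 : ℝ) • rightDeriv G (C w)
      - (1 / 2 : ℝ) • -rightDeriv G (C w) := by
    rw [← smul_sub, sub_neg_eq_add, ← two_smul ℝ, smul_smul]; norm_num
  rw [h4, h3, h2, h1]
  simp only [generator, Finset.sum_mul, Finset.smul_sum, ← Finset.sum_sub_distrib,
    ← Finset.sum_add_distrib]
  refine Finset.sum_congr rfl fun i _ => ?_
  have h5 : ExteriorAlgebra.ι ℝ w * β (stdOrthonormalBasis ℝ V i)
      = -(β (stdOrthonormalBasis ℝ V i) * ExteriorAlgebra.ι ℝ w) :=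
    ExteriorAlgebra.odd_anticomm (CliffordAlgebra.ι_mem_evenOdd_one _ _) (hβ _)
  rw [rightDeriv_mul_ι, rightDeriv_sub, rightDeriv_smul, rightDeriv_mul_ι, sub_mul, mul_assoc _ _ (β _),
    h5, add_mul, smul_mul_assoc, smul_mul_assoc, mul_neg, mul_assoc]
  simp only [smul_sub]
  abel

end Generator

/-! ### Gaussian integration by parts with density, and the Gibbs functional -/

section Tilt

variable {V : Type*} [NormedAddCommGroup V] [InnerProductSpace ℝ V]
variable {𝒜 : Type*} [CStarAlgebra 𝒜] {ω : 𝒜 →L[ℂ] ℂ} {X : GrassmannRV V 𝒜}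

theorem ContinuousLinearMap.apply_real_smul (ω : 𝒜 →L[ℂ] ℂ) (r : ℝ) (a : 𝒜) : ω (r • a) = r • ω a :=
  ω.map_smul_of_tower r a

theorem hasSum_exp_real (a : 𝒜) :
    HasSum (fun k : ℕ => ((k.factorial : ℝ)⁻¹) • a ^ k) (NormedSpace.exp a) :=
  NormedSpace.exp_series_hasSum_exp' (𝕂 := ℝ) a

/-- Integration by parts with respect to a Gaussian variable with an exponential density. -/
theorem IsGrassmannGaussian.integration_by_parts_exp {D : V →L[ℝ] V}
    (hX : IsGrassmannGaussian ω D X) {W : ExteriorAlgebra ℝ V}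
    (hW : W ∈ ExteriorAlgebra.parity V 0) (H : ExteriorAlgebra ℝ V) (f : V) :
    ω (X (H * ExteriorAlgebra.ι ℝ f) * NormedSpace.exp (X W))
      = ω (X (rightDeriv H (D f)) * NormedSpace.exp (X W))
        + ω (X (H * rightDeriv W (D f)) * NormedSpace.exp (X W)) := by
  have hs : ∀ a : 𝒜, HasSum (fun k : ℕ => ω (a * (((k.factorial : ℝ)⁻¹) • X W ^ k)))
      (ω (a * NormedSpace.exp (X W))) := fun a =>
    ((hasSum_exp_real (X W)).mul_left a).mapL ω
  have h0 := hs (X (H * ExteriorAlgebra.ι ℝ f))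
  have h1 := hs (X (rightDeriv H (D f)))
  have h2 := hs (X (H * rightDeriv W (D f)))
  refine h0.unique ?_
  -- The derivative of W^{k+1}/(k+1)! is ∂W · W^k/k!, so this is the exponential series shifted by
  -- one; the k = 0 term vanishes.
  have h3 : HasSum (fun k : ℕ => ω (X (H * rightDeriv (W ^ k) (D f)) ) / (k.factorial : ℝ))
      (ω (X (H * rightDeriv W (D f)) * NormedSpace.exp (X W))) := by
    rw [← hasSum_nat_add_iff' 1]
    have e0 : ∑ i ∈ Finset.range 1, ω (X (H * rightDeriv (W ^ i) (D f))) / (i.factorial : ℝ)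
        = 0 := by
      simp [rightDeriv_one]
    rw [e0, sub_zero]
    refine h2.congr_fun fun k => ?_
    rw [rightDeriv_pow hW, mul_smul_comm, map_smul, ContinuousLinearMap.apply_real_smul, mul_smul_comm, ContinuousLinearMap.apply_real_smul,
      ← mul_assoc H, map_mul X (H * _), map_pow, Nat.factorial_succ, Complex.real_smul,
      Complex.real_smul]
    have hk : (k.factorial : ℂ) ≠ 0 := by exact_mod_cast k.factorial_ne_zero
    have hk1 : ((k : ℂ) + 1) ≠ 0 := by exact_mod_cast k.succ_ne_zero
    push_cast
    field_simp
  refine (h1.add h3).congr_fun fun k => ?_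
  have e : X (H * ExteriorAlgebra.ι ℝ f) * X W ^ k
      = X (H * W ^ k) * X (ExteriorAlgebra.ι ℝ f) := by
    rw [← map_pow, ← map_mul, ← map_mul, mul_assoc, mul_assoc,
      ExteriorAlgebra.even_commute (ExteriorAlgebra.even_pow hW k)]
  rw [mul_smul_comm, ContinuousLinearMap.apply_real_smul, e, hX.2, rightDeriv_mul,
    ExteriorAlgebra.involute_of_even (ExteriorAlgebra.even_pow hW k), map_add, map_add, smul_add,
    add_comm, mul_smul_comm, ContinuousLinearMap.apply_real_smul, ← map_pow, ← map_mul]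
  congr 1
  rw [Complex.real_smul, Complex.ofReal_inv]
  simp only [Complex.ofReal_natCast]
  rw [div_eq_inv_mul]

variable [FiniteDimensional ℝ V] [CompleteSpace V]

/-- The Langevin drift `ι(A v) + lam F(v)`. -/
def totalDrift (A : V →L[ℝ] V) (F : V →ₗ[ℝ] ExteriorAlgebra ℝ V) (lam : ℝ) :
    V →ₗ[ℝ] ExteriorAlgebra ℝ V := ExteriorAlgebra.ι ℝ ∘ₗ (A : V →ₗ[ℝ] V) + lam • F

theorem totalDrift_mem {A : V →L[ℝ] V} {F : V →ₗ[ℝ] ExteriorAlgebra ℝ V} (lam : ℝ)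
    (hF : ∀ v, F v ∈ ExteriorAlgebra.parity V 1) (v : V) :
    totalDrift A F lam v ∈ ExteriorAlgebra.parity V 1 :=
  Submodule.add_mem _ (CliffordAlgebra.ι_mem_evenOdd_one _ _) (Submodule.smul_mem _ _ (hF v))

/-- The Gibbs functional is annihilated by the generator of the Langevin dynamics. -/
theorem IsGrassmannGaussian.generator_eq_zero {D A C : V →L[ℝ] V}
    (hX : IsGrassmannGaussian ω D X) {U : ExteriorAlgebra ℝ V}
    (hU : U ∈ ExteriorAlgebra.parity V 0) (hD : ∀ v, D (A v) = -((1 / 2 : ℝ) • C v)) (lam : ℝ)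
    (G : ExteriorAlgebra ℝ V) :
    ω (X (generator C (totalDrift A (langevinDrift C U) lam) G)
      * NormedSpace.exp (-(lam • X U))) = 0 := by
  have e : -(lam • X U) = X (-(lam • U)) := by rw [map_neg, map_smul]
  have hW : -(lam • U) ∈ ExteriorAlgebra.parity V 0 :=
    Submodule.neg_mem _ (Submodule.smul_mem _ _ hU)
  rw [e, generator, map_sum, Finset.sum_mul, map_sum]
  refine Finset.sum_eq_zero fun i _ => ?_
  set v := stdOrthonormalBasis ℝ V i
  -- With D A = -C/2 the contraction of the first factor is minus the diffusion term, and the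
  -- contraction of the density is minus the contribution of the nonlinear drift. The cancellation
  -- holds for each basis vector separately.
  have h := hX.integration_by_parts_exp hW (rightDeriv G v) (A v)
  have e1 : rightDeriv (-(lam • U)) (D (A v)) = (1 / 2 : ℝ) • lam • rightDeriv U (C v) := by
    rw [hD, ← neg_smul, ← neg_smul, rightDeriv_smul_right, rightDeriv_smul, neg_smul, neg_smul,
      smul_neg, neg_neg]
  have e2 : rightDeriv (rightDeriv G v) (D (A v))
      = -((1 / 2 : ℝ) • rightDeriv (rightDeriv G v) (C v)) := by
    rw [hD, ← neg_smul, rightDeriv_smul_right, neg_smul]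
  have e3 : totalDrift A (langevinDrift C U) lam v
      = ExteriorAlgebra.ι ℝ (A v) - (1 / 2 : ℝ) • lam • rightDeriv U (C v) := by
    change ExteriorAlgebra.ι ℝ (A v) + lam • -((1 / 2 : ℝ) • rightDeriv U (C v)) = _
    rw [smul_neg, ← sub_eq_add_neg, smul_comm]
  rw [e1, e2] at h
  rw [e3, mul_sub, map_add, map_sub, add_mul, sub_mul, map_add, map_sub, h,
    map_neg X ((1 / 2 : ℝ) • rightDeriv (rightDeriv G v) (C v)), neg_mul, map_neg ω]
  ring

end Tilt

end

noncomputable section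
set_option linter.unusedSectionVars false
open Filter Topology

/-! ### The Itô formula -/

section Ito

open Asymptotics

variable {V : Type*} [NormedAddCommGroup V] [InnerProductSpace ℝ V] [FiniteDimensional ℝ V]
variable {𝒜 : Type*} [CStarAlgebra 𝒜]

/-- `ξ` is an infinitesimal Gaussian increment of correlation `C`, independent of `S`. -/
structure IsInfinitesimalIncrement (ω : 𝒜 →L[ℂ] ℂ) (C : V →L[ℝ] V) (S : Subalgebra ℝ 𝒜)
    (l : Filter ℝ) (ξ : ℝ → V → 𝒜) : Prop where
  tendsto : ∀ v, Tendsto (fun h => ξ h v) l (𝓝 0)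
  mul_isBigO : ∀ v w, (fun h => ξ h v * ξ h w) =O[l] (fun h : ℝ => h)
  expectation : ∀ v, ∀ᶠ h in l, ∀ a ∈ S, ∀ b ∈ S, ω (a * ξ h v * b) = 0
  expectation_mul : ∀ v w, ∃ k : ℝ → ℝ, (fun h => k h - h * inner ℝ v (C w)) =o[l] (fun h => h) ∧
    ∀ᶠ h in l, ∀ a ∈ S, ∀ b ∈ S, ω (a * ξ h v * ξ h w * b) = k h • ω (a * b)

theorem isLittleO_mul_of_isBigO_one {l : Filter ℝ} {f g : ℝ → 𝒜}
    (hf : f =o[l] (fun h : ℝ => h)) (hg : g =O[l] (fun _ => (1 : ℝ))) :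
    (fun h => f h * g h) =o[l] (fun h : ℝ => h) := by
  simpa using hf.mul_isBigO hg

theorem isLittleO_of_isBigO_one_mul {l : Filter ℝ} {f g : ℝ → 𝒜}
    (hg : g =O[l] (fun _ => (1 : ℝ))) (hf : f =o[l] (fun h : ℝ => h)) :
    (fun h => g h * f h) =o[l] (fun h : ℝ => h) := by
  simpa using hg.mul_isLittleO hf

theorem isLittleO_smul_of_tendsto_zero {l : Filter ℝ} {f : ℝ → 𝒜} (hf : Tendsto f l (𝓝 0)) :
    (fun h : ℝ => h • f h) =o[l] (fun h : ℝ => h) := by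
  have := (isBigO_refl (fun h : ℝ => h) l).smul_isLittleO
    ((isLittleO_one_iff ℝ).mpr hf)
  simpa using this

theorem isLittleO_apply {l : Filter ℝ} {f : ℝ → 𝒜} (ω : 𝒜 →L[ℂ] ℂ)
    (hf : f =o[l] (fun h : ℝ => h)) : (fun h => ω (f h)) =o[l] (fun h : ℝ => h) :=
  (ω.isBigO_comp f l).trans_isLittleO hf

variable {ω : 𝒜 →L[ℂ] ℂ} {C : V →L[ℝ] V} {S : Subalgebra ℝ 𝒜} {l : Filter ℝ} {ξ : ℝ → V → 𝒜}
  {β : V →ₗ[ℝ] ExteriorAlgebra ℝ V} {p : V →L[ℝ] 𝒜} {q : ℝ → V →L[ℝ] 𝒜}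

/-- The new increment correlates only with the copy of itself inside `q h`, which to first order
yields h times the covariation. The right factor `c` is arbitrary in S because the induction moves
the factor p(u) across ξ into it. -/
theorem IsInfinitesimalIncrement.expectation_eval_mul (hξ : IsInfinitesimalIncrement ω C S l ξ)
    (hp : IsNull p) (hpS : ∀ v, p v ∈ S) (hqn : ∀ᶠ h in l, IsNull (q h)) (hq : Tendsto q l (𝓝 p))
    (hcomm : ∀ v w, ∀ᶠ h in l, p v * ξ h w = -(ξ h w * p v))
    (hexp : ∀ v, (fun h => q h v - p v - h • evalRV p (β v) - ξ h v) =o[l] (fun h : ℝ => h))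
    (G : ExteriorAlgebra ℝ V) (w : V) {c : 𝒜} (hc : c ∈ S) :
    (fun h : ℝ => ω (evalRV (q h) G * ξ h w * c)
      - h • ω (evalRV p (rightDeriv G (C w)) * c)) =o[l] (fun h : ℝ => h) := by
  induction G using ExteriorAlgebra.right_induction generalizing c with
  | algebraMap r =>
    refine (isLittleO_zero (E' := ℂ) _ l).congr' ?_ EventuallyEq.rfl
    filter_upwards [hξ.expectation w] with h hh
    rw [AlgHom.commutes, rightDeriv_algebraMap, hh _ (S.algebraMap_mem r) c hc]
    simp
  | add x y hx hy =>
    refine ((hx hc).add (hy hc)).congr' (Eventually.of_forall fun h => ?_) EventuallyEq.rfl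
    simp only [map_add, add_mul, rightDeriv_add, smul_add]
    ring
  | mul_ι G u ih =>
    obtain ⟨k, hk, hkω⟩ := hξ.expectation_mul u w
    have hE : Tendsto (fun h => evalRV (q h) G) l (𝓝 (evalRV p G)) := tendsto_evalRV hq hqn hp G
    have hE1 := hE.isBigO_one ℝ
    have hE0 : Tendsto (fun h => evalRV (q h) G - evalRV p G) l (𝓝 0) := by
      simpa using hE.sub_const (evalRV p G)
    have hξ1 : (fun h => ξ h w * c) =O[l] (fun _ => (1 : ℝ)) :=
      ((hξ.tendsto w).mul_const c).isBigO_one ℝ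
    have s1 : (fun h => (evalRV (q h) G - evalRV p G) * (ξ h u * ξ h w) * c) =o[l]
        (fun h : ℝ => h) := by
      refine isLittleO_mul_of_isBigO_one ?_ (isBigO_const_one ℝ c l)
      simpa using ((isLittleO_one_iff ℝ).mpr hE0).mul_isBigO (hξ.mul_isBigO u w)
    have s2 : (fun h : ℝ => h • (evalRV (q h) G * evalRV p (β u) * (ξ h w * c))) =o[l]
        (fun h : ℝ => h) := by
      refine isLittleO_smul_of_tendsto_zero ?_
      simpa using (hE.mul_const (evalRV p (β u))).mul ((hξ.tendsto w).mul_const c)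
    have s3 : (fun h => evalRV (q h) G * ((q h u - p u - h • evalRV p (β u) - ξ h u)
        * (ξ h w * c))) =o[l] (fun h : ℝ => h) :=
      isLittleO_of_isBigO_one_mul hE1 (isLittleO_mul_of_isBigO_one (hexp u) hξ1)
    have s4 : (fun h => (k h - h * inner ℝ u (C w)) • ω (evalRV p G * c)) =o[l]
        (fun h : ℝ => h) := by
      have := hk.smul_isBigO (isBigO_const_one ℝ (ω (evalRV p G * c)) l)
      simpa using this
    have s5 := ih (S.mul_mem (hpS u) hc)
    refine ((((isLittleO_apply ω s1).add (isLittleO_apply ω s2)).add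
      (isLittleO_apply ω s3)).add (s4.sub s5)).congr' ?_ EventuallyEq.rfl
    filter_upwards [hkω, hqn, hcomm u w] with h h1 h2 h3
    have h1' := h1 (evalRV p G) (evalRV_mem_subalgebra hp hpS G) c hc
    -- Substitute q(u) = p(u) + hβ(u) + ξ(u) + o(h). The first three terms are o(1)·O(h), h·o(1) and
    -- o(h); the fourth carries the covariation `k h`, and the last is handled by the induction
    -- hypothesis after anticommuting.
    have e : evalRV (q h) (G * ExteriorAlgebra.ι ℝ u) * ξ h w * c
        = (evalRV (q h) G - evalRV p G) * (ξ h u * ξ h w) * c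
          + h • (evalRV (q h) G * evalRV p (β u) * (ξ h w * c))
          + evalRV (q h) G * ((q h u - p u - h • evalRV p (β u) - ξ h u) * (ξ h w * c))
          + evalRV p G * ξ h u * ξ h w * c - evalRV (q h) G * ξ h w * (p u * c) := by
      have h3' : evalRV (q h) G * ξ h w * (p u * c) = -(evalRV (q h) G * (p u * (ξ h w * c))) := by
        rw [← mul_assoc (p u), h3]; noncomm_ring
      rw [h3', map_mul, evalRV_ι h2]
      simp only [sub_mul, mul_sub, mul_assoc, smul_mul_assoc, mul_smul_comm]
      abel
    have e2 : evalRV p (rightDeriv (G * ExteriorAlgebra.ι ℝ u) (C w)) * c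
        = (inner ℝ u (C w) : ℝ) • (evalRV p G * c)
          - evalRV p (rightDeriv G (C w)) * (p u * c) := by
      rw [rightDeriv_mul_ι, map_sub, map_smul, map_mul, evalRV_ι hp, sub_mul, smul_mul_assoc,
        mul_assoc]
    rw [e, e2]
    simp only [map_add, map_sub, ContinuousLinearMap.apply_real_smul, h1', Complex.real_smul]
    push_cast
    ring

/-- The infinitesimal Itô formula. -/
theorem IsInfinitesimalIncrement.ito (hξ : IsInfinitesimalIncrement ω C S l ξ)
    (hC : ∀ v w : V, inner ℝ (C v) w = -inner ℝ v (C w))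
    (hβ : ∀ v, β v ∈ ExteriorAlgebra.parity V 1)
    (hp : IsNull p) (hpS : ∀ v, p v ∈ S) (hqn : ∀ᶠ h in l, IsNull (q h)) (hq : Tendsto q l (𝓝 p))
    (hcomm : ∀ v w, ∀ᶠ h in l, p v * ξ h w = -(ξ h w * p v))
    (hexp : ∀ v, (fun h => q h v - p v - h • evalRV p (β v) - ξ h v) =o[l] (fun h : ℝ => h))
    (G : ExteriorAlgebra ℝ V) {c : 𝒜} (hc : c ∈ S) :
    (fun h : ℝ => ω (evalRV (q h) G * c) - ω (evalRV p G * c)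
      - h • ω (evalRV p (generator C β G) * c)) =o[l] (fun h : ℝ => h) := by
  induction G using ExteriorAlgebra.right_induction generalizing c with
  | algebraMap r =>
    refine (isLittleO_zero (E' := ℂ) _ l).congr' (Eventually.of_forall fun h => ?_) EventuallyEq.rfl
    simp only [AlgHom.commutes, generator_algebraMap, map_zero, zero_mul, smul_zero, sub_self]
  | add x y hx hy =>
    refine ((hx hc).add (hy hc)).congr' (Eventually.of_forall fun h => ?_) EventuallyEq.rfl
    simp only [map_add, add_mul, generator_add, smul_add]
    ring
  | mul_ι G u ih =>
    have hE : Tendsto (fun h => evalRV (q h) G) l (𝓝 (evalRV p G)) := tendsto_evalRV hq hqn hp G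
    have hE1 := hE.isBigO_one ℝ
    have hE0 : Tendsto (fun h => evalRV (q h) G - evalRV p G) l (𝓝 0) := by
      simpa using hE.sub_const (evalRV p G)
    -- The term with the increment ξ(u) does not vanish to first order: it supplies the cross term
    -- ∂_{Cu}G of the generator's product rule.
    have s1 := hξ.expectation_eval_mul hp hpS hqn hq hcomm hexp G u hc
    have s2 : (fun h : ℝ => h • ((evalRV (q h) G - evalRV p G) * (evalRV p (β u) * c))) =o[l]
        (fun h : ℝ => h) := by
      refine isLittleO_smul_of_tendsto_zero ?_
      simpa using hE0.mul_const (evalRV p (β u) * c)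
    have s3 : (fun h => evalRV (q h) G * ((q h u - p u - h • evalRV p (β u) - ξ h u) * c)) =o[l]
        (fun h : ℝ => h) :=
      isLittleO_of_isBigO_one_mul hE1
        (isLittleO_mul_of_isBigO_one (hexp u) (isBigO_const_one ℝ c l))
    have s5 := ih (S.mul_mem (hpS u) hc)
    refine ((s1.add (isLittleO_apply ω s2)).add ((isLittleO_apply ω s3).add s5)).congr' ?_
      EventuallyEq.rfl
    filter_upwards [hqn] with h h2
    have e : evalRV (q h) (G * ExteriorAlgebra.ι ℝ u) * c
        = evalRV (q h) G * ξ h u * c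
          + h • ((evalRV (q h) G - evalRV p G) * (evalRV p (β u) * c))
          + h • (evalRV p G * (evalRV p (β u) * c))
          + evalRV (q h) G * ((q h u - p u - h • evalRV p (β u) - ξ h u) * c)
          + evalRV (q h) G * (p u * c) := by
      rw [map_mul, evalRV_ι h2]
      simp only [sub_mul, mul_sub, mul_assoc, smul_mul_assoc, mul_smul_comm, smul_sub]
      abel
    have e2 : evalRV p (generator C β (G * ExteriorAlgebra.ι ℝ u)) * c
        = evalRV p (generator C β G) * (p u * c) + evalRV p G * (evalRV p (β u) * c)
          + evalRV p (rightDeriv G (C u)) * c := by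
      rw [generator_mul_ι hC hβ, map_add, map_add, map_mul, map_mul, evalRV_ι hp, add_mul,
        add_mul, mul_assoc, mul_assoc]
    have e3 : evalRV p (G * ExteriorAlgebra.ι ℝ u) * c = evalRV p G * (p u * c) := by
      rw [map_mul, evalRV_ι hp, mul_assoc]
    rw [e, e2, e3]
    simp only [map_add, ContinuousLinearMap.apply_real_smul, Complex.real_smul]
    ring

end Ito

end

noncomputable section
set_option linter.unusedSectionVars false
open Filter Topology

/-! ### Invariance of the Gibbs functional -/

section LinearODE

/-- Grönwall for the vector of values of Φ on a basis. Only the values of `T` on that basis enter,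
so `T` need not be known to be linear. -/
theorem eq_zero_of_linear_ode {E : Type*} [AddCommGroup E] [Module ℝ E] [FiniteDimensional ℝ E]
    (T : E → E) (Φ : ℝ → E →ₗ[ℝ] ℂ) {a b : ℝ} (hc : ∀ x, ContinuousOn (fun t => Φ t x) (Icc a b))
    (hd : ∀ t ∈ Ico a b, ∀ x, HasDerivWithinAt (fun t => Φ t x) (Φ t (T x)) (Ici t) t)
    (h0 : Φ a = 0) {t : ℝ} (ht : t ∈ Icc a b) : Φ t = 0 := by
  set e := Module.finBasis ℝ E with he
  set m : Fin (Module.finrank ℝ E) → Fin (Module.finrank ℝ E) → ℝ := fun i j =>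
    e.repr (T (e i)) j
  have hT : ∀ t i, Φ t (T (e i)) = ∑ j, m i j • Φ t (e j) := fun t i => by
    conv_lhs => rw [← e.sum_repr (T (e i)), map_sum]
    simp only [map_smul, m]
  have key := norm_le_gronwallBound_of_norm_deriv_right_le (f := fun t i => Φ t (e i))
    (f' := fun t i => Φ t (T (e i))) (δ := 0) (K := ∑ i, ∑ j, |m i j|) (ε := 0) (a := a) (b := b)
    (continuousOn_pi.mpr fun i => hc _) (fun r hr => hasDerivWithinAt_pi.mpr fun i => hd r hr _)
    (by simp [h0, Pi.zero_def]) (fun r hr => ?_) t ht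
  · rw [gronwallBound_ε0_δ0] at key
    have h := norm_le_zero_iff.mp key
    exact e.ext fun i => congrFun h i
  · rw [add_zero]
    refine (pi_norm_le_iff_of_nonneg (by positivity)).mpr fun i => ?_
    change ‖Φ r (T (e i))‖ ≤ _
    rw [hT]
    calc ‖∑ j, m i j • Φ r (e j)‖ ≤ ∑ j, |m i j| * ‖fun i => Φ r (e i)‖ := by
          refine norm_sum_le_of_le _ fun j _ => ?_
          rw [norm_smul, Real.norm_eq_abs]
          exact mul_le_mul_of_nonneg_left (norm_le_pi_norm (fun i => Φ r (e i)) j) (abs_nonneg _)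
      _ = (∑ j, |m i j|) * ‖fun i => Φ r (e i)‖ := (Finset.sum_mul _ _ _).symm
      _ ≤ _ := by
          refine mul_le_mul_of_nonneg_right ?_ (norm_nonneg _)
          exact Finset.single_le_sum (f := fun i => ∑ j, |m i j|)
            (fun i _ => Finset.sum_nonneg fun j _ => abs_nonneg _) (Finset.mem_univ i)

end LinearODE

section Invariance

open Asymptotics

variable {V : Type*} [NormedAddCommGroup V] [InnerProductSpace ℝ V] [FiniteDimensional ℝ V]
  [CompleteSpace V]
variable {𝒜 : Type*} [CStarAlgebra 𝒜] {ω : 𝒜 →L[ℂ] ℂ} {A C : V →L[ℝ] V} {M η : ℝ}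
variable {Ξ : GrassmannRV (L2 V) 𝒜} {X : GrassmannRV V 𝒜} {Z : GrassmannRV (V × (ℝ →₀ V)) 𝒜}
variable {F : V →ₗ[ℝ] ExteriorAlgebra ℝ V} {lam a b : ℝ}

/-- The forcing of the equation started from `X` at time `a`, in terms of the Ornstein-Uhlenbeck
motion. -/
def ouForcing (A : V →L[ℝ] V) (Ξ : GrassmannRV (L2 V) 𝒜) (X : GrassmannRV V 𝒜) (a t : ℝ) :
    V →L[ℝ] 𝒜 :=
  X.lin - (ouMotion A Ξ a).lin + (ouMotion A Ξ t).lin - ∫ s in a..t, (ouMotion A Ξ s).lin ∘L A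

theorem ouForcing_self (A : V →L[ℝ] V) (Ξ : GrassmannRV (L2 V) 𝒜) (X : GrassmannRV V 𝒜) (a : ℝ) :
    ouForcing A Ξ X a a = X.lin := by
  simp [ouForcing]

theorem continuous_ouMotion_comp (hA : VolterraBound A M η 0) (hΞ : IsWhiteNoise ω C Ξ) :
    Continuous fun s => (ouMotion A Ξ s).lin ∘L A :=
  (continuous_ouMotion hA hΞ).clm_comp continuous_const

theorem continuous_ouForcing (hA : VolterraBound A M η 0) (hΞ : IsWhiteNoise ω C Ξ)
    (X : GrassmannRV V 𝒜) (a : ℝ) : Continuous (ouForcing A Ξ X a) := by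
  have h := continuous_ouMotion_comp hA hΞ
  exact (continuous_const.add (continuous_ouMotion hA hΞ)).sub
    (intervalIntegral.continuous_primitive (fun _ _ => h.intervalIntegrable _ _) a)

theorem ouForcing_mem (hA : VolterraBound A M η 0) (hΞ : IsWhiteNoise ω C Ξ)
    {O : Submodule ℝ 𝒜} (hO : IsClosed (O : Set 𝒜)) (hX : ∀ v, X.lin v ∈ O) {t : ℝ} (hat : a ≤ t)
    (hB : ∀ s ∈ Icc a t, ∀ v, (ouMotion A Ξ s).lin v ∈ O) (v : V) :
    ouForcing A Ξ X a t v ∈ O := by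
  have h := continuous_ouMotion_comp hA hΞ
  refine O.sub_mem (O.add_mem (O.sub_mem (hX v) (hB a ⟨le_rfl, hat⟩ v)) (hB t ⟨hat, le_rfl⟩ v)) ?_
  rw [intervalIntegral.integral_of_le hat]
  exact integral_clm_mem hO measurableSet_Ioc (h.integrableOn_Ioc)
    (fun s hs v => hB s ⟨hs.1.le, hs.2⟩ _) v

theorem IsJoint.lin_apply (hZ : IsJoint A Ξ X Z) (v : V) :
    Z (ExteriorAlgebra.ι ℝ (v, 0)) = X.lin v := by
  rw [hZ, map_zero, map_zero, add_zero, GrassmannRV.lin_apply]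

theorem IsJoint.lin_mem (hZ : IsJoint A Ξ X Z) (t : ℝ) (v : V) :
    X.lin v ∈ oddClosure (restrictRV Z (history V t)) :=
  hZ.lin_apply v ▸ apply_ι_mem_oddClosure_restrictRV Z (fst_mem_history t v)

theorem IsJoint.ouMotion_mem (hZ : IsJoint A Ξ X Z) {s t : ℝ} (hst : s ≤ t) (v : V) :
    (ouMotion A Ξ s).lin v ∈ oddClosure (restrictRV Z (history V t)) :=
  hZ.apply_single s v ▸ apply_ι_mem_oddClosure_restrictRV Z (single_mem_history hst v)

/-- Solutions are adapted. -/
theorem IsIntegralSolution.adapted (hA : VolterraBound A M η 0) (hΞ : IsWhiteNoise ω C Ξ)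
    (hZ : IsJoint A Ξ X Z) (hF : ∀ v, F v ∈ ExteriorAlgebra.parity V 1) {Ψ : ℝ → V →L[ℝ] 𝒜}
    (hΨ : IsIntegralSolution A F lam (ouForcing A Ξ X a) a b Ψ) {t : ℝ} (ht : t ∈ Icc a b) (v : V) :
    Ψ t v ∈ oddClosure (restrictRV Z (history V t)) := by
  have hO := isOddSubspace_oddClosure (restrictRV Z (history V t))
  have hclamp : ∀ r, a ≤ max a (min r t) ∧ max a (min r t) ≤ t := fun r =>
    ⟨le_max_left _ _, max_le ht.1 (min_le_right _ _)⟩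
  -- Freezing the forcing outside [a, t] keeps it in the odd part of the history at all times. The
  -- existence theorem then produces a solution inside the history, and uniqueness identifies it
  -- with Ψ up to time t.
  obtain ⟨Φ, hΦ, hΦm⟩ := HasSolutionIn.exists_isIntegralSolution hO
    (exists_hasSolutionIn (A := A) (F := F) (lam := lam) (a := a) (b := t)
      (y := fun r => ouForcing A Ξ X a (max a (min r t))) hO ht.1 hF
      ((continuous_ouForcing hA hΞ X a).comp (by fun_prop))
      (fun r => ouForcing_mem hA hΞ hO.isClosed (hZ.lin_mem t) (hclamp r).1
        fun s hs v => hZ.ouMotion_mem (hs.2.trans (hclamp r).2) v))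
  have hΦ' : IsIntegralSolution A F lam (ouForcing A Ξ X a) a t Φ := by
    refine ⟨hΦ.1, hΦ.2, fun r hr => ?_⟩
    have := hΦ.3 r hr
    rwa [min_eq_left hr.2, max_eq_right hr.1] at this
  rw [(hΨ.mono ht.2).unique hΦ' t ⟨ht.1, le_rfl⟩]
  exact hΦm t v

theorem IsJoint.exists_norm_increment_le (hA : VolterraBound A M η 0) (hΞ : IsWhiteNoise ω C Ξ)
    (hZ : IsJoint A Ξ X Z) (t : ℝ) (v : V) : ∃ c : ℝ, 0 ≤ c ∧ ∀ h : ℝ, 0 ≤ h →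
      ‖Z (ExteriorAlgebra.ι ℝ (0, incrementIndex A t h v))‖ ≤ c * √h := by
  obtain ⟨N, hN⟩ := hΞ.exists_clm
  have hM := hA.nonneg
  refine ⟨‖N‖ * (M * ‖v‖), by positivity, fun h hh => ?_⟩
  have e : Z (ExteriorAlgebra.ι ℝ (0, incrementIndex A t h v)) = N (ouIncrement A t h v) := by
    rw [hZ, map_zero, map_zero, zero_add, hN, ← processKernel_incrementIndex, ouProcess,
      AlgHom.comp_apply, ExteriorAlgebra.map_apply_ι]
    rfl
  rw [e, mul_assoc]
  exact (N.le_opNorm _).trans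
    (mul_le_mul_of_nonneg_left (norm_ouIncrement_le hA t hh v) (norm_nonneg _))

theorem IsJoint.isInfinitesimalIncrement (hA : VolterraBound A M η 0) (hΞ : IsWhiteNoise ω C Ξ)
    (hi : Independent ω X (ouProcess A Ξ)) (hZ : IsJoint A Ξ X Z) (t : ℝ) :
    IsInfinitesimalIncrement ω C (historyAlg Z t) (𝓝[>] 0)
      (fun h v => Z (ExteriorAlgebra.ι ℝ (0, incrementIndex A t h v))) where
  tendsto v := by
    obtain ⟨c, -, hc⟩ := hZ.exists_norm_increment_le hA hΞ t v
    refine squeeze_zero_norm' (a := fun h => c * √h) ?_ ?_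
    · filter_upwards [self_mem_nhdsWithin] with h hh using hc h (le_of_lt hh)
    · have : Tendsto (fun h : ℝ => c * √h) (𝓝 0) (𝓝 (c * √0)) :=
        (Continuous.tendsto (by fun_prop) 0)
      rw [Real.sqrt_zero, mul_zero] at this
      exact this.mono_left nhdsWithin_le_nhds
  mul_isBigO v w := by
    obtain ⟨c, hc0, hc⟩ := hZ.exists_norm_increment_le hA hΞ t v
    obtain ⟨d, hd0, hd⟩ := hZ.exists_norm_increment_le hA hΞ t w
    refine IsBigO.of_bound (c * d) ?_
    filter_upwards [self_mem_nhdsWithin] with h hh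
    have hh' : 0 ≤ h := le_of_lt hh
    refine (norm_mul_le _ _).trans ((mul_le_mul (hc h hh') (hd h hh') (norm_nonneg _)
      (by positivity)).trans (le_of_eq ?_))
    rw [Real.norm_of_nonneg hh', mul_mul_mul_comm, Real.mul_self_sqrt hh']
  expectation v := by
    filter_upwards [self_mem_nhdsWithin] with h hh a ha b hb
    exact expectation_increment hA hΞ hi hZ t (le_of_lt hh) v ha hb
  expectation_mul v w := by
    refine ⟨incrementCov A C v w, ?_, ?_⟩
    · have := hasDerivAt_iff_isLittleO_nhds_zero.mp (hasDerivAt_incrementCov A C v w)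
      simp only [zero_add, incrementCov_zero, sub_zero, smul_eq_mul] at this
      exact this.mono nhdsWithin_le_nhds
    · filter_upwards [self_mem_nhdsWithin] with h hh a ha b hb
      exact expectation_increment_mul hA hΞ hi hZ t (le_of_lt hh) v w ha hb

theorem hasDerivWithinAt_Ici_of_isLittleO {E : Type*} [NormedAddCommGroup E] [NormedSpace ℝ E]
    {f : ℝ → E} {f' : E} {t : ℝ}
    (h : (fun h : ℝ => f (t + h) - f t - h • f') =o[𝓝[>] 0] (fun h : ℝ => h)) :
    HasDerivWithinAt f f' (Ici t) t := by
  rw [← hasDerivWithinAt_Ioi_iff_Ici, hasDerivWithinAt_iff_isLittleO]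
  have hlim : Tendsto (fun r : ℝ => r - t) (𝓝[>] t) (𝓝[>] 0) := by
    refine tendsto_nhdsWithin_iff.mpr ⟨?_, ?_⟩
    · have : Tendsto (fun r : ℝ => r - t) (𝓝 t) (𝓝 (t - t)) := Continuous.tendsto (by fun_prop) t
      rw [sub_self] at this
      exact this.mono_left nhdsWithin_le_nhds
    · filter_upwards [self_mem_nhdsWithin] with r hr using mem_Ioi.mpr (sub_pos.mpr (mem_Ioi.mp hr))
  simpa [Function.comp_def] using h.comp_tendsto hlim

theorem isLittleO_of_hasDerivWithinAt_Ici {E : Type*} [NormedAddCommGroup E] [NormedSpace ℝ E]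
    {f : ℝ → E} {f' : E} {t : ℝ} (h : HasDerivWithinAt f f' (Ici t) t) :
    (fun h : ℝ => f (t + h) - f t - h • f') =o[𝓝[>] 0] (fun h : ℝ => h) := by
  rw [hasDerivWithinAt_iff_isLittleO] at h
  have hlim : Tendsto (fun r : ℝ => t + r) (𝓝[>] 0) (𝓝[≥] t) := by
    refine tendsto_nhdsWithin_iff.mpr ⟨?_, ?_⟩
    · have : Tendsto (fun r : ℝ => t + r) (𝓝 0) (𝓝 (t + 0)) := Continuous.tendsto (by fun_prop) 0
      rw [add_zero] at this
      exact this.mono_left nhdsWithin_le_nhds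
    · filter_upwards [self_mem_nhdsWithin] with r hr
      exact mem_Ici.mpr (le_add_of_nonneg_right (mem_Ioi.mp hr).le)
  simpa [Function.comp_def] using h.comp_tendsto hlim

theorem totalDrift_eval {ψ : V →L[ℝ] 𝒜} (h : IsNull ψ) (v : V) :
    evalRV ψ (totalDrift A F lam v) = vectorField A F lam ψ v := by
  change evalRV ψ (ExteriorAlgebra.ι ℝ (A v) + lam • F v) = ψ (A v) + lam • evalRV ψ (F v)
  rw [map_add, map_smul, evalRV_ι h]

/-- Subtracting the Ornstein–Uhlenbeck increment removes the rough part. What is left is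
differentiable from the right, and the derivatives of ∫ B_s ∘ A and of B_t(e^{(r-t)A}v) cancel at r
= t, leaving the vector field. -/
theorem IsIntegralSolution.expansion (hA : VolterraBound A M η 0) (hΞ : IsWhiteNoise ω C Ξ)
    (hZ : IsJoint A Ξ X Z) {Ψ : ℝ → V →L[ℝ] 𝒜}
    (hΨ : IsIntegralSolution A F lam (ouForcing A Ξ X a) a b Ψ) {t : ℝ} (ht : t ∈ Ico a b) (v : V) :
    (fun h => Ψ (t + h) v - Ψ t v - h • evalRV (Ψ t) (totalDrift A F lam v)
      - Z (ExteriorAlgebra.ι ℝ (0, incrementIndex A t h v))) =o[𝓝[>] 0] (fun h : ℝ => h) := by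
  have ht' : t ∈ Icc a b := ⟨ht.1, ht.2.le⟩
  have hB := continuous_ouMotion_comp hA hΞ
  have hvf := continuousOn_vectorField (A := A) (F := F) (lam := lam) hΨ.continuousOn hΨ.isNull
  have d1 : HasDerivWithinAt (fun r => (∫ s in a..r, vectorField A F lam (Ψ s)) v)
      (vectorField A F lam (Ψ t) v) (Ici t) t :=
    ((ContinuousLinearMap.apply ℝ 𝒜 v).hasFDerivAt.comp_hasDerivWithinAt t
      (hasDerivWithinAt_integral_Ici hvf ht))
  have d2 : HasDerivWithinAt (fun r => (∫ s in a..r, (ouMotion A Ξ s).lin ∘L A) v)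
      ((ouMotion A Ξ t).lin (A v)) (Ici t) t :=
    ((ContinuousLinearMap.apply ℝ 𝒜 v).hasFDerivAt.comp_hasDerivWithinAt t
      (hB.integral_hasStrictDerivAt a t).hasDerivAt.hasDerivWithinAt)
  have d3 : HasDerivWithinAt (fun r => (ouMotion A Ξ t).lin (NormedSpace.exp ((r - t) • A) v))
      ((ouMotion A Ξ t).lin (A v)) (Ici t) t := by
    have h1 := (hasDerivAt_exp_smul_const A (t - t)).comp_sub_const t t
    have h2 := (((ouMotion A Ξ t).lin).hasFDerivAt.comp_hasDerivAt t
      ((ContinuousLinearMap.apply ℝ V v).hasFDerivAt.comp_hasDerivAt t h1)).hasDerivWithinAt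
      (s := Ici t)
    simpa [Function.comp_def] using h2
  have key := isLittleO_of_hasDerivWithinAt_Ici ((d1.sub d2).add d3)
  refine key.congr' ?_ EventuallyEq.rfl
  have hmem : Icc 0 (b - t) ∈ 𝓝[>] (0 : ℝ) :=
    mem_of_superset (Ioc_mem_nhdsGT (sub_pos.mpr ht.2)) Ioc_subset_Icc_self
  filter_upwards [hmem] with h hh
  have hth : t + h ∈ Icc a b := ⟨by linarith [hh.1, ht.1], by linarith [hh.2]⟩
  rw [totalDrift_eval (hΨ.isNull t ht'), hZ.apply_incrementIndex]
  have e1 := DFunLike.congr_fun (hΨ.equation (t + h) hth) v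
  have e2 := DFunLike.congr_fun (hΨ.equation t ht') v
  simp only [ouForcing, add_apply, sub_apply] at e1 e2
  simp only [Pi.add_apply, Pi.sub_apply, e1, e2, add_sub_cancel_left, sub_self, zero_smul,
    NormedSpace.exp_zero, one_apply_eq_self, sub_add_cancel]
  abel

theorem IsIntegralSolution.hasDerivWithinAt_expectation (hA : VolterraBound A M η 0)
    (hC : ∀ v w : V, inner ℝ (C v) w = -inner ℝ v (C w))
    (hΞ : IsWhiteNoise ω C Ξ) (hi : Independent ω X (ouProcess A Ξ)) (hZ : IsJoint A Ξ X Z)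
    (hF : ∀ v, F v ∈ ExteriorAlgebra.parity V 1) {Ψ : ℝ → V →L[ℝ] 𝒜}
    (hΨ : IsIntegralSolution A F lam (ouForcing A Ξ X a) a b Ψ) {t : ℝ} (ht : t ∈ Ico a b)
    (G : ExteriorAlgebra ℝ V) {c : 𝒜} (hc : c ∈ historyAlg Z t) :
    HasDerivWithinAt (fun t => ω (evalRV (Ψ t) G * c))
      (ω (evalRV (Ψ t) (generator C (totalDrift A F lam) G) * c)) (Ici t) t := by
  have ht' : t ∈ Icc a b := ⟨ht.1, ht.2.le⟩
  have hmem : Icc 0 (b - t) ∈ 𝓝[>] (0 : ℝ) :=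
    mem_of_superset (Ioc_mem_nhdsGT (sub_pos.mpr ht.2)) Ioc_subset_Icc_self
  have hth : ∀ h ∈ Icc 0 (b - t), t + h ∈ Icc a b := fun h hh =>
    ⟨by linarith [hh.1, ht.1], by linarith [hh.2]⟩
  have hO := isOddSubspace_oddClosure Z
  have had := fun v => hΨ.adapted hA hΞ hZ hF ht' v
  refine hasDerivWithinAt_Ici_of_isLittleO
    ((hZ.isInfinitesimalIncrement hA hΞ hi t).ito (q := fun h => Ψ (t + h)) hC
      (totalDrift_mem lam hF) (hΨ.isNull t ht') (fun v => oddClosure_le_algClosure _ (had v)) ?_ ?_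
      ?_ (hΨ.expansion hA hΞ hZ ht) G hc)
  · filter_upwards [hmem] with h hh using hΨ.isNull _ (hth h hh)
  · have hlim : Tendsto (fun r : ℝ => t + r) (𝓝[>] 0) (𝓝[Icc a b] t) := by
      refine tendsto_nhdsWithin_iff.mpr ⟨?_, ?_⟩
      · have : Tendsto (fun r : ℝ => t + r) (𝓝 0) (𝓝 (t + 0)) := Continuous.tendsto (by fun_prop) 0
        rw [add_zero] at this
        exact this.mono_left nhdsWithin_le_nhds
      · filter_upwards [hmem] with h hh using hth h hh
    exact (hΨ.continuousOn t ht').tendsto.comp hlim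
  · exact fun v w => Eventually.of_forall fun h => hO.anticomm _
      (oddClosure_restrictRV_le Z _ (had v)) _ (apply_ι_mem_oddClosure Z _)

theorem exp_mem_of_isClosed {S : Subalgebra ℝ 𝒜} (hS : IsClosed (S : Set 𝒜)) {a : 𝒜} (ha : a ∈ S) :
    NormedSpace.exp a ∈ S :=
  hS.mem_of_tendsto (hasSum_exp_real a) (Eventually.of_forall fun _ =>
    S.sum_mem fun k _ => S.smul_mem (S.pow_mem ha k) _)

theorem IsJoint.apply_mem_historyAlg (hZ : IsJoint A Ξ X Z) (t : ℝ) (G : ExteriorAlgebra ℝ V) :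
    X G ∈ historyAlg Z t := by
  have := evalRV_mem_subalgebra X.isNull_lin
    (fun v => oddClosure_le_algClosure _ (hZ.lin_mem t v)) G
  rwa [evalRV_lin] at this

theorem isClosed_algClosure {W : Type*} [AddCommGroup W] [Module ℝ W] (Y : GrassmannRV W 𝒜) :
    IsClosed (algClosure Y : Set 𝒜) := Subalgebra.isClosed_topologicalClosure _

theorem IsJoint.exp_mem_historyAlg (hZ : IsJoint A Ξ X Z) (t : ℝ) (U : ExteriorAlgebra ℝ V)
    (lam : ℝ) : NormedSpace.exp (-(lam • X U)) ∈ historyAlg Z t :=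
  exp_mem_of_isClosed (isClosed_algClosure _)
    (neg_mem (Subalgebra.smul_mem _ (hZ.apply_mem_historyAlg t U) lam))

/-- The Gibbs functional is invariant under the Langevin dynamics started from `X`. -/
theorem gibbs_invariant {D : V →L[ℝ] V} {U : ExteriorAlgebra ℝ V} (hA : VolterraBound A M η 0)
    (hC : ∀ v w : V, inner ℝ (C v) w = -inner ℝ v (C w))
    (hΞ : IsWhiteNoise ω C Ξ) (hi : Independent ω X (ouProcess A Ξ))
    (hX : IsGrassmannGaussian ω D X) (hU : U ∈ ExteriorAlgebra.parity V 0)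
    (hD : ∀ v, D (A v) = -((1 / 2 : ℝ) • C v)) {Ψ : ℝ → V →L[ℝ] 𝒜}
    (hΨ : IsIntegralSolution A (langevinDrift C U) lam (ouForcing A Ξ X a) a b Ψ) {t : ℝ}
    (ht : t ∈ Icc a b) (G : ExteriorAlgebra ℝ V) :
    ω (evalRV (Ψ t) G * NormedSpace.exp (-(lam • X U)))
      = ω (X G * NormedSpace.exp (-(lam • X U))) := by
  obtain ⟨Z, hZ⟩ := hi.1
  replace hZ : IsJoint A Ξ X Z := hZ
  set E := NormedSpace.exp (-(lam • X U)) with hE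
  have hlin : ∀ Y : GrassmannRV V 𝒜, ∃ φ : ExteriorAlgebra ℝ V →ₗ[ℝ] ℂ, ∀ G, φ G = ω (Y G * E) :=
    fun Y => ⟨(ω.toLinearMap.restrictScalars ℝ) ∘ₗ (LinearMap.mulRight ℝ E) ∘ₗ Y.toLinearMap,
      fun G => rfl⟩
  choose φ hφ using hlin
  have hF := langevinDrift_mem C hU
  have h0 : Ψ a = X.lin := by
    rw [hΨ.equation a ⟨le_rfl, ht.1.trans ht.2⟩, ouForcing_self, intervalIntegral.integral_same,
      add_zero]
  -- The difference of the tilted laws of Ψ_t and X: the constant law of X also solves the ODE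
  -- because the generator annihilates it.
  have key := eq_zero_of_linear_ode (generator C (totalDrift A (langevinDrift C U) lam))
    (fun t => φ (evalRV (Ψ t)) - φ X) (a := a) (b := b) (fun G => ?_) (fun t ht G => ?_) ?_ ht
  · have := DFunLike.congr_fun key G
    rw [LinearMap.sub_apply, LinearMap.zero_apply, sub_eq_zero, hφ, hφ] at this
    exact this
  · simp only [LinearMap.sub_apply, hφ]
    exact ((ω.continuous.comp_continuousOn
      ((continuousOn_evalRV hΨ.continuousOn hΨ.isNull G).mul continuousOn_const)).sub
      continuousOn_const)
  · have h1 := hX.generator_eq_zero hU hD lam G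
    have h2 := (hΨ.hasDerivWithinAt_expectation hA hC hΞ hi hZ hF ht G
      (hZ.exp_mem_historyAlg t U lam)).sub_const (φ X G)
    simp only [LinearMap.sub_apply, hφ] at h2 ⊢
    rwa [h1, sub_zero]
  · simp only [h0, evalRV_lin, sub_self]

end Invariance

end

noncomputable section
set_option linter.unusedSectionVars false
open Filter Topology

/-! ### Stationary solutions -/

section Mild

variable {V : Type*} [NormedAddCommGroup V] [InnerProductSpace ℝ V] [FiniteDimensional ℝ V]
  [CompleteSpace V]
variable {𝒜 : Type*} [CStarAlgebra 𝒜] {A : V →L[ℝ] V} {M η : ℝ}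
variable {F : V →ₗ[ℝ] ExteriorAlgebra ℝ V} {lam a b : ℝ}

/-- Variation of constants read backwards: both sides have the same value at a and the same right
derivative w ∘ A + k. -/
theorem mild_integral_eq (hab : a ≤ b) {x : V →L[ℝ] 𝒜} {w k : ℝ → V →L[ℝ] 𝒜} (hw : ContinuousOn w (Icc a b))
    (hk : ContinuousOn k (Icc a b))
    (h : ∀ t ∈ Icc a b, w t = x ∘L NormedSpace.exp ((t - a) • A)
      + ∫ s in a..t, k s ∘L NormedSpace.exp ((t - s) • A)) :
    ∀ t ∈ Icc a b, w t = x + ∫ s in a..t, (w s ∘L A + k s) := by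
  have hexp := continuous_exp_smul A
  set m : ℝ → V →L[ℝ] 𝒜 := fun s => k s ∘L NormedSpace.exp ((-s) • A) with hm
  have hmc : ContinuousOn m (Icc a b) :=
    hk.clm_comp ((hexp.comp continuous_neg).continuousOn)
  have hc : ContinuousOn (fun s => w s ∘L A + k s) (Icc a b) :=
    (hw.clm_comp continuousOn_const).add hk
  have hform : ∀ t ∈ Icc a b, w t = (x ∘L NormedSpace.exp ((-a) • A) + ∫ s in a..t, m s) ∘L
      NormedSpace.exp (t • A) := fun t ht => by
    have hint : IntervalIntegrable m volume a t :=
      (hmc.mono (by rw [uIcc_of_le ht.1]; exact Icc_subset_Icc_right ht.2)).intervalIntegrable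
    have h1 := (precompL 𝒜 (NormedSpace.exp (t • A))).intervalIntegral_comp_comm hint
    have h2 : (∫ s in a..t, m s) ∘L NormedSpace.exp (t • A)
        = ∫ s in a..t, k s ∘L NormedSpace.exp ((t - s) • A) := by
      refine h1.symm.trans (intervalIntegral.integral_congr fun s _ => ?_)
      change (k s ∘L NormedSpace.exp ((-s) • A)) ∘L NormedSpace.exp (t • A) = _
      rw [ContinuousLinearMap.comp_assoc, exp_smul_mul_exp_neg_smul]
    rw [h t ht, ContinuousLinearMap.add_comp, h2, ContinuousLinearMap.comp_assoc,
      exp_smul_mul_exp_neg_smul]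
  refine eq_of_has_deriv_right_eq (f' := fun t => w t ∘L A + k t) (fun t ht => ?_)
    (fun t ht => (hasDerivWithinAt_integral_Ici hc ht).const_add x) hw ?_ ?_
  · have d1 := (hasDerivWithinAt_integral_Ici hmc ht).const_add
      (x ∘L NormedSpace.exp ((-a) • A))
    have d2 := (hasDerivAt_exp_smul_const A t).hasDerivWithinAt (s := Ici t)
    have d3 := d1.clm_comp d2
    have e : m t ∘L NormedSpace.exp (t • A) + (x ∘L NormedSpace.exp ((-a) • A)
        + ∫ s in a..t, m s) ∘L (NormedSpace.exp (t • A) * A) = w t ∘L A + k t := by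
      rw [hform t ⟨ht.1, ht.2.le⟩, add_comm, hm, ContinuousLinearMap.comp_assoc (k t),
        exp_smul_mul_exp_neg_smul, sub_self, zero_smul, NormedSpace.exp_zero]
      rfl
    rw [e] at d3
    refine d3.congr_of_eventuallyEq ?_ (hform t ⟨ht.1, ht.2.le⟩)
    filter_upwards [Icc_mem_nhdsGE ht.2] with r hr
    exact hform r ⟨ht.1.trans hr.1, hr.2⟩
  · have := intervalIntegral.continuousOn_primitive_interval (μ := volume)
      (f := fun s => w s ∘L A + k s) (a := a) (b := b)
      (by rw [uIcc_of_le hab]; exact hc.integrableOn_Icc)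
    rw [uIcc_of_le hab] at this
    exact continuousOn_const.add this
  · rw [h a ⟨le_rfl, hab⟩, sub_self, zero_smul, NormedSpace.exp_zero,
      intervalIntegral.integral_same, intervalIntegral.integral_same]
    rfl

/-- The nonlinearity is bounded and Lipschitz on null maps of norm at most `R`. -/
def IsDriftBound (F : V →ₗ[ℝ] ExteriorAlgebra ℝ V) (𝒜 : Type*) [CStarAlgebra 𝒜] (R c : ℝ) : Prop :=
  0 ≤ c ∧ ∀ ψ φ : V →L[ℝ] 𝒜, IsNull ψ → IsNull φ → ‖ψ‖ ≤ R → ‖φ‖ ≤ R →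
    ‖driftMap F ψ‖ ≤ c ∧ ‖driftMap F ψ - driftMap F φ‖ ≤ c * ‖ψ - φ‖

variable {R c K : ℝ} {O : Submodule ℝ 𝒜} {g u u' : ℝ → V →L[ℝ] 𝒜}

theorem norm_smul_driftMap_le (hc : IsDriftBound F 𝒜 R c) {ψ : V →L[ℝ] 𝒜} (hψ : IsNull ψ)
    (hR : ‖ψ‖ ≤ R) : ‖lam • driftMap F ψ‖ ≤ |lam| * c := by
  rw [norm_smul, Real.norm_eq_abs]
  exact mul_le_mul_of_nonneg_left (hc.2 ψ ψ hψ hψ hR hR).1 (abs_nonneg _)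

theorem norm_smul_driftMap_sub_le (hc : IsDriftBound F 𝒜 R c) {ψ φ : V →L[ℝ] 𝒜} (hψ : IsNull ψ)
    (hφ : IsNull φ) (hR : ‖ψ‖ ≤ R) (hR' : ‖φ‖ ≤ R) :
    ‖lam • driftMap F ψ - lam • driftMap F φ‖ ≤ |lam| * c * ‖ψ - φ‖ := by
  have e : lam • driftMap F ψ - lam • driftMap F φ = lam • (driftMap F ψ - driftMap F φ) :=
    (smul_sub _ _ _).symm
  rw [e, norm_smul, Real.norm_eq_abs, mul_assoc]
  exact mul_le_mul_of_nonneg_left (hc.2 ψ φ hψ hφ hR hR').2 (abs_nonneg _)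

/-- A mild solution on the whole line, bounded by `K`, with forcing `g`. -/
structure IsMildStationary (A : V →L[ℝ] V) (F : V →ₗ[ℝ] ExteriorAlgebra ℝ V) (lam K : ℝ)
    (g u : ℝ → V →L[ℝ] 𝒜) : Prop where
  continuous : Continuous u
  isNull : ∀ t, IsNull (u t)
  norm_le : ∀ t, ‖u t‖ ≤ K
  equation : ∀ t, u t = g t + ∫ s in Iic t, (lam • driftMap F (u s)) ∘L NormedSpace.exp ((t - s) • A)

theorem exists_isMildStationary (hO : IsOddSubspace O) (hF : ∀ v, F v ∈ ExteriorAlgebra.parity V 1)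
    (hA : VolterraBound A M η 0) (hc : IsDriftBound F 𝒜 K c) (hK : 0 ≤ K) (hg : Continuous g)
    (hgO : ∀ t v, g t v ∈ O) {ρ : ℝ} (hgρ : ∀ t, ‖g t‖ ≤ ρ)
    (h1 : ρ + M * (|lam| * c) / η ≤ K) (h2 : M * (|lam| * c) / η ≤ 1 / 2) :
    ∃ u, IsMildStationary A F lam K g u ∧ ∀ t v, u t v ∈ O := by
  have hlc : 0 ≤ |lam| * c := mul_nonneg (abs_nonneg _) hc.1
  have key := exists_volterra_solution (O := fun _ => O)
    (n := fun _ x => lam • driftMap F x) (g := g) (ρ := K) (ρ₀ := ρ) (B := |lam| * c)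
    (Lp := |lam| * c) hA MeasurableSet.univ (fun _ => hO.isClosed) monotone_const hK hlc hlc
    (fun s _ x hx hxn => ?_) (fun s _ x y hx hy hxn hyn => ?_) (fun u hu hub => ?_) hg hgO
    (fun t => ?_) (by rwa [zero_add]) (by rwa [zero_add])
  · obtain ⟨u, hu, hub, hue⟩ := key
    refine ⟨u, ⟨hu, fun t => hO.isNull (hub t).1, fun t => ?_, fun t => ?_⟩, fun t => (hub t).1⟩
    · simpa using (hub t).2
    · simpa using hue t
  · rw [zero_mul, Real.exp_zero, mul_one] at hxn ⊢
    exact ⟨fun v => O.smul_mem _ (hO.driftMap_mem hF hx v),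
      norm_smul_driftMap_le hc (hO.isNull hx) hxn⟩
  · rw [zero_mul, Real.exp_zero, mul_one] at hxn hyn
    exact norm_smul_driftMap_sub_le hc (hO.isNull hx) (hO.isNull hy) hxn hyn
  · exact (continuousOn_driftMap F hu.continuousOn fun t _ => hO.isNull (hub t).1).const_smul lam
  · simpa using hgρ t

theorem IsMildStationary.continuous_drift (hu : IsMildStationary A F lam K g u) :
    Continuous fun s => lam • driftMap F (u s) :=
  continuousOn_univ.mp
    ((continuousOn_driftMap F hu.continuous.continuousOn fun t _ => hu.isNull t).const_smul lam)

theorem integrableOn_drift (hA : VolterraBound A M η 0) (hc : IsDriftBound F 𝒜 K c)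
    (hu : Continuous u) (hn : ∀ t, IsNull (u t)) (hK : ∀ t, ‖u t‖ ≤ K) (lam t : ℝ) :
    IntegrableOn (fun s => (lam • driftMap F (u s)) ∘L NormedSpace.exp ((t - s) • A)) (Iic t) := by
  have := hA.integrableOn MeasurableSet.univ
    ((continuousOn_driftMap F hu.continuousOn fun t _ => hn t).const_smul lam)
    (mul_nonneg (abs_nonneg lam) hc.1) (fun s _ => by
      simpa using norm_smul_driftMap_le hc (hn s) (hK s)) t
  rwa [univ_inter] at this

theorem IsMildStationary.integrableOn (hA : VolterraBound A M η 0) (hc : IsDriftBound F 𝒜 K c)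
    (hu : IsMildStationary A F lam K g u) (t : ℝ) :
    IntegrableOn (fun s => (lam • driftMap F (u s)) ∘L NormedSpace.exp ((t - s) • A)) (Iic t) :=
  integrableOn_drift hA hc hu.continuous hu.isNull hu.norm_le lam t

/-- Any uniform bound on the difference can be halved, starting from 2K. The competitors are only
assumed null and bounded by K; they need not lie in a common odd subspace. -/
theorem IsMildStationary.unique (hA : VolterraBound A M η 0) (hc : IsDriftBound F 𝒜 K c)
    (h2 : M * (|lam| * c) / η ≤ 1 / 2) (hu : IsMildStationary A F lam K g u)
    (hu' : IsMildStationary A F lam K g u') : u = u' := by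
  have hK : 0 ≤ K := (norm_nonneg _).trans (hu.norm_le 0)
  have step : ∀ m : ℝ, 0 ≤ m → (∀ s, ‖u s - u' s‖ ≤ m) → ∀ t, ‖u t - u' t‖ ≤ m * (1 / 2) := by
    intro m hm hs t
    have e : u t - u' t = ∫ s in univ ∩ Iic t, (lam • driftMap F (u s) - lam • driftMap F (u' s)) ∘L
        NormedSpace.exp ((t - s) • A) := by
      rw [hu.equation, hu'.equation, add_sub_add_left_eq_sub,
        ← integral_sub (hu.integrableOn hA hc t) (hu'.integrableOn hA hc t), univ_inter]
      simp only [ContinuousLinearMap.sub_comp]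
    have h := hA.norm_integral_le (h := fun s => lam • driftMap F (u s) - lam • driftMap F (u' s))
      MeasurableSet.univ (B := |lam| * c * m)
      (mul_nonneg (mul_nonneg (abs_nonneg lam) hc.1) hm) (fun s _ => by
        rw [zero_mul, Real.exp_zero, mul_one]
        exact (norm_smul_driftMap_sub_le hc (hu.isNull s) (hu'.isNull s) (hu.norm_le s)
          (hu'.norm_le s)).trans
          (mul_le_mul_of_nonneg_left (hs s) (mul_nonneg (abs_nonneg lam) hc.1))) t
    rw [← e, zero_add, zero_mul, Real.exp_zero, mul_one] at h
    calc _ ≤ _ := h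
      _ = m * (M * (|lam| * c) / η) := by ring
      _ ≤ _ := mul_le_mul_of_nonneg_left h2 hm
  have hn : ∀ n : ℕ, ∀ t, ‖u t - u' t‖ ≤ (2 * K) * (1 / 2) ^ n := by
    intro n
    induction n with
    | zero =>
      intro t
      rw [pow_zero, mul_one, two_mul]
      exact norm_sub_le_of_le (hu.norm_le t) (hu'.norm_le t)
    | succ n ih => intro t; rw [pow_succ, ← mul_assoc]; exact step _ (by positivity) ih t
  ext1 t
  have hlim : Tendsto (fun n : ℕ => (2 * K) * (1 / 2 : ℝ) ^ n) atTop (𝓝 0) := by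
    simpa using (tendsto_pow_atTop_nhds_zero_of_lt_one (by norm_num : (0 : ℝ) ≤ 1 / 2)
      (by norm_num)).const_mul (2 * K)
  exact sub_eq_zero.mp (norm_le_zero_iff.mp (ge_of_tendsto' hlim fun n => hn n t))

theorem IsMildStationary.restart (hA : VolterraBound A M η 0) (hc : IsDriftBound F 𝒜 K c)
    (hu : IsMildStationary A F lam K g u) {t : ℝ} (hat : a ≤ t) :
    u t - g t = (u a - g a) ∘L NormedSpace.exp ((t - a) • A)
      + ∫ s in Ioc a t, (lam • driftMap F (u s)) ∘L NormedSpace.exp ((t - s) • A) := by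
  have h1 := hu.integrableOn hA hc t
  have h2 := (precompL 𝒜 (NormedSpace.exp ((t - a) • A))).integral_comp_comm
    (hu.integrableOn hA hc a)
  have h3 : (u a - g a) ∘L NormedSpace.exp ((t - a) • A)
      = ∫ s in Iic a, (lam • driftMap F (u s)) ∘L NormedSpace.exp ((t - s) • A) := by
    rw [hu.equation a, add_sub_cancel_left]
    refine h2.symm.trans (integral_congr_ae (ae_of_all _ fun s => ?_))
    change ((lam • driftMap F (u s)) ∘L NormedSpace.exp ((a - s) • A)) ∘L
      NormedSpace.exp ((t - a) • A) = _
    rw [ContinuousLinearMap.comp_assoc, ← exp_add_smul]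
    congr 3; ring
  rw [hu.equation t, add_sub_cancel_left, h3, ← setIntegral_union (Iic_disjoint_Ioc le_rfl)
    measurableSet_Ioc (h1.mono_set (Iic_subset_Iic.mpr hat)) (h1.mono_set Ioc_subset_Iic_self),
    Iic_union_Ioc_eq_Iic hat]

/-- Solutions started at time `a` relax exponentially to the stationary solution. -/
theorem IsMildStationary.exists_relaxing (hO : IsOddSubspace O)
    (hF : ∀ v, F v ∈ ExteriorAlgebra.parity V 1) (hA : VolterraBound A M η 0)
    (hR : K * (1 + 4 * M) ≤ R) (hc : IsDriftBound F 𝒜 R c)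
    (hu : IsMildStationary A F lam K g u) (huO : ∀ t v, u t v ∈ O) {x : V →L[ℝ] 𝒜}
    (hx : ∀ v, x v ∈ O) (hxK : ‖x‖ ≤ K) (h2 : M * (|lam| * c) / (η / 2) ≤ 1 / 2) (a : ℝ) :
    ∃ Φ : ℝ → V →L[ℝ] 𝒜, Continuous Φ ∧ (∀ t v, Φ t v ∈ O) ∧
      (∀ t, a ≤ t → ‖Φ t - u t‖ ≤ 4 * K * M * Real.exp (-(η / 2) * (t - a))) ∧
      ∀ t, a ≤ t → Φ t - g t = (x - g a) ∘L NormedSpace.exp ((t - a) • A)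
        + ∫ s in a..t, (lam • driftMap F (Φ s)) ∘L NormedSpace.exp ((t - s) • A) := by
  have hM := hA.nonneg
  have hη : 0 < η := by simpa using hA.pos
  have hK : 0 ≤ K := (norm_nonneg _).trans hxK
  have hlc : 0 ≤ |lam| * c := mul_nonneg (abs_nonneg _) hc.1
  -- Half of the decay rate is spent on the weight e^{-ηt/2}, so the fixed point itself carries the
  -- exponential relaxation.
  have hA' : VolterraBound A M η (-(η / 2)) := ⟨hA.exp_le, by linarith⟩
  have hsum : -(η / 2) + η = η / 2 := by ring
  have hKR : K ≤ R := by nlinarith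
  have hcK : IsDriftBound F 𝒜 K c := ⟨hc.1, fun ψ φ h1 h2 h3 h4 =>
    hc.2 ψ φ h1 h2 (h3.trans hKR) (h4.trans hKR)⟩
  set ρ₀ := 2 * K * M * Real.exp (η / 2 * a) with hρ₀
  have hρ₀0 : 0 ≤ ρ₀ := by positivity
  have hweight : ∀ t, ρ₀ * Real.exp (-(η / 2) * t)
      = 2 * K * M * Real.exp (-(η / 2) * (t - a)) := fun t => by
    rw [hρ₀, mul_assoc, ← Real.exp_add]; ring_nf
  have hle1 : ∀ t, a ≤ t → Real.exp (-(η / 2) * (t - a)) ≤ 1 := fun t ht =>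
    Real.exp_le_one_iff.mpr (by nlinarith)
  -- After time a the ball of radius 2ρ₀ allows differences of norm up to 4KM; with ‖u‖ ≤ K this
  -- explains the radius K(1 + 4M).
  have hsmall : ∀ s ∈ Ioi a, ∀ y : V →L[ℝ] 𝒜, ‖y‖ ≤ 2 * ρ₀ * Real.exp (-(η / 2) * s) →
      ‖u s + y‖ ≤ R := fun s hs y hy => by
    rw [mul_assoc, hweight] at hy
    have h3 := hle1 s (mem_Ioi.mp hs).le
    have h4 : 2 * (2 * K * M * Real.exp (-(η / 2) * (s - a))) ≤ 2 * (2 * K * M * 1) := by gcongr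
    have := norm_add_le_of_le (hu.norm_le s) (hy.trans h4)
    linarith
  have huy : ∀ s, ∀ y : V →L[ℝ] 𝒜, (∀ v, y v ∈ O) → ∀ v, (u s + y) v ∈ O := fun s y hy v =>
    O.add_mem (huO s v) (hy v)
  have huR : ∀ s, ‖u s‖ ≤ R := fun s => (hu.norm_le s).trans hKR
  have key := exists_volterra_solution (I := Ioi a) (O := fun _ => O)
    (n := fun s y => lam • driftMap F (u s + y) - lam • driftMap F (u s))
    -- The fixed point theorem needs a forcing on the whole line; before a it is frozen, where the
    -- weight is at least its value at a.
    (g := fun t => (x - u a) ∘L NormedSpace.exp (max (t - a) 0 • A)) (ρ := 2 * ρ₀) (ρ₀ := ρ₀)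
    (B := |lam| * c * (2 * ρ₀))
    (Lp := |lam| * c) hA' measurableSet_Ioi (fun _ => hO.isClosed) monotone_const (by positivity)
    (by positivity) hlc
    (fun s hs y hy hyn => ?_) (fun s hs y z hy hz hyn hzn => ?_) (fun w hw hwb => ?_)
    (continuous_const.clm_comp ((continuous_exp_smul A).comp (by fun_prop)))
    (fun t v => O.sub_mem (hx _) (huO _ _))
    (fun t => ?_) ?_ ?_
  · obtain ⟨δ, hδ, hδb, hδe⟩ := key
    refine ⟨fun t => u t + δ t, hu.continuous.add hδ, fun t v => huy t _ (hδb t).1 v,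
      fun t ht => ?_, fun t ht => ?_⟩
    · rw [add_sub_cancel_left]
      refine (hδb t).2.trans (le_of_eq ?_)
      rw [mul_assoc, hweight]; ring
    · have hcn : ContinuousOn (fun s => lam • driftMap F (u s + δ s) - lam • driftMap F (u s))
          (Ioi a) :=
        ((continuousOn_driftMap F (hu.continuous.add hδ).continuousOn fun s _ =>
          hO.isNull (huy s _ (hδb s).1)).const_smul lam).sub hu.continuous_drift.continuousOn
      have hi1 := (hu.integrableOn hA hcK t).mono_set (Ioc_subset_Iic_self (a := a))
      have hi2 := hA'.integrableOn measurableSet_Ioi hcn (B := |lam| * c * (2 * ρ₀))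
        (by positivity) (fun s hs => by
          have := norm_smul_driftMap_sub_le (lam := lam) hc
            (hO.isNull (huy s _ (hδb s).1)) (hu.isNull s)
            (hsmall s hs _ (hδb s).2) (huR s)
          rw [add_sub_cancel_left] at this
          refine this.trans ?_
          rw [mul_assoc (|lam| * c)]
          exact mul_le_mul_of_nonneg_left (hδb s).2 hlc) t
      rw [Ioi_inter_Iic] at hi2
      have e0 : u t + δ t - g t = (u t - g t) + δ t := by abel
      rw [e0, hu.restart hA hcK ht, hδe t, Ioi_inter_Iic, max_eq_left (sub_nonneg.mpr ht),
        intervalIntegral.integral_of_le ht]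
      have e1 : ∫ s in Ioc a t, (lam • driftMap F (u s + δ s)) ∘L NormedSpace.exp ((t - s) • A)
          = (∫ s in Ioc a t, (lam • driftMap F (u s)) ∘L NormedSpace.exp ((t - s) • A))
            + ∫ s in Ioc a t, (lam • driftMap F (u s + δ s) - lam • driftMap F (u s)) ∘L
              NormedSpace.exp ((t - s) • A) := by
        rw [← integral_add hi1 hi2]
        refine integral_congr_ae (ae_of_all _ fun s => ?_)
        simp only [ContinuousLinearMap.sub_comp]
        abel
      rw [e1]
      simp only [ContinuousLinearMap.sub_comp]
      abel
  · refine ⟨fun v => O.sub_mem (O.smul_mem _ (hO.driftMap_mem hF (huy s y hy) v))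
      (O.smul_mem _ (hO.driftMap_mem hF (huO s) v)), ?_⟩
    have := norm_smul_driftMap_sub_le (lam := lam) hc (hO.isNull (huy s y hy)) (hu.isNull s)
      (hsmall s hs y hyn) (huR s)
    rw [add_sub_cancel_left] at this
    refine this.trans ?_
    rw [mul_assoc (|lam| * c)]
    exact mul_le_mul_of_nonneg_left hyn hlc
  · have := norm_smul_driftMap_sub_le (lam := lam) hc (hO.isNull (huy s y hy))
      (hO.isNull (huy s z hz)) (hsmall s hs y hyn) (hsmall s hs z hzn)
    rwa [add_sub_add_left_eq_sub, ← sub_sub_sub_cancel_right _ _ (lam • driftMap F (u s))] at this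
  · exact ((continuousOn_driftMap F (hu.continuous.add hw).continuousOn fun s _ =>
      hO.isNull (huy s _ (hwb s).1)).const_smul lam).sub hu.continuous_drift.continuousOn
  · rw [hweight]
    have h3 : ‖x - u a‖ ≤ 2 * K := by
      rw [two_mul]; exact norm_sub_le_of_le hxK (hu.norm_le a)
    have h4 := hA.exp_le (max (t - a) 0) (le_max_right _ _)
    have h5 : Real.exp (-η * max (t - a) 0) ≤ Real.exp (-(η / 2) * (t - a)) := by
      refine Real.exp_le_exp.mpr ?_
      have h6 := le_max_left (t - a) 0
      have h7 := le_max_right (t - a) 0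
      nlinarith
    calc _ ≤ ‖x - u a‖ * ‖NormedSpace.exp (max (t - a) 0 • A)‖ :=
          ContinuousLinearMap.opNorm_comp_le _ _
      _ ≤ (2 * K) * (M * Real.exp (-(η / 2) * (t - a))) :=
          mul_le_mul h3 (h4.trans (mul_le_mul_of_nonneg_left h5 hM)) (norm_nonneg _) (by positivity)
      _ = _ := by ring
  · rw [hsum]
    have : M * (|lam| * c * (2 * ρ₀)) / (η / 2) = 2 * ρ₀ * (M * (|lam| * c) / (η / 2)) := by ring
    rw [this]
    nlinarith
  · rw [hsum]; exact h2

end Mild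

end

noncomputable section
set_option linter.unusedSectionVars false
open Filter Topology

/-! ### The equation started at time zero -/

section InitialValue

variable {V : Type*} [NormedAddCommGroup V] [InnerProductSpace ℝ V] [FiniteDimensional ℝ V]
  [CompleteSpace V]
variable {𝒜 : Type*} [CStarAlgebra 𝒜] {ω : 𝒜 →L[ℂ] ℂ} {A C : V →L[ℝ] V} {M η : ℝ}
variable {Ξ : GrassmannRV (L2 V) 𝒜} {X : GrassmannRV V 𝒜}
variable {F : V →ₗ[ℝ] ExteriorAlgebra ℝ V} {lam a b : ℝ}

theorem intervalIntegral_clm_apply {k : ℝ → V →L[ℝ] 𝒜} (hab : a ≤ b)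
    (hk : ContinuousOn k (Icc a b)) (v : V) :
    (∫ s in a..b, k s) v = ∫ s in a..b, k s v :=
  ((ContinuousLinearMap.apply ℝ 𝒜 v).intervalIntegral_comp_comm
    (ContinuousOn.intervalIntegrable (by rwa [uIcc_of_le hab]))).symm

theorem vectorField_lin_apply (Y : GrassmannRV V 𝒜) (v : V) :
    vectorField A F lam Y.lin v = Y (ExteriorAlgebra.ι ℝ (A v)) + lam • Y (F v) := by
  rw [← driftMap_lin F]; rfl

theorem forcing_add_integral_apply (hA : VolterraBound A M η 0) (hΞ : IsWhiteNoise ω C Ξ) {t : ℝ}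
    (ht : 0 ≤ t) {Ψ : ℝ → GrassmannRV V 𝒜}
    (hΨ : ContinuousOn (fun t => (Ψ t).lin) (Icc 0 t)) (v : V) :
    (ouForcing A Ξ X 0 t + ∫ s in (0 : ℝ)..t, vectorField A F lam (Ψ s).lin) v
      = X (ExteriorAlgebra.ι ℝ v)
      + (∫ s in (0 : ℝ)..t, (Ψ s (ExteriorAlgebra.ι ℝ (A v)) + lam • Ψ s (F v)))
      + brownianMotion Ξ t v := by
  have hvf := continuousOn_vectorField (A := A) (F := F) (lam := lam) hΨ
    fun t _ => (Ψ t).isNull_lin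
  rw [brownianMotion_eq hA hΞ ht, add_apply, intervalIntegral_clm_apply ht hvf, ouForcing,
    sub_apply, add_apply, sub_apply,
    intervalIntegral_clm_apply ht (continuous_ouMotion_comp hA hΞ).continuousOn]
  simp only [vectorField_lin_apply, ContinuousLinearMap.comp_apply, GrassmannRV.lin_apply X]
  abel

theorem IsSDESolution.isIntegralSolution (hA : VolterraBound A M η 0) (hΞ : IsWhiteNoise ω C Ξ)
    {Ψ : ℝ → GrassmannRV V 𝒜} (hΨ : IsSDESolution A F lam Ξ X Ψ) (b : ℝ) :
    IsIntegralSolution A F lam (ouForcing A Ξ X 0) 0 b (fun t => (Ψ t).lin) where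
  continuousOn := hΨ.continuousOn.mono Icc_subset_Ici_self
  isNull t _ := (Ψ t).isNull_lin
  equation t ht := by
    ext v
    rw [forcing_add_integral_apply hA hΞ ht.1 (hΨ.continuousOn.mono Icc_subset_Ici_self),
      GrassmannRV.lin_apply, hΨ.equation t ht.1]

theorem exists_isSDESolution (hA : VolterraBound A M η 0) (hΞ : IsWhiteNoise ω C Ξ)
    (hi : Independent ω X (ouProcess A Ξ)) (hF : ∀ v, F v ∈ ExteriorAlgebra.parity V 1) (lam : ℝ) :
    ∃ Ψ : ℝ → GrassmannRV V 𝒜, IsSDESolution A F lam Ξ X Ψ := by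
  obtain ⟨Z, hZ⟩ := hi.1
  replace hZ : IsJoint A Ξ X Z := hZ
  have hO := isOddSubspace_oddClosure Z
  have hle := oddClosure_restrictRV_le Z
  obtain ⟨Ψ, hn, hΨ⟩ := exists_global_solution (A := A) (F := F) (lam := lam)
    (y := fun t => ouForcing A Ξ X 0 (max 0 t)) hO hF
    ((continuous_ouForcing hA hΞ X 0).comp (by fun_prop))
    (fun t => ouForcing_mem hA hΞ hO.isClosed (fun v => hle _ (hZ.lin_mem 0 v)) (le_max_left _ _)
      fun s _ v => hle _ (hZ.ouMotion_mem (le_refl s) v)) 0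
  have hlin : ∀ t, (evalRV (Ψ t)).lin = Ψ t := fun t => lin_evalRV (hn t)
  refine ⟨fun t => evalRV (Ψ t), ?_, fun t ht v => ?_⟩
  · simp only [hlin]
    intro t ht
    refine ((hΨ (t + 1)).continuousOn t ⟨ht, by linarith⟩).mono_of_mem_nhdsWithin ?_
    exact inter_mem self_mem_nhdsWithin
      (nhdsWithin_le_nhds (Iic_mem_nhds (by linarith)))
  · have hc : ContinuousOn (fun t => (evalRV (Ψ t)).lin) (Icc 0 t) := by
      simpa only [hlin] using (hΨ t).continuousOn
    rw [← forcing_add_integral_apply hA hΞ ht hc, ← GrassmannRV.lin_apply]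
    simp only [hlin]
    have := (hΨ t).equation t ⟨ht, le_rfl⟩
    rw [max_eq_right ht] at this
    exact DFunLike.congr_fun this v

/-- The Gibbs functional is an invariant measure of the Langevin dynamics. -/
theorem gibbs_isInvariantMeasure {D : V →L[ℝ] V} {U : ExteriorAlgebra ℝ V}
    (hA : VolterraBound A M η 0) (hC : ∀ v w : V, inner ℝ (C v) w = -inner ℝ v (C w))
    (hΞ : IsWhiteNoise ω C Ξ) (hi : Independent ω X (ouProcess A Ξ))
    (hX : IsGrassmannGaussian ω D X) (hU : U ∈ ExteriorAlgebra.parity V 0)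
    (hD : ∀ v, D (A v) = -((1 / 2 : ℝ) • C v)) (lam : ℝ) :
    IsInvariantMeasure (tilt ω (NormedSpace.exp (-(lam • X U)))) A (langevinDrift C U) lam Ξ X := by
  refine ⟨exists_isSDESolution hA hΞ hi (langevinDrift_mem C hU) lam, fun Ψ hΨ t ht G => ?_⟩
  have hs := hΨ.isIntegralSolution hA hΞ t
  have h1 := gibbs_invariant hA hC hΞ hi hX hU hD hs ⟨ht, le_rfl⟩ G
  have h2 := gibbs_invariant hA hC hΞ hi hX hU hD hs ⟨le_rfl, ht⟩ G
  rw [evalRV_lin] at h1 h2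
  exact h1.trans h2.symm

end InitialValue

/-! ### The law of the stationary solution -/

section Stationary

variable {V : Type*} [NormedAddCommGroup V] [InnerProductSpace ℝ V] [FiniteDimensional ℝ V]
  [CompleteSpace V]
variable {𝒜 : Type*} [CStarAlgebra 𝒜] {ω : 𝒜 →L[ℂ] ℂ} {A C : V →L[ℝ] V} {M η : ℝ}
variable {Ξ : GrassmannRV (L2 V) 𝒜} {X : GrassmannRV V 𝒜} {Z : GrassmannRV (V × (ℝ →₀ V)) 𝒜}
variable {F : V →ₗ[ℝ] ExteriorAlgebra ℝ V} {lam K c : ℝ}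

theorem Independent.apply_algClosure {W W' : Type*} [AddCommGroup W] [Module ℝ W]
    [AddCommGroup W'] [Module ℝ W'] {X : GrassmannRV W 𝒜} {Y : GrassmannRV W' 𝒜}
    (h : Independent ω X Y) {e d : 𝒜} (he : e ∈ algClosure X) (hd : d ∈ algClosure Y) :
    ω (e * d) = ω e * ω d := by
  have hed : (e, d) ∈ closure ((X.range : Set 𝒜) ×ˢ (Y.range : Set 𝒜)) := by
    rw [closure_prod_eq]; exact ⟨he, hd⟩
  refine closure_minimal (t := {x : 𝒜 × 𝒜 | ω (x.1 * x.2) = ω x.1 * ω x.2}) ?_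
    (isClosed_eq (by fun_prop) (by fun_prop)) hed
  rintro ⟨_, _⟩ ⟨⟨G, rfl⟩, ⟨H, rfl⟩⟩
  exact h.2 G H

theorem apply_mem_algClosure {W : Type*} [AddCommGroup W] [Module ℝ W] (Y : GrassmannRV W 𝒜)
    (G : ExteriorAlgebra ℝ W) : Y G ∈ algClosure Y := subset_closure ⟨G, rfl⟩

theorem IsJoint.commute_of_even (hZ : IsJoint A Ξ X Z) {U : ExteriorAlgebra ℝ V}
    (hU : U ∈ ExteriorAlgebra.parity V 0) {d : 𝒜} (hd : d ∈ algClosure (ouProcess A Ξ)) :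
    Commute (X U) d := by
  refine closure_minimal (t := {d | X U * d = d * X U}) ?_
    (isClosed_eq (by fun_prop) (by fun_prop)) hd
  rintro _ ⟨H, rfl⟩
  change X U * ouProcess A Ξ H = ouProcess A Ξ H * X U
  induction H using ExteriorAlgebra.right_induction with
  | algebraMap r => rw [AlgHom.commutes]; exact (Algebra.commutes r _).symm
  | add x y hx hy => rw [map_add, mul_add, add_mul, hx, hy]
  | mul_ι x w hx =>
    have h1 : X U = Z (ExteriorAlgebra.map (LinearMap.inl ℝ V (ℝ →₀ V)) U) :=
      (DFunLike.congr_fun hZ.comp_inl U).symm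
    have h2 : ouProcess A Ξ (ExteriorAlgebra.ι ℝ w) = Z (ExteriorAlgebra.ι ℝ (0, w)) := by
      rw [hZ, map_zero, map_zero, zero_add]
    have h3 : ouProcess A Ξ (ExteriorAlgebra.ι ℝ w) * X U
        = X U * ouProcess A Ξ (ExteriorAlgebra.ι ℝ w) := by
      rw [h1, h2, ← map_mul, ← map_mul, ExteriorAlgebra.ι_mul_eq, ExteriorAlgebra.map_involute,
        ExteriorAlgebra.involute_of_even hU]
    rw [map_mul, ← mul_assoc, hx, mul_assoc, mul_assoc, h3]

/-- The difference Φ - B solves a mild equation without rough forcing, so `mild_integral_eq` applies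
to it; adding B back gives `ouForcing`. -/
theorem isIntegralSolution_of_mild (hA : VolterraBound A M η 0) (hΞ : IsWhiteNoise ω C Ξ) {a b : ℝ}
    (hab : a ≤ b) {Φ : ℝ → V →L[ℝ] 𝒜} (hΦ : Continuous Φ) (hn : ∀ t, IsNull (Φ t))
    (h : ∀ t, a ≤ t → Φ t - (ouMotion A Ξ t).lin
      = (X.lin - (ouMotion A Ξ a).lin) ∘L NormedSpace.exp ((t - a) • A)
        + ∫ s in a..t, (lam • driftMap F (Φ s)) ∘L NormedSpace.exp ((t - s) • A)) :
    IsIntegralSolution A F lam (ouForcing A Ξ X a) a b Φ := by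
  have hdrift : Continuous fun s => lam • driftMap F (Φ s) :=
    continuousOn_univ.mp
      ((continuousOn_driftMap F hΦ.continuousOn fun t _ => hn t).const_smul lam)
  have hvf : Continuous fun s => vectorField A F lam (Φ s) :=
    continuousOn_univ.mp (continuousOn_vectorField hΦ.continuousOn fun t _ => hn t)
  have hB := continuous_ouMotion_comp hA hΞ
  refine ⟨hΦ.continuousOn, fun t _ => hn t, fun t ht => ?_⟩
  have key := mild_integral_eq hab (w := fun t => Φ t - (ouMotion A Ξ t).lin)
    (hΦ.sub (continuous_ouMotion hA hΞ)).continuousOn hdrift.continuousOn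
    (fun t ht => h t ht.1) t ht
  have e : ∫ s in a..t, ((Φ s - (ouMotion A Ξ s).lin) ∘L A + lam • driftMap F (Φ s))
      = (∫ s in a..t, vectorField A F lam (Φ s)) - ∫ s in a..t, (ouMotion A Ξ s).lin ∘L A := by
    rw [← intervalIntegral.integral_sub (hvf.intervalIntegrable _ _) (hB.intervalIntegrable _ _)]
    refine intervalIntegral.integral_congr fun s _ => ?_
    simp only [vectorField, ContinuousLinearMap.sub_comp]
    abel
  rw [e] at key
  rw [sub_eq_iff_eq_add.mp key, ouForcing]
  abel

/-- The law of the stationary solution is the Gibbs functional. -/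
theorem IsMildStationary.expectation {D : V →L[ℝ] V} {U : ExteriorAlgebra ℝ V}
    {u : ℝ → V →L[ℝ] 𝒜} (hA : VolterraBound A M η 0)
    (hC : ∀ v w : V, inner ℝ (C v) w = -inner ℝ v (C w))
    (hΞ : IsWhiteNoise ω C Ξ) (hi : Independent ω X (ouProcess A Ξ))
    (hX : IsGrassmannGaussian ω D X) (hU : U ∈ ExteriorAlgebra.parity V 0)
    (hD : ∀ v, D (A v) = -((1 / 2 : ℝ) • C v))
    {R : ℝ} (hR : K * (1 + 4 * M) ≤ R) (hc : IsDriftBound (langevinDrift C U) 𝒜 R c)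
    (h2 : M * (|lam| * c) / (η / 2) ≤ 1 / 2) (hXK : ‖X.lin‖ ≤ K)
    (hu : IsMildStationary A (langevinDrift C U) lam K (fun t => (ouMotion A Ξ t).lin) u)
    (huY : ∀ t v, u t v ∈ oddClosure (ouProcess A Ξ)) (t : ℝ) (G : ExteriorAlgebra ℝ V) :
    ω (X G * NormedSpace.exp (-(lam • X U)))
      = ω (evalRV (u t) G) * ω (NormedSpace.exp (-(lam • X U))) := by
  obtain ⟨Z, hZ⟩ := hi.1
  replace hZ : IsJoint A Ξ X Z := hZ
  have hη : 0 < η := by simpa using hA.pos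
  have hF := langevinDrift_mem C hU
  have hO := isOddSubspace_oddClosure Z
  have hle : oddClosure (ouProcess A Ξ) ≤ oddClosure Z := by
    rw [← hZ.comp_inr]; exact oddClosure_comp_map_le _ _
  set E := NormedSpace.exp (-(lam • X U)) with hE
  -- Solutions started from the same X at every initial time a. For a = t - n their tilted law at
  -- time t is that of X, and as n grows they converge to u_t.
  choose Φ hΦc hΦO hΦu hΦe using fun a => hu.exists_relaxing hO hF hA hR hc
    (fun t v => hle (huY t v))
    (fun v => oddClosure_restrictRV_le Z _ (hZ.lin_mem 0 v)) hXK h2 a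
  have hinv : ∀ n : ℕ, ω (evalRV (Φ (t - n) t) G * E) = ω (X G * E) := fun n => by
    have hn : t - n ≤ t := sub_le_self _ n.cast_nonneg
    exact gibbs_invariant hA hC hΞ hi hX hU hD
      (isIntegralSolution_of_mild hA hΞ hn (hΦc _) (fun s => hO.isNull (hΦO _ s)) (hΦe _))
      ⟨hn, le_rfl⟩ G
  have hlim : Tendsto (fun n : ℕ => Φ (t - n) t) atTop (𝓝 (u t)) := by
    rw [tendsto_iff_norm_sub_tendsto_zero]
    refine squeeze_zero (fun _ => norm_nonneg _) (fun n =>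
      hΦu (t - n) t (sub_le_self _ n.cast_nonneg)) ?_
    have h1 : Tendsto (fun n : ℕ => -(η / 2) * (t - (t - (n : ℝ)))) atTop atBot := by
      simp only [sub_sub_cancel]
      exact tendsto_natCast_atTop_atTop.const_mul_atTop_of_neg (by linarith)
    simpa using (Real.tendsto_exp_atBot.comp h1).const_mul (4 * K * M)
  have h3 : Tendsto (fun n : ℕ => ω (evalRV (Φ (t - n) t) G * E)) atTop
      (𝓝 (ω (evalRV (u t) G * E))) :=
    (ω.continuous.tendsto _).comp ((tendsto_evalRV hlim
      (Eventually.of_forall fun n => hO.isNull (hΦO _ t)) (hu.isNull t) G).mul_const E)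
  simp only [hinv] at h3
  have hY : evalRV (u t) G ∈ algClosure (ouProcess A Ξ) :=
    evalRV_mem_subalgebra (hu.isNull t) (fun v => oddClosure_le_algClosure _ (huY t v)) G
  have hEX : E ∈ algClosure X := exp_mem_of_isClosed (isClosed_algClosure _)
    (neg_mem (Subalgebra.smul_mem _ (apply_mem_algClosure X U) lam))
  -- The independence hypothesis has the function of X on the left; E is a function of the even
  -- element X(U) and can be moved there.
  have hcomm : Commute E (evalRV (u t) G) :=
    Commute.exp_left (((hZ.commute_of_even hU hY).smul_left lam).neg_left)
  rw [tendsto_nhds_unique tendsto_const_nhds h3, ← hcomm.eq, hi.apply_algClosure hEX hY, mul_comm]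

theorem integral_drift_apply (hA : VolterraBound A M η 0) (hc : IsDriftBound F 𝒜 K c)
    {Ψ : ℝ → GrassmannRV V 𝒜} (hΨ : Continuous fun t => (Ψ t).lin) (hK : ∀ t, ‖(Ψ t).lin‖ ≤ K)
    (lam t : ℝ) (v : V) :
    (∫ s in Iic t, (lam • driftMap F (Ψ s).lin) ∘L NormedSpace.exp ((t - s) • A)) v
      = lam • ∫ τ in Iic t, Ψ τ (F (NormedSpace.exp ((t - τ) • A) v)) := by
  have h := (ContinuousLinearMap.apply ℝ 𝒜 v).integral_comp_comm
    (integrableOn_drift hA hc hΨ (fun t => (Ψ t).isNull_lin) hK lam t)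
  refine h.symm.trans ?_
  rw [← integral_smul]
  refine integral_congr_ae (ae_of_all _ fun s => ?_)
  change lam • driftMap F (Ψ s).lin (NormedSpace.exp ((t - s) • A) v) = _
  rw [driftMap_lin]

theorem isStationarySolution_iff (hA : VolterraBound A M η 0) (hc : IsDriftBound F 𝒜 K c)
    {Ψ : ℝ → GrassmannRV V 𝒜} :
    IsStationarySolution A F lam Ξ K Ψ ↔
      IsMildStationary A F lam K (fun t => (ouMotion A Ξ t).lin) (fun t => (Ψ t).lin) := by
  constructor
  · intro h
    refine ⟨h.continuous, fun t => (Ψ t).isNull_lin, h.norm_le, fun t => ?_⟩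
    ext v
    rw [add_apply, integral_drift_apply hA hc h.continuous h.norm_le, add_comm]
    exact h.equation t v
  · intro h
    refine ⟨h.continuous, h.norm_le, fun t v => ?_⟩
    have := DFunLike.congr_fun (h.equation t) v
    rw [add_apply, integral_drift_apply hA hc h.continuous h.norm_le, add_comm] at this
    exact this

end Stationary

end

/-! ### Choice of constants and conclusion -/

theorem theorem40 (V : Type*) [NormedAddCommGroup V] [InnerProductSpace ℝ V] [CompleteSpace V]
    [FiniteDimensional ℝ V] (F : V →ₗ[ℝ] ExteriorAlgebra ℝ V) (K L lamA M : ℝ)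
    (hK : 0 < K) (hlamA : 0 < lamA) :
    ∃ lam0 : ℝ, 0 < lam0 ∧
      ∀ (𝒜 : Type*) [CStarAlgebra 𝒜] (ω : 𝒜 →L[ℂ] ℂ) (A C : V →L[ℝ] V)
        (U : ExteriorAlgebra ℝ V) (Ξ : GrassmannRV (MeasureTheory.Lp V 2
          (MeasureTheory.volume : MeasureTheory.Measure ℝ)) 𝒜) (X : GrassmannRV V 𝒜),
        IsState ω →
        (∀ v w : V, inner ℝ (C v) w = -inner ℝ v (C w)) →
        EigenvaluesLE A lamA →
        growthConst A lamA ≤ M →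
        ContinuousLinearMap.adjoint A ∘L ouCovariance A C = ouCovariance A C ∘L A →
        U ∈ CliffordAlgebra.evenOdd (0 : QuadraticForm ℝ V) 0 →
        F = langevinDrift C U →
        IsWhiteNoise ω C Ξ →
        IsGrassmannGaussian ω (ouCovariance A C) X →
        Independent ω X (ouProcess A Ξ) →
        (⨆ t : ℝ, ‖(ouMotion A Ξ t).lin‖) = L →
        L ≤ K / 3 →
        ‖X.lin‖ ≤ K / 8 →
        (∀ lam : ℝ,
          IsInvariantMeasure (tilt ω (NormedSpace.exp (-(lam • X U)))) A F lam Ξ X) ∧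
        ∀ lam : ℝ, |lam| ≤ lam0 →
          ∃ Ψs : ℝ → GrassmannRV V 𝒜,
            IsStationarySolution A F lam Ξ K Ψs ∧
            (∀ Ψ : ℝ → GrassmannRV V 𝒜, IsStationarySolution A F lam Ξ K Ψ → Ψ = Ψs) ∧
            ∀ (t : ℝ) (G : ExteriorAlgebra ℝ V),
              ω (X G * NormedSpace.exp (-(lam • X U)))
                = ω (Ψs t G) * ω (NormedSpace.exp (-(lam • X U))) := by
  -- The radius required by the relaxation estimate. The sign of `M` is known only once an operator
  -- A with growth bound `M` is given, hence the absolute value.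
  obtain ⟨c, hc0, hc⟩ := exists_driftMap_bound F (R := K * (1 + 4 * |M|)) (by positivity)
  have hden : 0 < 8 * (|M| + 1) * (c + 1) := by positivity
  have hmin : 0 < min 1 K := lt_min one_pos hK
  -- This gives M|λ|c ≤ lamA · min(1, K)/8. The factor 1 yields contraction by ½ even at the halved
  -- rate lamA/4; the factor K keeps the integral term below K/4, which fits since L ≤ K/3. The
  -- summands 1 avoid division by zero.
  refine ⟨lamA * min 1 K / (8 * (|M| + 1) * (c + 1)), by positivity, ?_⟩
  intro 𝒜 _ ω A C U Ξ X _ hC hA hM hcomm hU hFU hΞ hX hi hL hLK hXK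
  subst hFU
  have hη : 0 < lamA / 2 := by positivity
  have hV : VolterraBound A M (lamA / 2) 0 :=
    ⟨fun t ht => norm_exp_le_of_growthConst_le A hlamA hA hM ht, by rwa [zero_add]⟩
  have hM0 := hV.nonneg
  rw [abs_of_nonneg hM0] at hc hden ⊢
  -- Detailed balance: by the commutation hypothesis the two terms of the Lyapunov equation
  -- coincide.
  have hD : ∀ v, ouCovariance A C (A v) = -((1 / 2 : ℝ) • C v) := fun v => by
    have h := adjoint_comp_ouCovariance_add A C hlamA hA
    rw [hcomm, ← two_smul ℝ] at h
    have h' : (2 : ℝ) • ouCovariance A C (A v) = -(C v) := DFunLike.congr_fun h v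
    rw [← smul_neg, ← h', smul_smul]
    norm_num
  refine ⟨gibbs_isInvariantMeasure hV hC hΞ hi hX hU hD, fun lam hlam => ?_⟩
  have hR : IsDriftBound (langevinDrift C U) 𝒜 (K * (1 + 4 * M)) c := ⟨hc0, hc 𝒜⟩
  have hKR : K ≤ K * (1 + 4 * M) := by nlinarith
  have hcK : IsDriftBound (langevinDrift C U) 𝒜 K c := ⟨hc0, fun ψ φ h1 h2 h3 h4 =>
    hc 𝒜 ψ φ h1 h2 (h3.trans hKR) (h4.trans hKR)⟩
  have hsmall : M * (|lam| * c) ≤ lamA * min 1 K / 8 := by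
    calc M * (|lam| * c) ≤ (M + 1) * (lamA * min 1 K / (8 * (M + 1) * (c + 1)) * (c + 1)) := by
          gcongr <;> linarith
      _ = _ := by field_simp
  have hsmall1 : M * (|lam| * c) ≤ lamA / 8 := hsmall.trans (by nlinarith [min_le_left 1 K])
  have hsmallK : M * (|lam| * c) ≤ lamA * K / 8 := hsmall.trans (by nlinarith [min_le_right 1 K])
  have h2 : M * (|lam| * c) / (lamA / 2) ≤ 1 / 2 := by rw [div_le_iff₀ hη]; linarith
  have h2' : M * (|lam| * c) / (lamA / 2 / 2) ≤ 1 / 2 := by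
    rw [div_le_iff₀ (by positivity)]; linarith
  have h1 : L + M * (|lam| * c) / (lamA / 2) ≤ K := by
    have : M * (|lam| * c) / (lamA / 2) ≤ K / 4 := by rw [div_le_iff₀ hη]; linarith
    linarith
  have hBL : ∀ t, ‖(ouMotion A Ξ t).lin‖ ≤ L := fun t => by
    obtain ⟨d, hd⟩ := exists_norm_ouMotion_le hV hΞ
    rw [← hL]
    exact le_ciSup (f := fun t => ‖(ouMotion A Ξ t).lin‖)
      ⟨d, by rintro _ ⟨s, rfl⟩; exact hd s⟩ t
  -- Solving inside the odd closure of the Ornstein–Uhlenbeck process alone makes the stationary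
  -- solution independent of X.
  obtain ⟨u, hu, huO⟩ := exists_isMildStationary (lam := lam)
    (isOddSubspace_oddClosure (ouProcess A Ξ)) (langevinDrift_mem C hU) hV hcK hK.le
    (continuous_ouMotion hV hΞ)
    (fun t v => by
      have := apply_ι_mem_oddClosure (ouProcess A Ξ) (Finsupp.single t v)
      rwa [ouProcess_single] at this) hBL h1 h2
  have hlin : (fun t => (evalRV (u t)).lin) = u := funext fun t => lin_evalRV (hu.isNull t)
  have hst := (isStationarySolution_iff (Ψ := fun t => evalRV (u t)) hV hcK).mpr (hlin ▸ hu)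
  refine ⟨fun t => evalRV (u t), hst, fun Ψ hΨ => ?_, ?_⟩
  · have h := ((isStationarySolution_iff hV hcK).mp hΨ).unique hV hcK h2 hu
    funext t
    refine GrassmannRV.lin_injective ?_
    rw [lin_evalRV (hu.isNull t)]
    exact congrFun h t
  · exact hu.expectation hV hC hΞ hi hX hU hD le_rfl hR h2' (hXK.trans (by linarith)) huO
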